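/- Let $U\subseteq\mathbb R^3$ be open with coordinates $(u^1,u^2,u^3)=(u,v,w)$. Let $\hat{\mathcal A}$ be the super-commutative ring of differential polynomials generated over $C^\infty(U)$ by the even jet variables $u^{\alpha,s}$ ($s\ge 1$; $u^{\alpha,0}=u^\alpha$) and the odd jet variables $\theta_\alpha^s$ ($s\ge 0$; $\theta_\alpha=\theta_\alpha^0$), with $$\partial_x=\sum_{s\ge0}\Big(u^{\alpha,s+1}\frac{\partial}{\partial u^{\alpha,s}}+\theta_\alpha^{s+1}\frac{\partial}{\partial\theta_\alpha^s}\Big),$$ and let $\hat{\mathcal F}=\hat{\mathcal A}[[\varepsilon]]/\partial_x\hat{\mathcal A}[[\varepsilon]]$ be the space of local functionals $\int f\,dx$. For local functionals $F=\int f\,dx$ of super degree $p$ (degree in the $\theta$'s) and $G$, the Schouten bracket is $$[F,G]=\int\Big(\frac{\delta F}{\delta\theta_\alpha}\frac{\delta G}{\delta u^\alpha}+(-1)^p\frac{\delta F}{\delta u^\alpha}\frac{\delta G}{\delta\theta_\alpha}\Big)dx,\qquad \frac{\delta F}{\delta u^\alpha}=\sum_{s\ge0}(-\partial_x)^s\frac{\partial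 f}{\partial u^{\alpha,s}},\quad \frac{\delta F}{\delta\theta_\alpha}=\sum_{s\ge0}(-\partial_x)^s\frac{\partial f}{\partial\theta_\alpha^s}.$$ To a matrix $\mathcal Q=(\mathcal Q^{\alpha\beta})$ of differential operators in $\partial_x$ (formal power series in $\varepsilon$, with coefficients in the differential polynomials in the $u^{\alpha,s}$ and of finite order at each power of $\varepsilon$) one assigns $\iota(\mathcal Q)=\frac12\int\theta_\alpha\,\mathcal Q^{\alpha\beta}\theta_\beta\,dx$. $\mathcal Q$ is called Hamiltonian if it is skew-symmetric ($(\mathcal Q^{\alpha\beta})^\dagger=-\mathcal Q^{\beta\alpha}$) and $[\iota(\mathcal Q),\iota(\mathcal Q)]=0$; two Hamiltonian operators are compatible, and form a bihamiltonian structure, if all their real linear combinations are Hamiltonian. Let $\Lambda=e^{\varepsilon\partial_x}$; rational expressions in $\Lambda$ are expanded as power series in $\varepsilon\partial_x$. Theorem. The operators associated with the rational reduction of the 2D-Toda hierarchy of type $(2,1)$, whose Lax operator is $L=(1-w\Lambda^{-1})^{-1}(\Lambda^2+u\Lambda+v)$, $$\mathcal P_1=\begin{pmatrix}\Lambda-\Lambda^{-1}&w\Lambda^{-1}-\Lambda^2w&0\\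 w\Lambda^{-2}-\Lambda w&w\Lambda^{-1}u-u\Lambda w&(\Lambda-1)w\\ 0&w(1-\Lambda^{-1})&0\end{pmatrix},$$ $$\mathcal P_2=\begin{pmatrix}\Lambda v-v\Lambda^{-1}+u\frac{1-\Lambda}{1+\Lambda}u&0&u\frac{\Lambda-1}{1+\Lambda^{-1}}w\\ 0&0&v(\Lambda-1)w\\ w\frac{1-\Lambda^{-1}}{\Lambda+1}u&w(1-\Lambda^{-1})v&w\frac{\Lambda^2-\Lambda^{-1}}{\Lambda+1}w\end{pmatrix},$$ form a bihamiltonian structure: both are Hamiltonian, and they are compatible. In particular $[I_2,I_2]=[I_1,I_2]=0$ for $I_a=\iota(\mathcal P_a)$. Moreover, if $w>0$ on $U$, then $$z^1=v+(\Lambda^{-1}u)\,w+(\Lambda^{-1}w)\,w,\qquad z^2=\frac{\sqrt2}{\Lambda+1}(u+w),\qquad z^3=\log w$$ are new coordinates (at $\varepsilon=0$ they are functions on $U$ with nowhere vanishing Jacobian determinant) in which $\mathcal P_1$ is constant: with the Jacobian operator $\mathcal J=\big(\sum_{s\ge0}\frac{\partial z^\alpha}{\partial u^{\beta,s}}\partial_x^s\big)$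 and its adjoint $\mathcal J^\dagger$, $$\mathcal J\mathcal P_1\mathcal J^\dagger=\begin{pmatrix}0&0&\Lambda-1\\ 0&2\frac{\Lambda-1}{\Lambda+1}&0\\ 1-\Lambda^{-1}&0&0\end{pmatrix}.$$ -/

import Mathlib

open scoped Manifold ContDiff TensorProduct PowerSeries
open TopologicalSpace (Opens)

namespace SuperJet

variable {n : ℕ}

/-! ### Smooth functions on a coordinate domain -/

/-- The ring `C^∞(U)` of smooth real functions on an open set `U ⊆ ℝⁿ`. -/
abbrev Smooth (U : Opens (Fin n → ℝ)) : Type := C^∞⟮𝓘(ℝ, Fin n → ℝ), U; ℝ⟯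

variable {U : Opens (Fin n → ℝ)}

/-- Extension by zero to `ℝⁿ`; only its germs at points of `U` are used. -/
noncomputable def Smooth.ext0 (f : Smooth U) : (Fin n → ℝ) → ℝ :=
  Function.extend Subtype.val f 0

theorem Smooth.ext0_apply (f : Smooth U) (x : U) : f.ext0 x = f x :=
  Subtype.val_injective.extend_apply _ _ _

theorem Smooth.contDiffAt (f : Smooth U) (x : U) : ContDiffAt ℝ ∞ f.ext0 x := by
  rw [← contMDiffAt_iff_contDiffAt, ← contMDiffAt_subtype_iff]
  have : (fun x : U => f.ext0 x) = f := funext f.ext0_apply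
  rw [this]
  exact f.contMDiff x

theorem Smooth.eventuallyEq {f : Smooth U} {g : (Fin n → ℝ) → ℝ} (h : ∀ x : U, f x = g x)
    (x : U) : f.ext0 =ᶠ[nhds (x : Fin n → ℝ)] g := by
  filter_upwards [U.isOpen.mem_nhds x.2] with y hy
  rw [← h ⟨y, hy⟩]; exact f.ext0_apply ⟨y, hy⟩

theorem Smooth.contMDiff_fderiv (f : Smooth U) (v : Fin n → ℝ) :
    ContMDiff 𝓘(ℝ, Fin n → ℝ) 𝓘(ℝ, ℝ) ∞ (fun x : U => fderiv ℝ f.ext0 x v) := by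
  intro x
  refine (contMDiffAt_subtype_iff (f := fun x => fderiv ℝ f.ext0 x v)).mpr ?_
  rw [contMDiffAt_iff_contDiffAt]
  have h : ContDiffAt ℝ ∞ (fderiv ℝ f.ext0) x :=
    (f.contDiffAt x).fderiv_right (m := ∞) (by exact le_rfl)
  exact h.clm_apply contDiffAt_const

/-- The partial derivative `∂f/∂u^α` of a smooth function. -/
noncomputable def Smooth.pdFun (α : Fin n) (f : Smooth U) : Smooth U :=
  ⟨fun x => fderiv ℝ f.ext0 x (Pi.single α 1), f.contMDiff_fderiv _⟩

theorem Smooth.pdFun_apply (α : Fin n) (f : Smooth U) (x : U) :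
    Smooth.pdFun α f x = fderiv ℝ f.ext0 x (Pi.single α 1) := rfl

/-- The partial derivative `∂/∂u^α` as a derivation of `C^∞(U)`. -/
noncomputable def Smooth.pd (α : Fin n) : Derivation ℝ (Smooth U) (Smooth U) :=
  Derivation.mk'
    { toFun := Smooth.pdFun α
      map_add' := fun f g => by
        ext x
        have h := (Smooth.eventuallyEq (f := f + g) (g := f.ext0 + g.ext0) (fun x => by
          simp [Smooth.ext0_apply]) x).fderiv_eq (𝕜 := ℝ)
        rw [ContMDiffMap.coe_add, Pi.add_apply, Smooth.pdFun_apply, Smooth.pdFun_apply,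
          Smooth.pdFun_apply, h, fderiv_add ((f.contDiffAt x).differentiableAt (by simp))
          ((g.contDiffAt x).differentiableAt (by simp))]
        rfl
      map_smul' := fun c f => by
        ext x
        have h := (Smooth.eventuallyEq (f := c • f) (g := c • f.ext0) (fun x => by
          simp [Smooth.ext0_apply]) x).fderiv_eq (𝕜 := ℝ)
        rw [RingHom.id_apply, ContMDiffMap.coe_smul, Pi.smul_apply, Smooth.pdFun_apply,
          Smooth.pdFun_apply, h, fderiv_const_smul ((f.contDiffAt x).differentiableAt (by simp))]
        rfl }
    (fun f g => by
        ext x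
        have h := (Smooth.eventuallyEq (f := f * g) (g := f.ext0 * g.ext0) (fun x => by
          simp [Smooth.ext0_apply]) x).fderiv_eq (𝕜 := ℝ)
        change Smooth.pdFun α (f * g) x = f x * Smooth.pdFun α g x + g x * Smooth.pdFun α f x
        rw [Smooth.pdFun_apply, Smooth.pdFun_apply, Smooth.pdFun_apply, h,
          fderiv_mul ((f.contDiffAt x).differentiableAt (by simp))
          ((g.contDiffAt x).differentiableAt (by simp))]
        simp [Smooth.ext0_apply])

theorem Smooth.pd_apply (α : Fin n) (f : Smooth U) (x : U) :
    Smooth.pd α f x = fderiv ℝ f.ext0 x (Pi.single α 1) := rfl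

theorem Smooth.pd_comm (α β : Fin n) (f : Smooth U) :
    Smooth.pd α (Smooth.pd β f) = Smooth.pd β (Smooth.pd α f) := by
  ext x
  have key : ∀ α β : Fin n, Smooth.pd α (Smooth.pd β f) x =
      fderiv ℝ (fderiv ℝ f.ext0) x (Pi.single α 1) (Pi.single β 1) := by
    intro α β
    rw [Smooth.pd_apply, (Smooth.eventuallyEq (f := Smooth.pd β f)
      (g := fun y => fderiv ℝ f.ext0 y (Pi.single β 1)) (fun _ => rfl) x).fderiv_eq (𝕜 := ℝ)]
    have h : DifferentiableAt ℝ (fderiv ℝ f.ext0) x :=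
      ((f.contDiffAt x).fderiv_right (m := 1) (by norm_cast)).differentiableAt (by simp)
    rw [fderiv_clm_apply h (by fun_prop)]
    simp
  rw [key, key]
  exact ((f.contDiffAt x).isSymmSndFDerivAt (by simp; norm_cast)).eq _ _

/-- The coordinate function `u^α` on `U`. -/
noncomputable def Smooth.coord (U : Opens (Fin n → ℝ)) (α : Fin n) : Smooth U :=
  ⟨fun x => (x : Fin n → ℝ) α,
    ((contDiff_apply ℝ ℝ α).contMDiff).comp contMDiff_subtype_val⟩

/-! ### Differential polynomials on the jet space -/

/-- The ring of differential polynomials `C^∞(U)[u^{α,s} : s ≥ 1]`; the variable `X (α, s)` is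
`u^{α,s+1}`. -/
abbrev DiffPoly (U : Opens (Fin n → ℝ)) : Type := MvPolynomial (Fin n × ℕ) (Smooth U)

/-- A derivation of `C^∞(U)` applied to the coefficients, as a linear map. -/
noncomputable def onCoeffsLin (D : Derivation ℝ (Smooth U) (Smooth U)) :
    DiffPoly U →ₗ[ℝ] DiffPoly U :=
  (AddMonoidAlgebra.coeffLinearEquiv ℝ).symm.toLinearMap ∘ₗ
    Finsupp.mapRange.linearMap D.toLinearMap ∘ₗ (AddMonoidAlgebra.coeffLinearEquiv ℝ).toLinearMap

theorem onCoeffsLin_monomial (D : Derivation ℝ (Smooth U) (Smooth U)) (m : Fin n × ℕ →₀ ℕ)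
    (c : Smooth U) :
    onCoeffsLin D (MvPolynomial.monomial m c) = MvPolynomial.monomial m (D c) := by
  change (AddMonoidAlgebra.coeffLinearEquiv ℝ).symm
    (Finsupp.mapRange.linearMap D.toLinearMap (Finsupp.single m c)) = _
  rw [Finsupp.mapRange.linearMap_apply, Finsupp.mapRange_single]
  rfl

/-- A derivation of `C^∞(U)` applied to the coefficients of differential polynomials. -/
noncomputable def onCoeffs (D : Derivation ℝ (Smooth U) (Smooth U)) :
    Derivation ℝ (DiffPoly U) (DiffPoly U) :=
  Derivation.mk' (onCoeffsLin D) (fun p q => by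
    induction p using MvPolynomial.induction_on' with
    | monomial a b =>
      induction q using MvPolynomial.induction_on' with
      | monomial c d =>
        simp only [MvPolynomial.monomial_mul, onCoeffsLin_monomial, Derivation.leibniz,
          smul_eq_mul, map_add, add_comm c a]
      | add p q hp hq => simp only [mul_add, map_add, hp, hq, smul_eq_mul, add_mul]; ring
    | add p q hp hq => simp only [mul_add, map_add, hp, hq, smul_eq_mul, add_mul]; ring)

theorem onCoeffs_C (D : Derivation ℝ (Smooth U) (Smooth U)) (c : Smooth U) :
    onCoeffs D (MvPolynomial.C c) = MvPolynomial.C (D c) := onCoeffsLin_monomial D 0 c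

theorem onCoeffs_X (D : Derivation ℝ (Smooth U) (Smooth U)) (i : Fin n × ℕ) :
    onCoeffs D (MvPolynomial.X i : DiffPoly U) = 0 := by
  refine (onCoeffsLin_monomial D (Finsupp.single i 1) 1).trans ?_
  simp

/-- The partial derivative `∂/∂u^{α,s}` on differential polynomials. -/
noncomputable def pdU (α : Fin n) : ℕ → Derivation ℝ (DiffPoly U) (DiffPoly U)
  | 0 => onCoeffs (Smooth.pd α)
  | s + 1 => (MvPolynomial.pderiv (α, s)).restrictScalars ℝ

/-- The total derivative `∑ u^{α,s+1} ∂/∂u^{α,s}` on differential polynomials: the derivation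
with `f ↦ ∑ u^{α,1} ∂f/∂u^α` for `f ∈ C^∞(U)`, and `u^{α,s+1} ↦ u^{α,s+2}`. -/
noncomputable def totalU : Derivation ℝ (DiffPoly U) (DiffPoly U) :=
  ∑ α, (MvPolynomial.X (α, 0) : DiffPoly U) • onCoeffs (Smooth.pd α) +
    (MvPolynomial.mkDerivation (Smooth U)
      (fun i : Fin n × ℕ => (MvPolynomial.X (i.1, i.2 + 1) : DiffPoly U))).restrictScalars ℝ

theorem derivation_diffPoly_ext {D₁ D₂ : Derivation ℝ (DiffPoly U) (DiffPoly U)}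
    (hC : ∀ c, D₁ (MvPolynomial.C c) = D₂ (MvPolynomial.C c))
    (hX : ∀ i, D₁ (MvPolynomial.X i) = D₂ (MvPolynomial.X i)) : D₁ = D₂ := by
  ext1 p
  induction p using MvPolynomial.induction_on with
  | C a => exact hC a
  | add p q hp hq => rw [map_add, map_add, hp, hq]
  | mul_X p i hp => rw [Derivation.leibniz, Derivation.leibniz, hp, hX]

theorem derivation_sum_apply {ι : Type*} (t : Finset ι)
    (D : ι → Derivation ℝ (DiffPoly U) (DiffPoly U)) (p : DiffPoly U) :
    (∑ i ∈ t, D i) p = ∑ i ∈ t, D i p := by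
  have := map_sum (Derivation.coeFnAddMonoidHom (R := ℝ) (A := DiffPoly U) (M := DiffPoly U)) D t
  exact (congrFun this p).trans (Finset.sum_apply _ _ _)

theorem totalU_C (c : Smooth U) : totalU (MvPolynomial.C c : DiffPoly U) =
    ∑ α, MvPolynomial.X (α, 0) * MvPolynomial.C (Smooth.pd α c) := by
  simp [totalU, Derivation.add_apply, derivation_sum_apply, onCoeffs_C]

theorem totalU_X (i : Fin n × ℕ) : totalU (MvPolynomial.X i : DiffPoly U) =
    MvPolynomial.X (i.1, i.2 + 1) := by
  simp [totalU, Derivation.add_apply, derivation_sum_apply, onCoeffs_X]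

theorem pdU_zero_totalU (α : Fin n) (p : DiffPoly U) :
    pdU α 0 (totalU p) = totalU (pdU α 0 p) := by
  have h : ⁅(pdU α 0 : Derivation ℝ (DiffPoly U) (DiffPoly U)), (totalU : Derivation ℝ (DiffPoly U) (DiffPoly U))⁆ = 0 := by
    refine derivation_diffPoly_ext (fun c => ?_) (fun i => ?_)
    · simp only [Derivation.commutator_apply, pdU, totalU_C, onCoeffs_C, map_sum,
        Derivation.leibniz, onCoeffs_X, smul_eq_mul, Smooth.pd_comm α]
      simp
    · simp [Derivation.commutator_apply, pdU, totalU_X, onCoeffs_X]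
  have := congrArg (fun D => D p) h
  simpa [Derivation.commutator_apply, sub_eq_zero] using this

theorem pdU_succ_totalU (α : Fin n) (s : ℕ) (p : DiffPoly U) :
    pdU α (s + 1) (totalU p) = totalU (pdU α (s + 1) p) + pdU α s p := by
  have h : ⁅(pdU α (s + 1) : Derivation ℝ (DiffPoly U) (DiffPoly U)),
      (totalU : Derivation ℝ (DiffPoly U) (DiffPoly U))⁆ = pdU α s := by
    refine derivation_diffPoly_ext (fun c => ?_) (fun i => ?_)
    · cases s with
      | zero =>
        simp only [Derivation.commutator_apply, pdU, totalU_C, onCoeffs_C, map_sum,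
          Derivation.leibniz, smul_eq_mul, Derivation.restrictScalars_apply]
        simp [MvPolynomial.pderiv_X, Pi.single_apply]
      | succ s =>
        simp only [Derivation.commutator_apply, pdU, totalU_C, map_sum,
          Derivation.leibniz, smul_eq_mul, Derivation.restrictScalars_apply]
        simp [MvPolynomial.pderiv_X]
    · cases s with
      | zero =>
        simp only [Derivation.commutator_apply, pdU, totalU_X, onCoeffs_X,
          Derivation.restrictScalars_apply, MvPolynomial.pderiv_X, Pi.single_apply]
        split_ifs <;> simp_all
      | succ s =>
        simp only [Derivation.commutator_apply, pdU, totalU_X,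
          Derivation.restrictScalars_apply, MvPolynomial.pderiv_X, Pi.single_apply]
        split_ifs <;> simp_all [Prod.ext_iff]
  have := congrArg (fun D => D p) h
  rw [← this]
  simp [Derivation.commutator_apply]

theorem pdU_finite (α : Fin n) (p : DiffPoly U) : {s | pdU α s p ≠ 0}.Finite := by
  classical
  refine ((p.vars.image fun i => i.2 + 1) ∪ {0}).finite_toSet.subset fun s hs => ?_
  cases s with
  | zero => simp
  | succ s =>
    simp only [Finset.coe_union, Finset.coe_image, Set.mem_union]
    left
    refine ⟨(α, s), ?_, rfl⟩
    by_contra hv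
    exact hs (MvPolynomial.pderiv_eq_zero_of_notMem_vars hv)

/-! ### The odd variables `θ_α^s` -/

/-- The Grassmann algebra on the odd variables `θ_α^s`. -/
abbrev Grass (n : ℕ) : Type := ExteriorAlgebra ℝ (Fin n × ℕ →₀ ℝ)

/-- The odd variable `θ_α^s` in the Grassmann algebra. -/
noncomputable def Grass.gen (α : Fin n) (s : ℕ) : Grass n :=
  ExteriorAlgebra.ι ℝ (Finsupp.single (α, s) 1)

/-- The left derivative `∂/∂θ_α^s`, i.e. contraction with the coordinate `(α, s)`:
`∂(θ_β^t x) = δ x - θ_β^t ∂x`. -/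
noncomputable def pdT (α : Fin n) (s : ℕ) : Grass n →ₗ[ℝ] Grass n :=
  CliffordAlgebra.contractLeft (Q := (0 : QuadraticForm ℝ (Fin n × ℕ →₀ ℝ)))
    (Finsupp.lapply (α, s))

/-- The linear map `θ_α^s ↦ θ_α^{s+1}` on generators. -/
noncomputable def shiftT : (Fin n × ℕ →₀ ℝ) →ₗ[ℝ] (Fin n × ℕ →₀ ℝ) :=
  Finsupp.lmapDomain ℝ ℝ (fun i : Fin n × ℕ => (i.1, i.2 + 1))


/-- The algebra map `θ_α^s ↦ θ_α^s + ε θ_α^{s+1}` to the dual numbers `ε² = 0` over the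
Grassmann algebra; it sends `x` to `x + ε ∂ₓx`. -/
noncomputable def totalTHom : Grass n →ₐ[ℝ] TrivSqZeroExt (Grass n) (Grass n) :=
  ExteriorAlgebra.lift ℝ
    ⟨(TrivSqZeroExt.inlAlgHom ℝ (Grass n) (Grass n)).toLinearMap ∘ₗ ExteriorAlgebra.ι ℝ +
      (TrivSqZeroExt.inrHom (Grass n) (Grass n)).restrictScalars ℝ ∘ₗ
        ExteriorAlgebra.ι ℝ ∘ₗ shiftT, fun v => by
      ext
      · simp
      · simp⟩

/-- The total derivative on the Grassmann algebra: the even derivation with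
`θ_α^s ↦ θ_α^{s+1}`. -/
noncomputable def totalT : Grass n →ₗ[ℝ] Grass n :=
  (TrivSqZeroExt.sndHom (Grass n) (Grass n)).restrictScalars ℝ ∘ₗ totalTHom.toLinearMap

theorem totalTHom_fst (x : Grass n) : (totalTHom x).fst = x := by
  have h : (TrivSqZeroExt.fstHom ℝ (Grass n) (Grass n)).comp totalTHom = AlgHom.id ℝ _ := by
    ext v
    simp [totalTHom]
  exact congrArg (fun f => f x) h

theorem totalT_mul (x y : Grass n) : totalT (x * y) = totalT x * y + x * totalT y := by
  simp [totalT, totalTHom_fst, add_comm]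

theorem totalT_ι (v : Fin n × ℕ →₀ ℝ) :
    totalT (ExteriorAlgebra.ι ℝ v) = ExteriorAlgebra.ι ℝ (shiftT v) := by
  simp [totalT, totalTHom]

theorem totalT_algebraMap (r : ℝ) : totalT (algebraMap ℝ (Grass n) r) = 0 := by
  have h := (totalTHom (n := n)).commutes r
  simp only [totalT, LinearMap.comp_apply, AlgHom.toLinearMap_apply, h]
  rfl

theorem totalT_gen (α : Fin n) (s : ℕ) : totalT (Grass.gen α s) = Grass.gen α (s + 1) := by
  simp [Grass.gen, totalT_ι, shiftT]

theorem pdT_ι_mul (α : Fin n) (s : ℕ) (v : Fin n × ℕ →₀ ℝ) (x : Grass n) :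
    pdT α s (ExteriorAlgebra.ι ℝ v * x) = v (α, s) • x - ExteriorAlgebra.ι ℝ v * pdT α s x :=
  CliffordAlgebra.contractLeft_ι_mul (Q := (0 : QuadraticForm ℝ (Fin n × ℕ →₀ ℝ)))
    (Finsupp.lapply (α, s)) v x

theorem pdT_algebraMap (α : Fin n) (s : ℕ) (r : ℝ) : pdT α s (algebraMap ℝ (Grass n) r) = 0 :=
  CliffordAlgebra.contractLeft_algebraMap (0 : QuadraticForm ℝ (Fin n × ℕ →₀ ℝ))
    (Finsupp.lapply (α, s)) r

theorem Grass.induction {P : Grass n → Prop} (h0 : ∀ r, P (algebraMap ℝ _ r))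
    (hadd : ∀ x y, P x → P y → P (x + y))
    (hmul : ∀ v x, P x → P (ExteriorAlgebra.ι ℝ v * x)) (x : Grass n) : P x :=
  CliffordAlgebra.left_induction (Q := (0 : QuadraticForm ℝ (Fin n × ℕ →₀ ℝ)))
    h0 hadd (fun x v hx => hmul v x hx) x

theorem shiftT_zero (v : Fin n × ℕ →₀ ℝ) (α : Fin n) : shiftT v (α, 0) = 0 := by
  refine Finsupp.mapDomain_of_notMem_range _ _ ?_
  rintro ⟨i, hi⟩
  simp at hi

theorem shiftT_succ (v : Fin n × ℕ →₀ ℝ) (α : Fin n) (s : ℕ) :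
    shiftT v (α, s + 1) = v (α, s) := by
  have hinj : Function.Injective (fun i : Fin n × ℕ => (i.1, i.2 + 1)) := by
    rintro ⟨a, b⟩ ⟨c, d⟩ h
    simpa using h
  exact Finsupp.mapDomain_apply hinj v (α, s)

theorem pdT_zero_totalT (α : Fin n) (x : Grass n) :
    pdT α 0 (totalT x) = totalT (pdT α 0 x) := by
  induction x using Grass.induction with
  | h0 r => simp [totalT_algebraMap, pdT_algebraMap]
  | hadd x y hx hy => simp only [map_add, hx, hy]
  | hmul v x hx =>
    simp only [totalT_mul, totalT_ι, map_add, pdT_ι_mul, shiftT_zero, map_sub, map_smul, hx]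
    simp only [zero_smul]
    abel

theorem pdT_succ_totalT (α : Fin n) (s : ℕ) (x : Grass n) :
    pdT α (s + 1) (totalT x) = totalT (pdT α (s + 1) x) + pdT α s x := by
  induction x using Grass.induction with
  | h0 r => simp [totalT_algebraMap, pdT_algebraMap]
  | hadd x y hx hy => simp only [map_add, hx, hy]; abel
  | hmul v x hx =>
    simp only [totalT_mul, totalT_ι, map_add, pdT_ι_mul, shiftT_succ, map_sub, map_smul, hx,
      mul_add]
    abel

theorem pdT_finite (α : Fin n) (x : Grass n) : {s | pdT α s x ≠ 0}.Finite := by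
  induction x using Grass.induction with
  | h0 r => simp [pdT_algebraMap]
  | hadd x y hx hy =>
    refine (hx.union hy).subset fun s hs => ?_
    by_contra h
    simp only [Set.mem_union, Set.mem_ofPred_eq, not_or, not_not] at h
    exact hs (by rw [map_add, h.1, h.2, add_zero])
  | hmul v x hx =>
    refine (hx.union (v.support.image Prod.snd).finite_toSet).subset fun s hs => ?_
    by_contra h
    simp only [Set.mem_union, Set.mem_ofPred_eq, not_or, not_not] at h
    have hv : v (α, s) = 0 := by
      by_contra hv
      exact h.2 (Finset.mem_coe.2 (Finset.mem_image.2 ⟨(α, s), by simpa using hv, rfl⟩))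
    exact hs (by rw [pdT_ι_mul, h.1, hv, zero_smul, mul_zero, sub_zero])

/-! ### The super jet space -/

/-- The ring of differential polynomials in the jet variables `u^{α,s}` and the odd jet variables
`θ_α^s`. -/
abbrev Super (U : Opens (Fin n → ℝ)) : Type := DiffPoly U ⊗[ℝ] Grass n

/-- `∂ₓ = ∑ (u^{α,s+1} ∂/∂u^{α,s} + θ_α^{s+1} ∂/∂θ_α^s)`. -/
noncomputable def dx : Super U →ₗ[ℝ] Super U :=
  TensorProduct.map totalU.toLinearMap LinearMap.id + TensorProduct.map LinearMap.id totalT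

/-- `∂/∂u^{α,s}`. -/
noncomputable def du (α : Fin n) (s : ℕ) : Super U →ₗ[ℝ] Super U :=
  TensorProduct.map (pdU α s).toLinearMap LinearMap.id

/-- `∂/∂θ_α^s` (left derivative). -/
noncomputable def dθ (α : Fin n) (s : ℕ) : Super U →ₗ[ℝ] Super U :=
  TensorProduct.map LinearMap.id (pdT α s)

theorem du_zero_dx (α : Fin n) (f : Super U) : du α 0 (dx f) = dx (du α 0 f) := by
  induction f using TensorProduct.induction_on with
  | zero => simp
  | tmul p x => simp [du, dx, pdU_zero_totalU]
  | add f g hf hg => simp only [map_add, hf, hg]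

theorem du_succ_dx (α : Fin n) (s : ℕ) (f : Super U) :
    du α (s + 1) (dx f) = dx (du α (s + 1) f) + du α s f := by
  induction f using TensorProduct.induction_on with
  | zero => simp
  | tmul p x => simp [du, dx, pdU_succ_totalU, TensorProduct.add_tmul]; abel
  | add f g hf hg => simp only [map_add, hf, hg]; abel

theorem dθ_zero_dx (α : Fin n) (f : Super U) : dθ α 0 (dx f) = dx (dθ α 0 f) := by
  induction f using TensorProduct.induction_on with
  | zero => simp
  | tmul p x => simp [dθ, dx, pdT_zero_totalT]
  | add f g hf hg => simp only [map_add, hf, hg]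

theorem dθ_succ_dx (α : Fin n) (s : ℕ) (f : Super U) :
    dθ α (s + 1) (dx f) = dx (dθ α (s + 1) f) + dθ α s f := by
  induction f using TensorProduct.induction_on with
  | zero => simp
  | tmul p x => simp [dθ, dx, pdT_succ_totalT, TensorProduct.tmul_add]; abel
  | add f g hf hg => simp only [map_add, hf, hg]; abel

theorem du_finite (α : Fin n) (f : Super U) : {s | du α s f ≠ 0}.Finite := by
  induction f using TensorProduct.induction_on with
  | zero => simp
  | tmul p x =>
    refine (pdU_finite α p).subset fun s hs h => hs ?_
    simp only [du, TensorProduct.map_tmul, Derivation.coeFn_coe, h, TensorProduct.zero_tmul]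
  | add f g hf hg =>
    refine (hf.union hg).subset fun s hs => ?_
    by_contra h
    simp only [Set.mem_union, Set.mem_ofPred_eq, not_or, not_not] at h
    exact hs (by rw [map_add, h.1, h.2, add_zero])

theorem dθ_finite (α : Fin n) (f : Super U) : {s | dθ α s f ≠ 0}.Finite := by
  induction f using TensorProduct.induction_on with
  | zero => simp
  | tmul p x =>
    refine (pdT_finite α x).subset fun s hs h => hs ?_
    simp only [dθ, TensorProduct.map_tmul, h, TensorProduct.tmul_zero]
  | add f g hf hg =>
    refine (hf.union hg).subset fun s hs => ?_
    by_contra h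
    simp only [Set.mem_union, Set.mem_ofPred_eq, not_or, not_not] at h
    exact hs (by rw [map_add, h.1, h.2, add_zero])

/-- `∑_s (-∂)^s ∘ P_s` for a family of linear maps `P_s` that is finite on every element. -/
noncomputable def varDer {V : Type*} [AddCommGroup V] [Module ℝ V] (d : V →ₗ[ℝ] V)
    (P : ℕ → V →ₗ[ℝ] V) (hP : ∀ f, {s | P s f ≠ 0}.Finite) : V →ₗ[ℝ] V where
  toFun f := ∑ᶠ s, ((-d) ^ s) (P s f)
  map_add' f g := by
    simp only [map_add]
    refine finsum_add_distrib ((hP f).subset ?_) ((hP g).subset ?_) <;>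
    · intro s hs h
      exact hs (by simp only [h, map_zero])
  map_smul' c f := by
    simp only [map_smul, RingHom.id_apply]
    refine (smul_finsum' c ((hP f).subset ?_)).symm
    intro s hs h
    exact hs (by simp only [h, map_zero])

theorem varDer_d {V : Type*} [AddCommGroup V] [Module ℝ V] {d : V →ₗ[ℝ] V}
    {P : ℕ → V →ₗ[ℝ] V} (hP : ∀ f, {s | P s f ≠ 0}.Finite)
    (h0 : ∀ f, P 0 (d f) = d (P 0 f)) (hs : ∀ s f, P (s + 1) (d f) = d (P (s + 1) f) + P s f)
    (f : V) : varDer d P hP (d f) = 0 := by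
  obtain ⟨N, hN⟩ : ∃ N, ∀ s, N ≤ s → P s f = 0 := by
    obtain ⟨N, hN⟩ := (hP f).bddAbove
    refine ⟨N + 1, fun s hs => ?_⟩
    by_contra h
    have := hN h
    omega
  have hsum : ∀ M, ∑ s ∈ Finset.range (M + 1), ((-d) ^ s) (P s (d f)) =
      ((-d) ^ M) (d (P M f)) := by
    intro M
    induction M with
    | zero => simp [h0]
    | succ M ih =>
      rw [Finset.sum_range_succ, ih, hs, map_add, pow_succ (-d) M]
      simp
  change ∑ᶠ s, ((-d) ^ s) (P s (d f)) = 0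
  rw [finsum_eq_sum_of_support_subset (s := Finset.range (N + 2)), hsum, hN _ (by omega)]
  · simp
  · intro s hs'
    simp only [Finset.coe_range, Set.mem_Iio]
    by_contra h
    obtain ⟨t, rfl⟩ : ∃ t, s = t + 1 := ⟨s - 1, by omega⟩
    exact hs' (by simp only [hs, hN t (by omega), hN (t + 1) (by omega), map_zero, add_zero])

/-! ### Formal power series in the dispersion parameter and local functionals -/

/-- Differential polynomials on the super jet space, with formal power series in the dispersion
parameter `ε` as coefficients; the variable `PowerSeries.X` is `ε`. -/
abbrev SuperE (U : Opens (Fin n → ℝ)) : Type := (Super U)⟦X⟧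

theorem coeff_smulE {V : Type*} [Ring V] [Algebra ℝ V] (k : ℕ) (c : ℝ) (f : V⟦X⟧) :
    PowerSeries.coeff k (c • f) = c • PowerSeries.coeff k f :=
  (PowerSeries.coeff k).map_smul_of_tower c f

/-- A linear map applied to each coefficient of a power series in `ε`. -/
noncomputable def coeffwise {V W : Type*} [Ring V] [Ring W] [Algebra ℝ V] [Algebra ℝ W]
    (L : V →ₗ[ℝ] W) : V⟦X⟧ →ₗ[ℝ] W⟦X⟧ where
  toFun f := PowerSeries.mk fun k => L (PowerSeries.coeff k f)
  map_add' f g := by ext k; simp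
  map_smul' c f := by
    ext k
    rw [PowerSeries.coeff_mk, RingHom.id_apply, coeff_smulE, coeff_smulE, map_smul,
      PowerSeries.coeff_mk]

/-- `∂ₓ` on power series in `ε`. -/
noncomputable def Dx : SuperE U →ₗ[ℝ] SuperE U := coeffwise dx

/-- The space of local functionals: densities modulo total `x`-derivatives. -/
abbrev LocalFunctional (U : Opens (Fin n → ℝ)) : Type :=
  SuperE U ⧸ LinearMap.range (Dx : SuperE U →ₗ[ℝ] SuperE U)

/-- The projection `f ↦ ∫ f dx` of densities to local functionals. -/
noncomputable def integral : SuperE U →ₗ[ℝ] LocalFunctional U := Submodule.mkQ _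

/-- The variational derivative `δF/δu^α = ∑ (-∂ₓ)^s ∂f/∂u^{α,s}` of `F = ∫ f dx`. -/
noncomputable def δu (α : Fin n) : LocalFunctional U →ₗ[ℝ] SuperE U :=
  Submodule.liftQ _ (coeffwise (varDer dx (du α) (du_finite α))) (by
    rintro _ ⟨f, rfl⟩
    rw [LinearMap.mem_ker]
    ext k
    simp [coeffwise, Dx, varDer_d (du_finite α) (du_zero_dx α) (du_succ_dx α)])

/-- The variational derivative `δF/δθ_α = ∑ (-∂ₓ)^s ∂f/∂θ_α^s` of `F = ∫ f dx`. -/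
noncomputable def δθ (α : Fin n) : LocalFunctional U →ₗ[ℝ] SuperE U :=
  Submodule.liftQ _ (coeffwise (varDer dx (dθ α) (dθ_finite α))) (by
    rintro _ ⟨f, rfl⟩
    rw [LinearMap.mem_ker]
    ext k
    simp [coeffwise, Dx, varDer_d (dθ_finite α) (dθ_zero_dx α) (dθ_succ_dx α)])

/-- The Schouten bracket `[F, G]` of a local functional `F` of super degree `p` with a local
functional `G`. -/
noncomputable def schouten (p : ℕ) (F G : LocalFunctional U) : LocalFunctional U :=
  integral (∑ α, (δθ α F * δu α G + (-1) ^ p * (δu α F * δθ α G)))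

/-! ### Differential operators -/

/-- Functions on the jet space (super degree zero) as elements of the super ring. -/
noncomputable def ofFun : (DiffPoly U)⟦X⟧ →+* SuperE U :=
  PowerSeries.map (Algebra.TensorProduct.includeLeftRingHom)

/-- The coordinate function `u^α` as a differential polynomial. -/
noncomputable def uVar (U : Opens (Fin n → ℝ)) (α : Fin n) : SuperE U :=
  ofFun (PowerSeries.C (MvPolynomial.C (Smooth.coord U α)))

/-- The odd variable `θ_α = θ_α^0`. -/
noncomputable def θVar (U : Opens (Fin n → ℝ)) (α : Fin n) : SuperE U :=
  PowerSeries.C (1 ⊗ₜ Grass.gen α 0)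

/-- Linear operators on the super ring; the product is composition. -/
abbrev Op (U : Opens (Fin n → ℝ)) : Type := Module.End ℝ (SuperE U)

/-- Multiplication by `a` as an operator. -/
noncomputable def mulOp (a : SuperE U) : Op U := Algebra.lmul ℝ (SuperE U) a

/-- The operator `φ(ε∂ₓ) = ∑ φ_k ε^k ∂ₓ^k` for a formal power series `φ = ∑ φ_k t^k`. -/
noncomputable def symbolOp (U : Opens (Fin n → ℝ)) (φ : ℝ⟦X⟧) : Op U where
  toFun f := PowerSeries.mk fun m => ∑ kl ∈ Finset.HasAntidiagonal.antidiagonal m,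
    PowerSeries.coeff kl.1 φ • (dx ^ kl.1) (PowerSeries.coeff kl.2 f)
  map_add' f g := by ext m; simp [Finset.sum_add_distrib]
  map_smul' c f := by
    ext m
    simp only [PowerSeries.coeff_mk, RingHom.id_apply, coeff_smulE, map_smul, Finset.smul_sum, smul_comm c]

/-- The differential operator `∑_{k,s} ε^k q_{k,s} ∂ₓ^s` with coefficients in the ring of
differential polynomials, of finite order at each power of `ε`. -/
noncomputable def diffOp (q : ℕ → ℕ →₀ DiffPoly U) : Op U where
  toFun f := PowerSeries.mk fun m => ∑ kl ∈ Finset.HasAntidiagonal.antidiagonal m,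
    (q kl.1).sum fun s c => (c ⊗ₜ[ℝ] (1 : Grass n)) * (dx ^ s) (PowerSeries.coeff kl.2 f)
  map_add' f g := by ext m; simp [Finset.sum_add_distrib, mul_add]
  map_smul' c f := by
    ext m
    simp only [PowerSeries.coeff_mk, RingHom.id_apply, coeff_smulE, map_smul, Finset.smul_sum, mul_smul_comm, Finsupp.smul_sum]

/-- `P` is a differential operator. -/
def IsDiffOp (P : Op U) : Prop := ∃ q : ℕ → ℕ →₀ DiffPoly U, P = diffOp q

/-- The differential operators `P` and `P'` are formally adjoint:
`∫ f · P g dx = ∫ (P' f) · g dx` for all functions `f`, `g` on the jet space. -/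
def IsAdjoint (P P' : Op U) : Prop :=
  IsDiffOp P ∧ IsDiffOp P' ∧
    ∀ f g : (DiffPoly U)⟦X⟧, integral (ofFun f * P (ofFun g)) = integral (P' (ofFun f) * ofFun g)

/-- A matrix of differential operators is skew-symmetric: `(Q^{αβ})† = -Q^{βα}`. -/
def IsSkew (Q : Matrix (Fin n) (Fin n) (Op U)) : Prop := ∀ α β, IsAdjoint (Q α β) (-Q β α)

/-- The local functional `ι(Q) = ½ ∫ θ_α (Q^{αβ} θ_β) dx`. -/
noncomputable def bivector (Q : Matrix (Fin n) (Fin n) (Op U)) : LocalFunctional U :=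
  (1 / 2 : ℝ) • integral (∑ α, ∑ β, θVar U α * Q α β (θVar U β))

/-- `Q` is a Hamiltonian operator: a skew-symmetric matrix of differential operators with
`[ι(Q), ι(Q)] = 0`. -/
def IsHamiltonian (Q : Matrix (Fin n) (Fin n) (Op U)) : Prop :=
  IsSkew Q ∧ schouten 2 (bivector Q) (bivector Q) = 0

/-- `(P, Q)` is a bihamiltonian structure: `P` and `Q` are Hamiltonian and compatible, that is,
every linear combination of them is Hamiltonian. -/
def IsBihamiltonian (P Q : Matrix (Fin n) (Fin n) (Op U)) : Prop :=
  IsHamiltonian P ∧ IsHamiltonian Q ∧ ∀ a b : ℝ, IsHamiltonian (a • P + b • Q)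

/-! ### Changes of coordinates -/

/-- The Fréchet derivative `∑_s ∂z/∂u^{β,s} ∂ₓ^s` of a function `z` on the jet space. -/
noncomputable def frechet (z : (DiffPoly U)⟦X⟧) (β : Fin n) : Op U :=
  diffOp fun k => Finsupp.ofSupportFinite (fun s => pdU β s (PowerSeries.coeff k z))
    (pdU_finite β _)

/-- `z^1, …, z^n` are new coordinates: at `ε = 0` they are functions on `U` whose Jacobian
determinant vanishes nowhere. -/
def IsCoordinates (z : Fin n → (DiffPoly U)⟦X⟧) : Prop :=
  ∃ z₀ : Fin n → Smooth U, (∀ α, PowerSeries.coeff 0 (z α) = MvPolynomial.C (z₀ α)) ∧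
    ∀ x : U, (Matrix.of fun α β => Smooth.pd β (z₀ α) x).det ≠ 0

/-- The matrix operator `Q` becomes `Q' = J Q J†` in the coordinates `z`, where `J` is the Jacobian
of `z` and `J†` is its adjoint. -/
def TransformsTo (z : Fin n → (DiffPoly U)⟦X⟧) (Q Q' : Matrix (Fin n) (Fin n) (Op U)) : Prop :=
  ∃ Jd : Matrix (Fin n) (Fin n) (Op U), (∀ α β, IsAdjoint (frechet (z α) β) (Jd β α)) ∧
    (Matrix.of fun α β => frechet (z α) β) * Q * Jd = Q'

/-! ### The two operators -/

/-- The power series of `Λ^k = e^{kε∂ₓ}` in the variable `t = ε∂ₓ`. -/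
noncomputable def shift (k : ℤ) : ℝ⟦X⟧ := PowerSeries.rescale (k : ℝ) (PowerSeries.exp ℝ)

/-- The operator `Λ^k = e^{kε∂ₓ}`. -/
noncomputable def Λ (U : Opens (Fin n → ℝ)) (k : ℤ) : Op U := symbolOp U (shift k)

/-- The operator `𝒫₁` in the coordinates `(u, v, w)`. -/
noncomputable def P₁ (U : Opens (Fin 3 → ℝ)) : Matrix (Fin 3) (Fin 3) (Op U) :=
  let u := mulOp (uVar U 0)
  let w := mulOp (uVar U 2)
  let L := Λ U
  !![L 1 - L (-1), w * L (-1) - L 2 * w, 0;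
    w * L (-2) - L 1 * w, w * L (-1) * u - u * L 1 * w, (L 1 - 1) * w;
    0, w * (1 - L (-1)), 0]

/-- The operator `𝒫₂` in the coordinates `(u, v, w)`; here `op a b` is `a(Λ)/b(Λ)`, the quotient
being taken in the ring of power series in `ε∂ₓ`. -/
noncomputable def P₂ (U : Opens (Fin 3 → ℝ)) : Matrix (Fin 3) (Fin 3) (Op U) :=
  let u := mulOp (uVar U 0)
  let v := mulOp (uVar U 1)
  let w := mulOp (uVar U 2)
  let L := Λ U
  let S := shift
  let op : ℝ⟦X⟧ → ℝ⟦X⟧ → Op U := fun a b => symbolOp U (a * b⁻¹)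
  !![L 1 * v - v * L (-1) + u * op (1 - S 1) (1 + S 1) * u, 0, u * op (S 1 - 1) (1 + S (-1)) * w;
    0, 0, v * (L 1 - 1) * w;
    w * op (1 - S (-1)) (S 1 + 1) * u, w * (1 - L (-1)) * v, w * op (S 2 - S (-1)) (S 1 + 1) * w]

end SuperJet

open SuperJet

namespace SuperJet

/-! Everything is reduced to finite algebra with shifts, and no series in `ε` is ever expanded. For
a skew operator, `δθ_bivector` gives `δI/δθ_γ = Q^{γβ} θ_β`. For `δI/δu^γ` the tool is the twisted
Euler operator `E_γ(f; h) = ∑ (-∂ₓ)^s (h · ∂f/∂u^{γ,s})`. It has a product rule (`eulerU_ofFun_mul`)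
and satisfies `E_γ(φ(ε∂ₓ) f; h) = E_γ(f; φ(-ε∂ₓ) h)` (`eulerU_symbolOp`), so shifts and rational
symbols are thrown onto `h` as they stand. The results `δu_P₁` and `δu_P₂` are quadratic in odd
elements, hence commute with the odd `δI/δθ`. A self-bracket is therefore twice `∫ ∑ δI/δθ_α ·
δI/δu^α`, and the mixed bracket is symmetric.

These integrals vanish for reasons isolated in `ShiftCalculus`: `Λ` is an automorphism, `∫` is
invariant under it, odd elements anticommute and functions are central. The denominator `1 + Λ`
enters only through `A = (1+Λ)⁻¹(u θ₁)` and `C = (1+Λ)⁻¹(w θ₃)` (with `θ₁, θ₂, θ₃` dual to `u, v,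
w`), and all that is needed of them is that they are odd with `A + ΛA = u θ₁` and `C + ΛC = w θ₃`.

In `first_bracket` the integrand is a sum of differences `X - ΛX` up to sign. In `second_bracket` it
becomes `K = v (Λ⁻¹θ₁) θ₁` times a linear expression: the `C` terms cancel, and the `A` terms reduce
to `K (Λ⁻¹(uθ₁) - uθ₁) = 0`. In `mixed_bracket` the terms without `A` or `C` are traded, modulo
differences `X - ΛX`, for quadratic terms times `u θ₁` and `v θ₂`; after `u θ₁ = A + ΛA` the rest is
linear bookkeeping.

Skew-symmetry is checked entry by entry with `AdjPair`, a notion closed under sums and products. The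
pencil is Hamiltonian because the bracket is bilinear.

For the flat coordinates, the Fréchet derivative is a derivation commuting with symbols
(`frechet_mul`, `frechet_symbolFun`), which yields the Jacobian operator and its adjoint. The
product with `P₁` is then computed column by column; what makes it constant is `w · w⁻¹ = 1`, `√2 ·
√2 = 2` and `(Λ² - 1)(1+Λ)⁻² = (Λ - 1)(1+Λ)⁻¹`. -/

theorem sum_antidiagonal_assoc {M : Type*} [AddCommMonoid M] (F : ℕ → ℕ → ℕ → M) (n : ℕ) :
    ∑ p ∈ Finset.HasAntidiagonal.antidiagonal n,
        ∑ q ∈ Finset.HasAntidiagonal.antidiagonal p.1, F q.1 q.2 p.2 =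
      ∑ p ∈ Finset.HasAntidiagonal.antidiagonal n,
        ∑ q ∈ Finset.HasAntidiagonal.antidiagonal p.2, F p.1 q.1 q.2 := by
  rw [Finset.sum_sigma', Finset.sum_sigma']
  refine Finset.sum_nbij' (fun x => ⟨(x.2.1, x.2.2 + x.1.2), (x.2.2, x.1.2)⟩)
    (fun x => ⟨(x.1.1 + x.2.1, x.2.2), (x.1.1, x.2.1)⟩) ?_ ?_ ?_ ?_ ?_
  · rintro ⟨⟨a, b⟩, ⟨c, d⟩⟩ h
    simp only [Finset.mem_sigma, Finset.HasAntidiagonal.mem_antidiagonal] at h ⊢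
    exact ⟨by omega, trivial⟩
  · rintro ⟨⟨a, b⟩, ⟨c, d⟩⟩ h
    simp only [Finset.mem_sigma, Finset.HasAntidiagonal.mem_antidiagonal] at h ⊢
    exact ⟨by omega, trivial⟩
  · rintro ⟨⟨a, b⟩, ⟨c, d⟩⟩ h
    simp only [Finset.mem_sigma, Finset.HasAntidiagonal.mem_antidiagonal] at h
    obtain ⟨-, h⟩ := h
    subst h
    rfl
  · rintro ⟨⟨a, b⟩, ⟨c, d⟩⟩ h
    simp only [Finset.mem_sigma, Finset.HasAntidiagonal.mem_antidiagonal] at h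
    obtain ⟨-, h⟩ := h
    subst h
    rfl
  · rintro ⟨⟨a, b⟩, ⟨c, d⟩⟩ -
    rfl

/-! ### Power series of operators -/

section Conv

variable {V : Type*} [Ring V] [Algebra ℝ V]

/-- A power series of operators acts on power series by convolution. -/
noncomputable def convLin : (Module.End ℝ V)⟦X⟧ →ₗ[ℝ] Module.End ℝ V⟦X⟧ where
  toFun A :=
    { toFun := fun f => PowerSeries.mk fun m => ∑ kl ∈ Finset.HasAntidiagonal.antidiagonal m,
        PowerSeries.coeff kl.1 A (PowerSeries.coeff kl.2 f)
      map_add' := fun f g => by ext m; simp [Finset.sum_add_distrib]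
      map_smul' := fun c f => by
        ext m
        simp only [PowerSeries.coeff_mk, RingHom.id_apply, coeff_smulE, map_smul,
          Finset.smul_sum] }
  map_add' A B := by ext f m; simp [Finset.sum_add_distrib]
  map_smul' c A := by
    ext f m
    simp only [LinearMap.coe_mk, AddHom.coe_mk, PowerSeries.coeff_mk, RingHom.id_apply,
      coeff_smulE, LinearMap.smul_apply, Finset.smul_sum]

theorem coeff_convLin (A : (Module.End ℝ V)⟦X⟧) (f : V⟦X⟧) (m : ℕ) :
    PowerSeries.coeff m (convLin A f) = ∑ kl ∈ Finset.HasAntidiagonal.antidiagonal m,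
        PowerSeries.coeff kl.1 A (PowerSeries.coeff kl.2 f) := by
  simp [convLin]

/-- The action of power series of operators on power series, as an algebra homomorphism. -/
noncomputable def conv : (Module.End ℝ V)⟦X⟧ →ₐ[ℝ] Module.End ℝ V⟦X⟧ :=
  AlgHom.ofLinearMap convLin
    (by
      ext f m
      rw [coeff_convLin, Finset.sum_eq_single (0, m)]
      · simp
      · rintro ⟨a, b⟩ hab h
        have : a ≠ 0 := by
          rintro rfl
          simp at hab
          exact h (by rw [hab])
        simp [PowerSeries.coeff_one, this]
      · simp)
    (fun A B => by
      ext f m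
      rw [Module.End.mul_apply, coeff_convLin, coeff_convLin]
      simp only [coeff_convLin, PowerSeries.coeff_mul, LinearMap.sum_apply, Module.End.mul_apply,
        map_sum]
      exact sum_antidiagonal_assoc (fun i j k => (PowerSeries.coeff i A)
        ((PowerSeries.coeff j B) (PowerSeries.coeff k f))) m)

theorem coeff_conv (A : (Module.End ℝ V)⟦X⟧) (f : V⟦X⟧) (m : ℕ) :
    PowerSeries.coeff m (conv A f) = ∑ kl ∈ Finset.HasAntidiagonal.antidiagonal m,
        PowerSeries.coeff kl.1 A (PowerSeries.coeff kl.2 f) := coeff_convLin A f m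

/-- Left multiplication by a power series, as a power series of operators. -/
noncomputable def lmulSeries : V⟦X⟧ →+* (Module.End ℝ V)⟦X⟧ :=
  PowerSeries.map (Algebra.lmul ℝ V).toRingHom

theorem conv_lmulSeries (a f : V⟦X⟧) : conv (lmulSeries a) f = a * f := by
  ext m
  simp [coeff_conv, lmulSeries, PowerSeries.coeff_mul]

/-- The convolution of two power series along a bilinear map. -/
noncomputable def bilinSeries {W : Type*} [Ring W] [Algebra ℝ W]
    (B : V →ₗ[ℝ] V →ₗ[ℝ] W) : V⟦X⟧ →ₗ[ℝ] V⟦X⟧ →ₗ[ℝ] W⟦X⟧ :=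
  LinearMap.mk₂ ℝ (fun f g => PowerSeries.mk fun m =>
      ∑ kl ∈ Finset.HasAntidiagonal.antidiagonal m,
        B (PowerSeries.coeff kl.1 f) (PowerSeries.coeff kl.2 g))
    (fun f f' g => by ext m; simp [Finset.sum_add_distrib])
    (fun c f g => by
      ext m
      simp only [PowerSeries.coeff_mk, coeff_smulE, map_smul, LinearMap.smul_apply,
        Finset.smul_sum])
    (fun f g g' => by ext m; simp [Finset.sum_add_distrib])
    (fun c f g => by
      ext m
      simp only [PowerSeries.coeff_mk, coeff_smulE, map_smul, Finset.smul_sum])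

theorem coeff_bilinSeries {W : Type*} [Ring W] [Algebra ℝ W] (B : V →ₗ[ℝ] V →ₗ[ℝ] W)
    (f g : V⟦X⟧) (m : ℕ) : PowerSeries.coeff m (bilinSeries B f g) =
      ∑ kl ∈ Finset.HasAntidiagonal.antidiagonal m,
        B (PowerSeries.coeff kl.1 f) (PowerSeries.coeff kl.2 g) := by
  simp [bilinSeries]

/-- Both double sums run over the same triples of exponents, those of the operator, of `f` and of
`g`, with total `m`. Since `ε` is a scalar, adjointness of the coefficients passes to the series
without extra signs. -/
theorem bilinSeries_conv {W : Type*} [AddCommGroup W] (B : V → V →+ W)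
    (hB : ∀ g, ∀ x y, B (x + y) g = B x g + B y g)
    {A A' : (Module.End ℝ V)⟦X⟧}
    (h : ∀ k f g, B (PowerSeries.coeff k A f) g = B f (PowerSeries.coeff k A' g))
    (f g : V⟦X⟧) (m : ℕ) :
    ∑ kl ∈ Finset.HasAntidiagonal.antidiagonal m,
        B (PowerSeries.coeff kl.1 (conv A f)) (PowerSeries.coeff kl.2 g) =
      ∑ kl ∈ Finset.HasAntidiagonal.antidiagonal m,
        B (PowerSeries.coeff kl.1 f) (PowerSeries.coeff kl.2 (conv A' g)) := by
  have hs : ∀ (s : Finset (ℕ × ℕ)) (F : ℕ × ℕ → V) (y : V),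
      B (∑ p ∈ s, F p) y = ∑ p ∈ s, B (F p) y := fun s F y =>
    map_sum (AddMonoidHom.mk' (fun x => B x y) (hB y)) F s
  simp only [coeff_conv, hs, map_sum, h]
  rw [← sum_antidiagonal_assoc (fun i k j => B (PowerSeries.coeff i f)
    (PowerSeries.coeff k A' (PowerSeries.coeff j g)))]
  refine Finset.sum_congr rfl fun p _ => ?_
  rw [← Finset.Nat.sum_antidiagonal_swap]
  rfl

end Conv

variable {n : ℕ} {U : Opens (Fin n → ℝ)}

theorem dx_mul (a b : Super U) : dx (a * b) = dx a * b + a * dx b := by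
  induction a using TensorProduct.induction_on with
  | zero => simp
  | tmul p x =>
    induction b using TensorProduct.induction_on with
    | zero => simp
    | tmul q y =>
      simp only [Algebra.TensorProduct.tmul_mul_tmul, dx, LinearMap.add_apply,
        TensorProduct.map_tmul, LinearMap.id_apply, totalT_mul, Derivation.coeFn_coe,
        Derivation.leibniz, smul_eq_mul, TensorProduct.add_tmul, TensorProduct.tmul_add,
        add_mul, mul_add, mul_comm q]
      abel
    | add f g hf hg => simp only [mul_add, map_add, hf, hg]; abel
  | add f g hf hg => simp only [add_mul, map_add, hf, hg]; abel

theorem dx_one : dx (1 : Super U) = 0 := by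
  have := dx_mul (1 : Super U) 1
  simpa using this

/-! ### Symbols -/

/-- The power series of operators `∑ φ_k ε^k ∂ₓ^k`. -/
noncomputable def symbolSeries (U : Opens (Fin n → ℝ)) :
    ℝ⟦X⟧ →+* (Module.End ℝ (Super U))⟦X⟧ where
  toFun φ := PowerSeries.mk fun k => PowerSeries.coeff k φ • (dx : Module.End ℝ (Super U)) ^ k
  map_one' := by
    ext1 k
    rw [PowerSeries.coeff_mk, PowerSeries.coeff_one, PowerSeries.coeff_one]
    split_ifs with h <;> simp [h]
  map_mul' φ ψ := by
    ext1 k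
    rw [PowerSeries.coeff_mk, PowerSeries.coeff_mul, PowerSeries.coeff_mul, Finset.sum_smul]
    refine Finset.sum_congr rfl fun p hp => ?_
    rw [PowerSeries.coeff_mk, PowerSeries.coeff_mk, smul_mul_smul_comm, ← pow_add,
      Finset.HasAntidiagonal.mem_antidiagonal.1 hp]
  map_zero' := by ext1 k; simp
  map_add' φ ψ := by ext1 k; simp [add_smul]

theorem coeff_symbolSeries (φ : ℝ⟦X⟧) (k : ℕ) : PowerSeries.coeff k (symbolSeries U φ) =
    PowerSeries.coeff k φ • (dx : Module.End ℝ (Super U)) ^ k := by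
  simp [symbolSeries]

theorem symbolOp_eq (φ : ℝ⟦X⟧) : symbolOp U φ = conv (symbolSeries U φ) := by
  ext f m
  rw [coeff_conv]
  simp [symbolOp, coeff_symbolSeries]

/-- `φ ↦ φ(ε∂ₓ)` as an algebra homomorphism. -/
noncomputable def symbolHom (U : Opens (Fin n → ℝ)) : ℝ⟦X⟧ →ₐ[ℝ] Op U :=
  AlgHom.ofLinearMap
    { toFun := symbolOp U
      map_add' := fun φ ψ => by simp [symbolOp_eq]
      map_smul' := fun c φ => by
        rw [symbolOp_eq, symbolOp_eq, RingHom.id_apply, ← map_smul]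
        congr 1
        ext1 k
        rw [coeff_symbolSeries, coeff_smulE, smul_assoc, ← coeff_symbolSeries]
        exact ((PowerSeries.coeff k).map_smul_of_tower c _).symm }
    (by simp [symbolOp_eq]) (fun φ ψ => by simp [symbolOp_eq])

theorem symbolHom_apply (φ : ℝ⟦X⟧) : symbolHom U φ = symbolOp U φ := rfl

theorem mulOp_apply (a f : SuperE U) : mulOp a f = a * f := rfl

theorem mulOp_eq (a : SuperE U) : mulOp a = conv (lmulSeries a) := by
  ext1 f
  rw [conv_lmulSeries, mulOp_apply]

/-! ### Differential operators of finite order -/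

/-- The operators `∑ c_s ∂ₓ^s` on the super ring. -/
noncomputable def finOp (q : ℕ →₀ DiffPoly U) : Module.End ℝ (Super U) :=
  q.sum fun s c => Algebra.lmul ℝ (Super U) (c ⊗ₜ[ℝ] (1 : Grass n)) * dx ^ s

theorem finOp_add (q r : ℕ →₀ DiffPoly U) : finOp (q + r) = finOp q + finOp r :=
  Finsupp.sum_add_index' (by simp) (by simp [TensorProduct.add_tmul, add_mul])

theorem finOp_single (s : ℕ) (c : DiffPoly U) : finOp (Finsupp.single s c) =
    Algebra.lmul ℝ (Super U) (c ⊗ₜ[ℝ] (1 : Grass n)) * dx ^ s :=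
  Finsupp.sum_single_index (by simp)

theorem dx_tmul_one (c : DiffPoly U) : dx (c ⊗ₜ[ℝ] (1 : Grass n)) = totalU c ⊗ₜ[ℝ] 1 := by
  have : totalT (1 : Grass n) = 0 := by simpa using totalT_algebraMap (n := n) 1
  simp [dx, this]

theorem exists_lmul_mul_finOp (c : DiffPoly U) (q : ℕ →₀ DiffPoly U) :
    ∃ r, Algebra.lmul ℝ (Super U) (c ⊗ₜ[ℝ] (1 : Grass n)) * finOp q = finOp r := by
  induction q using Finsupp.induction_linear with
  | zero => exact ⟨0, by simp [finOp]⟩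
  | add q r hq hr =>
    obtain ⟨a, ha⟩ := hq
    obtain ⟨b, hb⟩ := hr
    exact ⟨a + b, by rw [finOp_add, finOp_add, mul_add, ha, hb]⟩
  | single s d =>
    exact ⟨Finsupp.single s (c * d), by
      rw [finOp_single, finOp_single, ← mul_assoc, ← map_mul]
      simp⟩

/-- The Leibniz rule `∂ₓ ∘ c ∂ₓ^s = (∂ₓc) ∂ₓ^s + c ∂ₓ^{s+1}`; this is what closes finite-order
operators under composition. -/
theorem exists_dx_mul_finOp (q : ℕ →₀ DiffPoly U) :
    ∃ r, (dx : Module.End ℝ (Super U)) * finOp q = finOp r := by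
  induction q using Finsupp.induction_linear with
  | zero => exact ⟨0, by simp [finOp]⟩
  | add q r hq hr =>
    obtain ⟨a, ha⟩ := hq
    obtain ⟨b, hb⟩ := hr
    exact ⟨a + b, by rw [finOp_add, finOp_add, mul_add, ha, hb]⟩
  | single s d =>
    refine ⟨Finsupp.single s (totalU d) + Finsupp.single (s + 1) d, ?_⟩
    rw [finOp_add, finOp_single, finOp_single, finOp_single]
    refine LinearMap.ext fun f => ?_
    simp [dx_mul, dx_tmul_one, pow_succ']

theorem exists_finOp_mul (q r : ℕ →₀ DiffPoly U) : ∃ t, finOp q * finOp r = finOp t := by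
  induction q using Finsupp.induction_linear with
  | zero => exact ⟨0, by simp [finOp]⟩
  | add q r hq hr =>
    obtain ⟨a, ha⟩ := hq
    obtain ⟨b, hb⟩ := hr
    exact ⟨a + b, by rw [finOp_add, finOp_add, add_mul, ha, hb]⟩
  | single s d =>
    have : ∃ t, dx ^ s * finOp r = finOp t := by
      induction s with
      | zero => exact ⟨r, by simp⟩
      | succ s ih =>
        obtain ⟨t, ht⟩ := ih
        obtain ⟨t', ht'⟩ := exists_dx_mul_finOp t
        exact ⟨t', by rw [pow_succ', mul_assoc, ht, ht']⟩
    obtain ⟨t, ht⟩ := this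
    obtain ⟨t', ht'⟩ := exists_lmul_mul_finOp d t
    exact ⟨t', by rw [finOp_single, mul_assoc, ht, ht']⟩

variable (U) in
/-- The algebra of differential operators of finite order on the super ring. -/
noncomputable def finOpAlg : Subalgebra ℝ (Module.End ℝ (Super U)) where
  carrier := Set.range finOp
  mul_mem' := by
    rintro _ _ ⟨q, rfl⟩ ⟨r, rfl⟩
    obtain ⟨t, ht⟩ := exists_finOp_mul q r
    exact ⟨t, ht.symm⟩
  add_mem' := by
    rintro _ _ ⟨q, rfl⟩ ⟨r, rfl⟩
    exact ⟨q + r, finOp_add q r⟩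
  algebraMap_mem' := fun c => ⟨Finsupp.single 0 (algebraMap ℝ _ c), by
    refine LinearMap.ext fun f => ?_
    rw [finOp_single]
    rw [Algebra.algebraMap_eq_smul_one, ← TensorProduct.smul_tmul',
      ← Algebra.TensorProduct.one_def]
    simp⟩

theorem finOp_mem (q : ℕ →₀ DiffPoly U) : finOp q ∈ finOpAlg U := ⟨q, rfl⟩

theorem dx_mem_finOpAlg : (dx : Module.End ℝ (Super U)) ∈ finOpAlg U :=
  ⟨Finsupp.single 1 1, by
    rw [finOp_single, ← Algebra.TensorProduct.one_def, map_one, one_mul, pow_one]⟩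

theorem lmul_mem_finOpAlg (c : DiffPoly U) :
    Algebra.lmul ℝ (Super U) (c ⊗ₜ[ℝ] (1 : Grass n)) ∈ finOpAlg U :=
  ⟨Finsupp.single 0 c, by rw [finOp_single, pow_zero, mul_one]⟩

theorem diffOp_eq (q : ℕ → ℕ →₀ DiffPoly U) :
    diffOp q = conv (PowerSeries.mk fun k => finOp (q k)) := by
  ext f m
  rw [coeff_conv]
  simp [diffOp, finOp, Finsupp.sum, LinearMap.sum_apply]

/-- Since `conv` is an algebra homomorphism, closure of differential operators under sums and
products is inherited from the subalgebra `finOpAlg`, one coefficient of `ε` at a time. -/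
theorem isDiffOp_iff {P : Op U} : IsDiffOp P ↔
    ∃ A, (∀ k, PowerSeries.coeff k A ∈ finOpAlg U) ∧ P = conv A := by
  constructor
  · rintro ⟨q, rfl⟩
    exact ⟨_, fun k => by simpa using finOp_mem (q k), diffOp_eq q⟩
  · rintro ⟨A, hA, rfl⟩
    choose q hq using hA
    refine ⟨q, ?_⟩
    rw [diffOp_eq]
    congr 1
    ext1 k
    simp [hq]

theorem IsDiffOp.mul {P Q : Op U} (hP : IsDiffOp P) (hQ : IsDiffOp Q) : IsDiffOp (P * Q) := by
  obtain ⟨A, hA, rfl⟩ := isDiffOp_iff.1 hP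
  obtain ⟨B, hB, rfl⟩ := isDiffOp_iff.1 hQ
  refine isDiffOp_iff.2 ⟨A * B, fun k => ?_, (map_mul _ _ _).symm⟩
  rw [PowerSeries.coeff_mul]
  exact sum_mem fun p _ => mul_mem (hA _) (hB _)

theorem IsDiffOp.add {P Q : Op U} (hP : IsDiffOp P) (hQ : IsDiffOp Q) : IsDiffOp (P + Q) := by
  obtain ⟨A, hA, rfl⟩ := isDiffOp_iff.1 hP
  obtain ⟨B, hB, rfl⟩ := isDiffOp_iff.1 hQ
  exact isDiffOp_iff.2 ⟨A + B, fun k => by simpa using add_mem (hA k) (hB k),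
    (map_add _ _ _).symm⟩

theorem IsDiffOp.smul {P : Op U} (c : ℝ) (hP : IsDiffOp P) : IsDiffOp (c • P) := by
  obtain ⟨A, hA, rfl⟩ := isDiffOp_iff.1 hP
  refine isDiffOp_iff.2 ⟨c • A, fun k => ?_, (map_smul _ _ _).symm⟩
  rw [(PowerSeries.coeff k).map_smul_of_tower c A]
  exact Subalgebra.smul_mem _ (hA k) c

theorem isDiffOp_symbolOp (φ : ℝ⟦X⟧) : IsDiffOp (symbolOp U φ) :=
  isDiffOp_iff.2 ⟨_, fun k => by
    rw [coeff_symbolSeries]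
    exact Subalgebra.smul_mem _ (pow_mem dx_mem_finOpAlg k) _, symbolOp_eq φ⟩

theorem isDiffOp_mulOp (c : (DiffPoly U)⟦X⟧) : IsDiffOp (mulOp (ofFun c)) :=
  isDiffOp_iff.2 ⟨_, fun k => by
    simpa [lmulSeries, ofFun] using lmul_mem_finOpAlg _, mulOp_eq _⟩

end SuperJet

namespace SuperJet

variable {n : ℕ} {U : Opens (Fin n → ℝ)}

theorem Super.neg_mul (a b : Super U) : -a * b = -(a * b) := _root_.neg_mul a b

theorem Super.mul_neg (a b : Super U) : a * -b = -(a * b) := _root_.mul_neg a b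

theorem SuperE.smul_mul (c : ℝ) (f g : SuperE U) : c • f * g = c • (f * g) := by
  ext m
  rw [coeff_smulE, PowerSeries.coeff_mul, PowerSeries.coeff_mul, Finset.smul_sum]
  simp only [coeff_smulE, smul_mul_assoc]

theorem SuperE.mul_smul (c : ℝ) (f g : SuperE U) : f * c • g = c • (f * g) := by
  ext m
  rw [coeff_smulE, PowerSeries.coeff_mul, PowerSeries.coeff_mul, Finset.smul_sum]
  simp only [coeff_smulE, mul_smul_comm]

/-! ### Functions are central -/

theorem tmul_one_mul_comm (c : DiffPoly U) (x : Super U) :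
    (c ⊗ₜ[ℝ] (1 : Grass n)) * x = x * (c ⊗ₜ[ℝ] (1 : Grass n)) := by
  induction x using TensorProduct.induction_on with
  | zero => simp
  | tmul p y => simp [mul_comm]
  | add f g hf hg => rw [mul_add, add_mul, hf, hg]

theorem coeff_ofFun (c : (DiffPoly U)⟦X⟧) (k : ℕ) :
    PowerSeries.coeff k (ofFun c) = PowerSeries.coeff k c ⊗ₜ[ℝ] (1 : Grass n) := by
  simp [ofFun]

theorem ofFun_mul_comm (c : (DiffPoly U)⟦X⟧) (x : SuperE U) : ofFun c * x = x * ofFun c := by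
  ext m
  rw [PowerSeries.coeff_mul, PowerSeries.coeff_mul, ← Finset.Nat.sum_antidiagonal_swap]
  refine Finset.sum_congr rfl fun p _ => ?_
  rw [coeff_ofFun, coeff_ofFun]
  exact tmul_one_mul_comm _ _

/-! ### Local functionals, coefficientwise -/

/-- `Dx` acts coefficientwise, so primitives chosen separately at each power of `ε` assemble into a
single series. -/
theorem integral_eq_of_coeff {f g : SuperE U}
    (h : ∀ m, (LinearMap.range (dx : Super U →ₗ[ℝ] Super U)).mkQ (PowerSeries.coeff m f) =
      (LinearMap.range (dx : Super U →ₗ[ℝ] Super U)).mkQ (PowerSeries.coeff m g)) :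
    integral f = integral g := by
  have h' : ∀ m, ∃ a, dx a = PowerSeries.coeff m f - PowerSeries.coeff m g := fun m =>
    (Submodule.Quotient.eq _).1 (h m)
  choose a ha using h'
  refine (Submodule.Quotient.eq _).2 ⟨PowerSeries.mk a, ?_⟩
  ext m
  simp [Dx, coeffwise, ha]

/-- The pairing `∫ f g dx` on the super ring. -/
noncomputable def pairing (U : Opens (Fin n → ℝ)) (g : Super U) :
    Super U →+ Super U ⧸ LinearMap.range (dx : Super U →ₗ[ℝ] Super U) :=
  ((Submodule.mkQ _).comp (Algebra.lmul ℝ (Super U) g)).toAddMonoidHom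

theorem pairing_apply (f g : Super U) : pairing U f g = Submodule.mkQ _ (f * g) := rfl

theorem pairing_dx (f g : Super U) : pairing U (dx f) g = pairing U (-f) (dx g) := by
  rw [pairing_apply, pairing_apply]
  refine (Submodule.Quotient.eq _).2 ⟨f * g, ?_⟩
  rw [dx_mul, Super.neg_mul]
  exact (sub_neg_eq_add _ _).symm

theorem pairing_add (g x y : Super U) : pairing U (x + y) g = pairing U x g + pairing U y g := by
  rw [pairing_apply, pairing_apply, pairing_apply, add_mul, map_add]

theorem integral_conv {A A' : (Module.End ℝ (Super U))⟦X⟧}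
    (h : ∀ k f g, pairing U (PowerSeries.coeff k A f) g = pairing U f (PowerSeries.coeff k A' g))
    (f g : SuperE U) : integral (conv A f * g) = integral (f * conv A' g) := by
  refine integral_eq_of_coeff fun m => ?_
  rw [PowerSeries.coeff_mul, PowerSeries.coeff_mul, map_sum, map_sum]
  exact bilinSeries_conv (pairing U) pairing_add h f g m

/-! ### The twisted Euler operators -/

/-- The twisted Euler operator `∑ (-∂ₓ)^s (h · P_s f)`. -/
noncomputable def eulerLin (P : ℕ → Super U →ₗ[ℝ] Super U)
    (hP : ∀ f, {s | P s f ≠ 0}.Finite) : Super U →ₗ[ℝ] Super U →ₗ[ℝ] Super U :=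
  LinearMap.flip
    { toFun := fun h => varDer dx (fun s => Algebra.lmul ℝ (Super U) h ∘ₗ P s) (fun f =>
        (hP f).subset fun s hs h0 => hs (by simp [h0]))
      map_add' := fun h h' => by
        refine LinearMap.ext fun f => ?_
        simp only [varDer, LinearMap.coe_mk, AddHom.coe_mk, LinearMap.add_apply, map_add,
          LinearMap.comp_apply]
        refine finsum_add_distrib ((hP f).subset ?_) ((hP f).subset ?_) <;>
        · intro s hs h0
          exact hs (by simp only [h0, map_zero])
      map_smul' := fun c h => by
        refine LinearMap.ext fun f => ?_
        simp only [varDer, LinearMap.coe_mk, AddHom.coe_mk, LinearMap.smul_apply, map_smul,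
          LinearMap.comp_apply, RingHom.id_apply]
        refine (smul_finsum' c ((hP f).subset ?_)).symm
        intro s hs h0
        exact hs (by simp only [h0, map_zero]) }

section Euler

variable {P : ℕ → Super U →ₗ[ℝ] Super U} {hP : ∀ f, {s | P s f ≠ 0}.Finite}

theorem eulerLin_apply (f h : Super U) :
    eulerLin P hP f h = ∑ᶠ s, ((-dx : Module.End ℝ (Super U)) ^ s) (h * P s f) := rfl

theorem eulerLin_eq_sum (f h : Super U) {N : ℕ} (hN : ∀ s, N ≤ s → P s f = 0) :
    eulerLin P hP f h =
      ∑ s ∈ Finset.range N, ((-dx : Module.End ℝ (Super U)) ^ s) (h * P s f) := by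
  rw [eulerLin_apply, finsum_eq_sum_of_support_subset]
  intro s hs
  simp only [Finset.coe_range, Set.mem_Iio]
  by_contra h
  exact hs (by simp [hN s (by omega)])

theorem exists_forall_ge_eq_zero (hP : ∀ f, {s | P s f ≠ 0}.Finite) (f : Super U) :
    ∃ N, ∀ s, N ≤ s → P s f = 0 := by
  obtain ⟨N, hN⟩ := (hP f).bddAbove
  refine ⟨N + 1, fun s hs => ?_⟩
  by_contra h
  have := hN h
  omega

/-- The commutation rule `P_{s+1} ∂ₓ = ∂ₓ P_{s+1} + P_s` telescopes against the Leibniz rule for `h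
· P_s f`. For `h = 1` this is the vanishing of variational derivatives on total derivatives; a
general `h` makes it integration by parts. -/
theorem eulerLin_dx (h0 : ∀ f, P 0 (dx f) = dx (P 0 f))
    (hs : ∀ s f, P (s + 1) (dx f) = dx (P (s + 1) f) + P s f) (f h : Super U) :
    eulerLin P hP (dx f) h = eulerLin P hP f (-dx h) := by
  obtain ⟨N, hN⟩ := exists_forall_ge_eq_zero hP f
  -- `∂ₓ f` may involve one more jet than `f`, hence the bound `N + 1`.
  have hN' : ∀ s, N + 1 ≤ s → P s (dx f) = 0 := by
    rintro (_ | s) h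
    · omega
    · rw [hs, hN _ (by omega), hN _ (by omega), map_zero, add_zero]
  rw [eulerLin_eq_sum f _ (N := N + 1) (fun s h => hN s (by omega)), eulerLin_eq_sum _ _ hN']
  have e1 : ∀ s, ((-dx : Module.End ℝ (Super U)) ^ s) (-dx h * P s f) =
      ((-dx : Module.End ℝ (Super U)) ^ s) (h * dx (P s f)) +
        ((-dx : Module.End ℝ (Super U)) ^ (s + 1)) (h * P s f) := by
    intro s
    rw [pow_succ, Module.End.mul_apply, ← map_add, LinearMap.neg_apply, dx_mul]
    congr 1
    rw [Super.neg_mul]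
    abel
  simp only [e1, Finset.sum_add_distrib]
  rw [Finset.sum_range_succ (fun s => ((-dx : Module.End ℝ (Super U)) ^ (s + 1)) (h * P s f)),
    hN N le_rfl, mul_zero, map_zero, add_zero, Finset.sum_range_succ', Finset.sum_range_succ']
  simp only [hs, h0, mul_add, map_add, Finset.sum_add_distrib]
  abel

theorem eulerLin_dx_pow (h0 : ∀ f, P 0 (dx f) = dx (P 0 f))
    (hs : ∀ s f, P (s + 1) (dx f) = dx (P (s + 1) f) + P s f) (k : ℕ) (f h : Super U) :
    eulerLin P hP ((dx ^ k) f) h =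
      eulerLin P hP f (((-dx : Module.End ℝ (Super U)) ^ k) h) := by
  induction k generalizing f h with
  | zero => rfl
  | succ k ih =>
    rw [pow_succ, Module.End.mul_apply, ih, eulerLin_dx h0 hs, pow_succ', Module.End.mul_apply]
    rfl

theorem eulerLin_congr {Q : ℕ → Super U →ₗ[ℝ] Super U} {hQ : ∀ f, {s | Q s f ≠ 0}.Finite}
    {f f' h h' : Super U} (H : ∀ s, h * P s f = h' * Q s f') :
    eulerLin P hP f h = eulerLin Q hQ f' h' := by
  rw [eulerLin_apply, eulerLin_apply]
  simp only [H]

theorem eulerLin_single {f h x : Super U} (h0 : h * P 0 f = x)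
    (hs : ∀ s, h * P (s + 1) f = 0) : eulerLin P hP f h = x := by
  rw [eulerLin_apply, finsum_eq_single _ 0, h0]
  · rfl
  · rintro (_ | s) hs'
    · exact absurd rfl hs'
    · rw [hs, map_zero]

end Euler

/-! ### Partial derivatives of products -/

theorem du_mul (α : Fin n) (s : ℕ) (a b : Super U) :
    du α s (a * b) = du α s a * b + a * du α s b := by
  induction a using TensorProduct.induction_on with
  | zero => simp
  | tmul p x =>
    induction b using TensorProduct.induction_on with
    | zero => simp
    | tmul q y =>
      simp only [Algebra.TensorProduct.tmul_mul_tmul, du, 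
        TensorProduct.map_tmul, LinearMap.id_apply, Derivation.coeFn_coe,
        Derivation.leibniz, smul_eq_mul, TensorProduct.add_tmul, mul_comm q]
      abel
    | add f g hf hg => simp only [mul_add, map_add, hf, hg]; abel
  | add f g hf hg => simp only [add_mul, map_add, hf, hg]; abel

theorem du_one_tmul (α : Fin n) (s : ℕ) (x : Grass n) :
    du α s ((1 : DiffPoly U) ⊗ₜ[ℝ] x) = 0 := by
  simp [du]

theorem dθ_tmul_one_mul (α : Fin n) (s : ℕ) (c : DiffPoly U) (x : Super U) :
    dθ α s ((c ⊗ₜ[ℝ] (1 : Grass n)) * x) = (c ⊗ₜ[ℝ] (1 : Grass n)) * dθ α s x := by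
  induction x using TensorProduct.induction_on with
  | zero => simp
  | tmul p y => simp [dθ]
  | add f g hf hg => simp only [mul_add, map_add, hf, hg]

theorem dθ_gen_mul (α β : Fin n) (s : ℕ) (x : Super U) :
    dθ α s (((1 : DiffPoly U) ⊗ₜ[ℝ] Grass.gen β 0) * x) =
      (if β = α ∧ s = 0 then x else 0) - ((1 : DiffPoly U) ⊗ₜ[ℝ] Grass.gen β 0) * dθ α s x := by
  induction x using TensorProduct.induction_on with
  | zero => simp
  | tmul p y =>
    simp only [dθ, Algebra.TensorProduct.tmul_mul_tmul, one_mul, TensorProduct.map_tmul,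
      LinearMap.id_apply, Grass.gen, pdT_ι_mul, Finsupp.single_apply, Prod.mk.injEq,
      TensorProduct.tmul_sub, eq_comm (a := (0 : ℕ))]
    split_ifs <;> simp
  | add f g hf hg =>
    simp only [mul_add, map_add, hf, hg]
    split_ifs <;> abel

theorem dθ_gen (α β : Fin n) (s : ℕ) :
    dθ α s ((1 : DiffPoly U) ⊗ₜ[ℝ] Grass.gen β 0) = if β = α ∧ s = 0 then 1 else 0 := by
  have h1 : dθ α s (1 : Super U) = 0 := by
    have : pdT α s (1 : Grass n) = 0 := by simpa using pdT_algebraMap α s 1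
    simp [dθ, Algebra.TensorProduct.one_def, this]
  simpa [h1] using dθ_gen_mul (U := U) α β s 1

theorem Smooth.pd_coord (α β : Fin n) :
    Smooth.pd α (Smooth.coord U β) = if β = α then 1 else 0 := by
  ext x
  rw [Smooth.pd_apply, (Smooth.eventuallyEq (f := Smooth.coord U β)
    (g := ContinuousLinearMap.proj (R := ℝ) (φ := fun _ : Fin n => ℝ) β)
    (fun _ => rfl) x).fderiv_eq (𝕜 := ℝ), ContinuousLinearMap.fderiv]
  simp only [ContinuousLinearMap.proj_apply, Pi.single_apply]
  split_ifs <;> rfl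

theorem pdU_coord (α β : Fin n) (s : ℕ) :
    pdU α s (MvPolynomial.C (Smooth.coord U β)) = if β = α ∧ s = 0 then 1 else 0 := by
  cases s with
  | zero =>
    rw [pdU, onCoeffs_C, Smooth.pd_coord]
    split_ifs <;> simp_all
  | succ s => simp [pdU]

theorem du_coord (α β : Fin n) (s : ℕ) :
    du α s (MvPolynomial.C (Smooth.coord U β) ⊗ₜ[ℝ] (1 : Grass n)) =
      if β = α ∧ s = 0 then 1 else 0 := by
  change pdU α s _ ⊗ₜ[ℝ] 1 = _
  rw [pdU_coord α β s]
  split_ifs <;> simp [Algebra.TensorProduct.one_def]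

/-! ### Euler operators on power series -/

/-- The adjoint symbol `φ(-ε∂ₓ)`. -/
noncomputable def adjSym : ℝ⟦X⟧ →+* ℝ⟦X⟧ := PowerSeries.rescale (-1 : ℝ)

theorem coeff_adjSym (φ : ℝ⟦X⟧) (k : ℕ) :
    PowerSeries.coeff k (adjSym φ) = (-1) ^ k * PowerSeries.coeff k φ :=
  PowerSeries.coeff_rescale _ _ _

theorem neg_dx_pow (k : ℕ) :
    (-dx : Module.End ℝ (Super U)) ^ k = (-1 : ℝ) ^ k • (dx : Module.End ℝ (Super U)) ^ k := by
  rw [← smul_pow]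
  congr 1
  exact LinearMap.ext fun f => (neg_one_smul ℝ (dx f)).symm

/-- The twisted Euler operator `∑ (-∂ₓ)^s (h · ∂f/∂u^{α,s})`. -/
noncomputable def eulerU (α : Fin n) : SuperE U →ₗ[ℝ] SuperE U →ₗ[ℝ] SuperE U :=
  bilinSeries (eulerLin (du α) (du_finite α))

/-- The twisted Euler operator `∑ (-∂ₓ)^s (h · ∂f/∂θ_α^s)`. -/
noncomputable def eulerθ (α : Fin n) : SuperE U →ₗ[ℝ] SuperE U →ₗ[ℝ] SuperE U :=
  bilinSeries (eulerLin (dθ α) (dθ_finite α))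

theorem coeff_bilinSeries_C_right {V W : Type*} [Ring V] [Algebra ℝ V] [Ring W] [Algebra ℝ W]
    (B : V →ₗ[ℝ] V →ₗ[ℝ] W) (f : V⟦X⟧) (c : V) (m : ℕ) :
    PowerSeries.coeff m (bilinSeries B f (PowerSeries.C c)) = B (PowerSeries.coeff m f) c := by
  rw [coeff_bilinSeries, Finset.sum_eq_single (m, 0)]
  · simp
  · rintro ⟨a, b⟩ hab h
    have : b ≠ 0 := by
      rintro rfl
      simp at hab
      exact h (by rw [hab])
    simp [PowerSeries.coeff_C, this]
  · simp

theorem coeff_bilinSeries_one {V W : Type*} [Ring V] [Algebra ℝ V] [Ring W] [Algebra ℝ W]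
    (B : V →ₗ[ℝ] V →ₗ[ℝ] W) (f : V⟦X⟧) (m : ℕ) :
    PowerSeries.coeff m (bilinSeries B f 1) = B (PowerSeries.coeff m f) 1 := by
  rw [← map_one (PowerSeries.C (R := V)), coeff_bilinSeries_C_right]

theorem δu_integral (α : Fin n) (f : SuperE U) : δu α (integral f) = eulerU α f 1 := by
  ext m
  rw [eulerU, coeff_bilinSeries_one, eulerLin_apply]
  simp [δu, integral, coeffwise, varDer]

theorem δθ_integral (α : Fin n) (f : SuperE U) : δθ α (integral f) = eulerθ α f 1 := by
  ext m
  rw [eulerθ, coeff_bilinSeries_one, eulerLin_apply]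
  simp [δθ, integral, coeffwise, varDer]

/-- Iterated integration by parts turns `∂ₓ^k` into `(-∂ₓ)^k` on the weight. As it holds for every
power series, quotients such as `(1+Λ)⁻¹` cross over whole. -/
theorem eulerU_symbolOp (α : Fin n) (φ : ℝ⟦X⟧) (f h : SuperE U) :
    eulerU α (symbolOp U φ f) h = eulerU α f (symbolOp U (adjSym φ) h) := by
  ext m
  rw [eulerU, coeff_bilinSeries, coeff_bilinSeries, symbolOp_eq, symbolOp_eq]
  refine bilinSeries_conv (fun f => (eulerLin (du α) (du_finite α) f).toAddMonoidHom)
    (fun g x y => by simp) (fun k f g => ?_) f h m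
  simp only [coeff_symbolSeries, LinearMap.smul_apply, map_smul, LinearMap.toAddMonoidHom_coe,
    eulerLin_dx_pow (du_zero_dx α) (du_succ_dx α), coeff_adjSym, neg_dx_pow, smul_smul, mul_comm]

theorem eulerθ_symbolOp (α : Fin n) (φ : ℝ⟦X⟧) (f h : SuperE U) :
    eulerθ α (symbolOp U φ f) h = eulerθ α f (symbolOp U (adjSym φ) h) := by
  ext m
  rw [eulerθ, coeff_bilinSeries, coeff_bilinSeries, symbolOp_eq, symbolOp_eq]
  refine bilinSeries_conv (fun f => (eulerLin (dθ α) (dθ_finite α) f).toAddMonoidHom)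
    (fun g x y => by simp) (fun k f g => ?_) f h m
  simp only [coeff_symbolSeries, LinearMap.smul_apply, map_smul, LinearMap.toAddMonoidHom_coe,
    eulerLin_dx_pow (dθ_zero_dx α) (dθ_succ_dx α), coeff_adjSym, neg_dx_pow, smul_smul, mul_comm]

/-- Odd derivatives do not see functions, and functions are central, so `c` slides onto the weight.
-/
theorem eulerθ_ofFun_mul (α : Fin n) (c : (DiffPoly U)⟦X⟧) (f h : SuperE U) :
    eulerθ α (ofFun c * f) h = eulerθ α f (ofFun c * h) := by
  ext m
  rw [eulerθ, coeff_bilinSeries, coeff_bilinSeries, ← conv_lmulSeries, ← conv_lmulSeries]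
  refine bilinSeries_conv (fun f => (eulerLin (dθ α) (dθ_finite α) f).toAddMonoidHom)
    (fun g x y => by simp) (fun k f g => ?_) f h m
  simp only [lmulSeries, PowerSeries.coeff_map, coeff_ofFun]
  refine eulerLin_congr (hP := dθ_finite α) (hQ := dθ_finite α) fun s => ?_
  change g * dθ α s ((_ ⊗ₜ 1) * f) = ((_ ⊗ₜ 1) * g) * _
  rw [dθ_tmul_one_mul, ← mul_assoc, tmul_one_mul_comm]

/-- The Leibniz rule under the sum over `s`. When `c` is differentiated, `f` joins the weight on its
right; the order matters because both may be odd. -/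
theorem eulerU_ofFun_mul (α : Fin n) (c : (DiffPoly U)⟦X⟧) (f h : SuperE U) :
    eulerU α (ofFun c * f) h = eulerU α (ofFun c) (h * f) + eulerU α f (h * ofFun c) := by
  have key : ∀ (p : DiffPoly U) (x y : Super U), eulerLin (du α) (du_finite α)
      ((p ⊗ₜ[ℝ] 1) * x) y = eulerLin (du α) (du_finite α) (p ⊗ₜ[ℝ] 1) (y * x) +
        eulerLin (du α) (du_finite α) x (y * (p ⊗ₜ[ℝ] 1)) := by
    intro p x y
    simp only [eulerLin_apply]
    rw [← finsum_add_distrib]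
    · refine finsum_congr fun s => ?_
      rw [← map_add, du_mul]
      congr 1
      have : du α s (p ⊗ₜ[ℝ] (1 : Grass n)) = (pdU α s p) ⊗ₜ[ℝ] 1 := rfl
      rw [this, tmul_one_mul_comm (pdU α s p) x]
      noncomm_ring
    · refine (du_finite α (p ⊗ₜ[ℝ] 1)).subset fun s hs h0 => hs ?_
      dsimp only
      rw [h0, mul_zero, map_zero]
    · refine (du_finite α x).subset fun s hs h0 => hs ?_
      dsimp only
      rw [h0, mul_zero, map_zero]
  ext m
  rw [map_add, eulerU, coeff_bilinSeries, coeff_bilinSeries, coeff_bilinSeries]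
  simp only [PowerSeries.coeff_mul, map_sum, LinearMap.sum_apply, coeff_ofFun, key,
    Finset.sum_add_distrib]
  congr 1
  · rw [sum_antidiagonal_assoc (fun a b j => eulerLin (du α) (du_finite α)
      (PowerSeries.coeff a c ⊗ₜ[ℝ] 1) (PowerSeries.coeff j h * PowerSeries.coeff b f))]
    refine Finset.sum_congr rfl fun p _ => ?_
    rw [← Finset.Nat.sum_antidiagonal_swap]
    rfl
  · have e : ∀ p : ℕ × ℕ, ∑ q ∈ Finset.HasAntidiagonal.antidiagonal p.1,
        eulerLin (du α) (du_finite α) (PowerSeries.coeff q.2 f)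
          (PowerSeries.coeff p.2 h * (PowerSeries.coeff q.1 c ⊗ₜ[ℝ] 1)) =
        ∑ q ∈ Finset.HasAntidiagonal.antidiagonal p.1,
        eulerLin (du α) (du_finite α) (PowerSeries.coeff q.1 f)
          (PowerSeries.coeff p.2 h * (PowerSeries.coeff q.2 c ⊗ₜ[ℝ] 1)) := fun p => by
      rw [← Finset.Nat.sum_antidiagonal_swap]
      rfl
    simp only [e]
    rw [sum_antidiagonal_assoc (fun b a j => eulerLin (du α) (du_finite α)
      (PowerSeries.coeff b f) (PowerSeries.coeff j h * (PowerSeries.coeff a c ⊗ₜ[ℝ] 1)))]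
    refine Finset.sum_congr rfl fun p _ => ?_
    rw [← Finset.Nat.sum_antidiagonal_swap]
    rfl

theorem coeff_bilinSeries_C {V W : Type*} [Ring V] [Algebra ℝ V] [Ring W] [Algebra ℝ W]
    (B : V →ₗ[ℝ] V →ₗ[ℝ] W) (c : V) (f : V⟦X⟧) (m : ℕ) :
    PowerSeries.coeff m (bilinSeries B (PowerSeries.C c) f) = B c (PowerSeries.coeff m f) := by
  rw [coeff_bilinSeries, Finset.sum_eq_single (0, m)]
  · simp
  · rintro ⟨a, b⟩ hab h
    have : a ≠ 0 := by
      rintro rfl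
      simp at hab
      exact h (by rw [hab])
    simp [PowerSeries.coeff_C, this]
  · simp

theorem uVar_eq (β : Fin n) : uVar U β =
    PowerSeries.C (MvPolynomial.C (Smooth.coord U β) ⊗ₜ[ℝ] (1 : Grass n)) := by
  simp [uVar, ofFun]

theorem eulerU_uVar (α β : Fin n) (h : SuperE U) :
    eulerU α (uVar U β) h = if β = α then h else 0 := by
  ext m
  rw [uVar_eq, eulerU, coeff_bilinSeries_C]
  refine eulerLin_single ?_ fun s => ?_
  · rw [du_coord]
    split_ifs <;> simp_all
  · rw [du_coord]
    simp

theorem eulerU_θVar (α β : Fin n) (h : SuperE U) : eulerU α (θVar U β) h = 0 := by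
  ext m
  rw [θVar, eulerU, coeff_bilinSeries_C]
  refine eulerLin_single ?_ fun s => ?_ <;> simp [du_one_tmul]

theorem eulerθ_θVar (α β : Fin n) (h : SuperE U) :
    eulerθ α (θVar U β) h = if β = α then h else 0 := by
  ext m
  rw [θVar, eulerθ, coeff_bilinSeries_C]
  refine eulerLin_single ?_ fun s => ?_
  · rw [dθ_gen]
    split_ifs <;> simp_all
  · rw [dθ_gen]
    simp

theorem eulerU_θVar_mul (α β : Fin n) (f : SuperE U) :
    eulerU α (θVar U β * f) 1 = eulerU α f (θVar U β) := by
  ext m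
  rw [eulerU, θVar, coeff_bilinSeries_C_right, coeff_bilinSeries_one, PowerSeries.coeff_C_mul]
  refine eulerLin_congr (hP := du_finite α) (hQ := du_finite α) fun s => ?_
  rw [du_mul, du_one_tmul, zero_mul, zero_add, one_mul]

/-- A left odd derivative changes sign when it passes `θ_β`. It hits `θ_β` itself only for `s = 0`,
which produces the undifferentiated term. -/
theorem eulerθ_θVar_mul (α β : Fin n) (f : SuperE U) :
    eulerθ α (θVar U β * f) 1 = (if β = α then f else 0) - eulerθ α f (θVar U β) := by
  ext m
  rw [map_sub, eulerθ, θVar, coeff_bilinSeries_C_right, coeff_bilinSeries_one,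
    PowerSeries.coeff_C_mul, eq_sub_iff_add_eq, eulerLin_apply, eulerLin_apply,
    ← finsum_add_distrib]
  -- The undifferentiated term is recognised as an Euler sum for an auxiliary family concentrated at
  -- `s = 0`.
  · refine (finsum_congr fun s => ?_).trans (eulerLin_single (P := fun s =>
      if s = 0 then (if β = α then LinearMap.id else 0) else 0) (hP := fun f =>
      (Set.finite_singleton 0).subset fun s hs => ?_) (f := PowerSeries.coeff m f) (h := 1) ?_ ?_)
    · rw [← map_add, one_mul, dθ_gen_mul]
      congr 1
      split_ifs with h1 <;> simp_all
    · by_contra h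
      exact hs (by simp at h; simp [h])
    · simp only [if_true]
      split_ifs <;> simp
    · simp
  · refine (dθ_finite α ((1 ⊗ₜ[ℝ] Grass.gen β 0) * PowerSeries.coeff m f)).subset
      fun s hs h0 => hs ?_
    dsimp only
    rw [h0, mul_zero, map_zero]
  · refine (dθ_finite α (PowerSeries.coeff m f)).subset fun s hs h0 => hs ?_
    dsimp only
    rw [h0, mul_zero, map_zero]

/-! ### Adjoint pairs of operators -/

/-- The differential operators `P` and `P'` are adjoint for the pairing of super functions and
for the twisted Euler operators in the odd directions. -/
structure AdjPair (P P' : Op U) : Prop where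
  left : IsDiffOp P
  right : IsDiffOp P'
  int : ∀ f g : SuperE U, integral (P f * g) = integral (f * P' g)
  -- The product of super functions is not commutative, so this does not follow from `int` by
  -- exchanging the factors.
  int' : ∀ f g : SuperE U, integral (P' f * g) = integral (f * P g)
  euler : ∀ γ f h, eulerθ γ (P f) h = eulerθ γ f (P' h)

theorem AdjPair.isAdjoint {P P' : Op U} (h : AdjPair P P') : IsAdjoint P P' :=
  ⟨h.left, h.right, fun _ _ => (h.int' _ _).symm⟩

theorem AdjPair.add {P P' Q Q' : Op U} (h : AdjPair P P') (k : AdjPair Q Q') :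
    AdjPair (P + Q) (P' + Q') where
  left := h.left.add k.left
  right := h.right.add k.right
  int f g := by simp only [LinearMap.add_apply, add_mul, mul_add, map_add, h.int, k.int]
  int' f g := by simp only [LinearMap.add_apply, add_mul, mul_add, map_add, h.int', k.int']
  euler γ f g := by simp only [LinearMap.add_apply, map_add, h.euler, k.euler]

theorem AdjPair.smul {P P' : Op U} (c : ℝ) (h : AdjPair P P') : AdjPair (c • P) (c • P') where
  left := h.left.smul c
  right := h.right.smul c
  int f g := by
    simp only [LinearMap.smul_apply, SuperE.smul_mul, SuperE.mul_smul, map_smul, h.int]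
  int' f g := by
    simp only [LinearMap.smul_apply, SuperE.smul_mul, SuperE.mul_smul, map_smul, h.int']
  euler γ f g := by simp only [LinearMap.smul_apply, map_smul, h.euler]

theorem AdjPair.neg {P P' : Op U} (h : AdjPair P P') : AdjPair (-P) (-P') := by
  have e : ∀ R : Op U, (-1 : ℝ) • R = -R := fun R => by ext; simp
  simpa only [e] using h.smul (-1)

theorem AdjPair.sub {P P' Q Q' : Op U} (h : AdjPair P P') (k : AdjPair Q Q') :
    AdjPair (P - Q) (P' - Q') := by
  have e : ∀ R S : Op U, R + -S = R - S := fun R S => (sub_eq_add_neg R S).symm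
  simpa only [e] using h.add k.neg

theorem AdjPair.mul {P P' Q Q' : Op U} (h : AdjPair P P') (k : AdjPair Q Q') :
    AdjPair (P * Q) (Q' * P') where
  left := h.left.mul k.left
  right := k.right.mul h.right
  int f g := by simp only [Module.End.mul_apply, h.int, k.int]
  int' f g := by simp only [Module.End.mul_apply, h.int', k.int']
  euler γ f g := by simp only [Module.End.mul_apply, h.euler, k.euler]

theorem adjSym_adjSym (φ : ℝ⟦X⟧) : adjSym (adjSym φ) = φ := by
  ext k
  rw [coeff_adjSym, coeff_adjSym, ← mul_assoc, ← mul_pow]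
  simp

theorem pairing_dx_pow (k : ℕ) (f g : Super U) : pairing U ((dx ^ k) f) g =
    pairing U f (((-dx : Module.End ℝ (Super U)) ^ k) g) := by
  induction k generalizing f g with
  | zero => rfl
  | succ k ih =>
    rw [pow_succ, Module.End.mul_apply, ih, pairing_dx, pow_succ', Module.End.mul_apply,
      pairing_apply, pairing_apply, LinearMap.neg_apply, Super.neg_mul, Super.mul_neg]

theorem integral_symbolOp_mul (φ : ℝ⟦X⟧) (f g : SuperE U) :
    integral (symbolOp U φ f * g) = integral (f * symbolOp U (adjSym φ) g) := by
  rw [symbolOp_eq, symbolOp_eq]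
  refine integral_conv (fun k f g => ?_) f g
  have := pairing_dx_pow k f g
  rw [neg_dx_pow] at this
  simp only [pairing_apply, coeff_symbolSeries, coeff_adjSym, LinearMap.smul_apply] at this ⊢
  rw [smul_mul_assoc, map_smul, this, mul_comm, mul_smul, mul_smul_comm, mul_smul_comm, map_smul,
    map_smul, mul_smul_comm, map_smul]

theorem adjPair_symbolOp (φ : ℝ⟦X⟧) : AdjPair (symbolOp U φ) (symbolOp U (adjSym φ)) where
  left := isDiffOp_symbolOp φ
  right := isDiffOp_symbolOp _
  int := integral_symbolOp_mul φ
  int' f g := by rw [integral_symbolOp_mul, adjSym_adjSym]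
  euler γ f h := eulerθ_symbolOp γ φ f h

theorem adjPair_ofFun (c : (DiffPoly U)⟦X⟧) : AdjPair (mulOp (ofFun c)) (mulOp (ofFun c)) where
  left := isDiffOp_mulOp c
  right := isDiffOp_mulOp c
  int _ _ := by rw [mulOp_apply, mulOp_apply, ofFun_mul_comm, mul_assoc]
  int' _ _ := by rw [mulOp_apply, mulOp_apply, ofFun_mul_comm, mul_assoc]
  euler γ f h := eulerθ_ofFun_mul γ c f h

/-- Differentiating the left `θ` gives `Q θ`; differentiating the right one gives, after
transposition, `-Q† θ`, which is the same by skew-symmetry. The doubling cancels the factor `½`. -/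
theorem δθ_bivector {Q : Matrix (Fin n) (Fin n) (Op U)} (hQ : ∀ α β, AdjPair (Q α β) (-Q β α))
    (γ : Fin n) : δθ γ (bivector Q) = ∑ β, Q γ β (θVar U β) := by
  rw [bivector, map_smul, δθ_integral]
  simp only [map_sum, LinearMap.sum_apply, eulerθ_θVar_mul, (hQ _ _).euler, eulerθ_θVar,
    Finset.sum_sub_distrib]
  simp [← two_smul ℝ, smul_smul]

theorem δu_bivector (Q : Matrix (Fin n) (Fin n) (Op U)) (γ : Fin n) :
    δu γ (bivector Q) = (1 / 2 : ℝ) • ∑ α, ∑ β, eulerU γ (Q α β (θVar U β)) (θVar U α) := by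
  rw [bivector, map_smul, δu_integral]
  simp only [map_sum, LinearMap.sum_apply, eulerU_θVar_mul]

end SuperJet

namespace SuperJet

variable {n : ℕ} {U : Opens (Fin n → ℝ)}

/-! ### Shift operators -/

theorem coeff_shift (k : ℤ) (a : ℕ) :
    PowerSeries.coeff a (shift k) = (k : ℝ) ^ a * ((a.factorial : ℝ))⁻¹ := by
  simp [shift, PowerSeries.coeff_rescale, PowerSeries.coeff_exp]

theorem shift_add (j k : ℤ) : shift (j + k) = shift j * shift k := by
  rw [shift, shift, shift, PowerSeries.exp_mul_exp_eq_exp_add, Int.cast_add]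

theorem shift_zero : shift 0 = 1 := by
  ext a
  rw [coeff_shift, PowerSeries.coeff_one]
  split_ifs with h <;> simp [h]

theorem adjSym_shift (k : ℤ) : adjSym (shift k) = shift (-k) := by
  ext a
  rw [coeff_adjSym, coeff_shift, coeff_shift, ← mul_assoc, ← mul_pow]
  simp

theorem symbolOp_mul_apply (φ ψ : ℝ⟦X⟧) (f : SuperE U) :
    symbolOp U (φ * ψ) f = symbolOp U φ (symbolOp U ψ f) := by
  rw [← symbolHom_apply, map_mul]
  rfl

theorem symbolOp_add (φ ψ : ℝ⟦X⟧) : symbolOp U (φ + ψ) = symbolOp U φ + symbolOp U ψ :=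
  map_add (symbolHom U) φ ψ

theorem symbolOp_sub (φ ψ : ℝ⟦X⟧) : symbolOp U (φ - ψ) = symbolOp U φ - symbolOp U ψ :=
  map_sub (symbolHom U) φ ψ

theorem symbolOp_one : symbolOp U 1 = 1 := map_one (symbolHom U)

theorem Λ_zero : Λ U 0 = 1 := by rw [Λ, shift_zero, symbolOp_one]

theorem Λ_Λ (j k : ℤ) (f : SuperE U) : Λ U j (Λ U k f) = Λ U (j + k) f := by
  rw [Λ, Λ, Λ, shift_add, symbolOp_mul_apply]

/-- Divided powers `∂ₓ^a / a!` absorb the binomial coefficients, so the Leibniz rule becomes a plain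
convolution; this is the form in which an exponential is multiplicative. -/
theorem dx_pow_mul (a : ℕ) (x y : Super U) :
    ((a.factorial : ℝ))⁻¹ • (dx ^ a) (x * y) = ∑ p ∈ Finset.HasAntidiagonal.antidiagonal a,
      (((p.1.factorial : ℝ))⁻¹ • (dx ^ p.1) x) * (((p.2.factorial : ℝ))⁻¹ • (dx ^ p.2) y) := by
  have step : ∀ (k : ℕ) (z : Super U), dx (((k.factorial : ℝ))⁻¹ • (dx ^ k) z) =
      ((k + 1 : ℕ) : ℝ) • (((k + 1).factorial : ℝ))⁻¹ • (dx ^ (k + 1)) z := by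
    intro k z
    have h1 : ((k.factorial : ℝ))⁻¹ = ((k + 1 : ℕ) : ℝ) * (((k + 1).factorial : ℝ))⁻¹ := by
      have : (k.factorial : ℝ) ≠ 0 := by positivity
      rw [Nat.factorial_succ]
      push_cast
      field_simp
    rw [map_smul, h1, mul_smul, pow_succ', Module.End.mul_apply]
  induction a with
  | zero => simp
  | succ a ih =>
    have hne : ((a + 1 : ℕ) : ℝ) ≠ 0 := by positivity
    refine smul_right_injective _ hne ?_
    dsimp only
    rw [← step, ih, map_sum]
    simp only [dx_mul, step, Finset.sum_add_distrib]
    -- On each pair of sum `a + 1` the factor `a + 1` is split into the two entries; each entry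
    -- kills the boundary term that would prevent lowering the index.
    have split : ∀ F : ℕ → ℕ → Super U, ((a + 1 : ℕ) : ℝ) •
        ∑ p ∈ Finset.HasAntidiagonal.antidiagonal (a + 1), F p.1 p.2 =
        ∑ p ∈ Finset.HasAntidiagonal.antidiagonal a, ((p.1 + 1 : ℕ) : ℝ) • F (p.1 + 1) p.2 +
        ∑ p ∈ Finset.HasAntidiagonal.antidiagonal a, ((p.2 + 1 : ℕ) : ℝ) • F p.1 (p.2 + 1) := by
      intro F
      have e : ((a + 1 : ℕ) : ℝ) • ∑ p ∈ Finset.HasAntidiagonal.antidiagonal (a + 1), F p.1 p.2 =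
          ∑ p ∈ Finset.HasAntidiagonal.antidiagonal (a + 1), (p.1 : ℝ) • F p.1 p.2 +
          ∑ p ∈ Finset.HasAntidiagonal.antidiagonal (a + 1), (p.2 : ℝ) • F p.1 p.2 := by
        rw [← Finset.sum_add_distrib, Finset.smul_sum]
        refine Finset.sum_congr rfl fun p hp => ?_
        rw [← add_smul, ← Nat.cast_add, Finset.HasAntidiagonal.mem_antidiagonal.1 hp]
      rw [e, Finset.Nat.sum_antidiagonal_succ, Finset.Nat.sum_antidiagonal_succ']
      simp
    rw [split (fun i j => (((i.factorial : ℝ))⁻¹ • (dx ^ i) x) *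
      (((j.factorial : ℝ))⁻¹ • (dx ^ j) y))]
    congr 1 <;> refine Finset.sum_congr rfl fun p _ => ?_
    · exact smul_mul_assoc _ _ _
    · exact mul_smul_comm _ _ _

/-- The exponential of a derivation is an automorphism. -/
theorem Λ_mul (k : ℤ) (f g : SuperE U) : Λ U k (f * g) = Λ U k f * Λ U k g := by
  have key : ∀ (a : ℕ) (x y : Super U), PowerSeries.coeff a (shift k) • (dx ^ a) (x * y) =
      ∑ p ∈ Finset.HasAntidiagonal.antidiagonal a,
        (PowerSeries.coeff p.1 (shift k) • (dx ^ p.1) x) *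
          (PowerSeries.coeff p.2 (shift k) • (dx ^ p.2) y) := by
    intro a x y
    rw [coeff_shift, mul_smul, dx_pow_mul, Finset.smul_sum]
    refine Finset.sum_congr rfl fun p hp => ?_
    rw [← Finset.HasAntidiagonal.mem_antidiagonal.1 hp, coeff_shift, coeff_shift,
      mul_smul (_ ^ p.1), mul_smul (_ ^ p.2), smul_mul_smul_comm, pow_add,
      smul_mul_smul_comm, smul_mul_smul_comm]
  ext m
  rw [Λ, symbolOp_eq, coeff_conv, PowerSeries.coeff_mul]
  simp only [coeff_conv, coeff_symbolSeries, LinearMap.smul_apply, PowerSeries.coeff_mul, map_sum,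
    key, Finset.sum_mul, Finset.mul_sum]
  simp only [Finset.sum_sigma']
  -- Both sides are indexed by 2×2 arrays of exponents with sum `m`, one grouped by rows and the
  -- other by columns; the bijection is transposition, its own inverse.
  refine Finset.sum_nbij'
    (fun x => ⟨(x.2.2.1 + x.2.1.1, x.2.2.2 + x.2.1.2), (x.2.2.2, x.2.1.2), (x.2.2.1, x.2.1.1)⟩)
    (fun x => ⟨(x.2.2.1 + x.2.1.1, x.2.2.2 + x.2.1.2), (x.2.2.2, x.2.1.2), (x.2.2.1, x.2.1.1)⟩)
    ?_ ?_ ?_ ?_ ?_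
  · rintro ⟨⟨a, b⟩, ⟨c, d⟩, ⟨e, f⟩⟩ h
    simp only [Finset.mem_sigma, Finset.HasAntidiagonal.mem_antidiagonal] at h ⊢
    exact ⟨by omega, trivial, trivial⟩
  · rintro ⟨⟨a, b⟩, ⟨c, d⟩, ⟨e, f⟩⟩ h
    simp only [Finset.mem_sigma, Finset.HasAntidiagonal.mem_antidiagonal] at h ⊢
    exact ⟨by omega, trivial, trivial⟩
  · rintro ⟨⟨a, b⟩, ⟨c, d⟩, ⟨e, f⟩⟩ h
    simp only [Finset.mem_sigma, Finset.HasAntidiagonal.mem_antidiagonal] at h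
    obtain ⟨-, h1, h2⟩ := h
    subst h1 h2
    rfl
  · rintro ⟨⟨a, b⟩, ⟨c, d⟩, ⟨e, f⟩⟩ h
    simp only [Finset.mem_sigma, Finset.HasAntidiagonal.mem_antidiagonal] at h
    obtain ⟨-, h1, h2⟩ := h
    subst h1 h2
    rfl
  · rintro ⟨⟨a, b⟩, ⟨c, d⟩, ⟨e, f⟩⟩ -
    rfl

theorem symbolOp_apply_one (φ : ℝ⟦X⟧) :
    symbolOp U φ 1 = PowerSeries.coeff 0 φ • (1 : SuperE U) := by
  ext m
  rw [symbolOp_eq, coeff_conv, coeff_smulE, Finset.sum_eq_single (m, 0)]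
  · rw [coeff_symbolSeries, PowerSeries.coeff_one, PowerSeries.coeff_one, if_pos rfl]
    cases m with
    | zero => simp
    | succ m => simp [pow_succ, dx_one]
  · rintro ⟨a, b⟩ hab h
    have : b ≠ 0 := by
      rintro rfl
      simp at hab
      exact h (by rw [hab])
    simp [PowerSeries.coeff_one, this]
  · simp

/-- Move `Λ^k` onto the constant `1`: the adjoint `Λ^{-k}` fixes it, the symbol having constant term
`1`. -/
theorem integral_Λ (k : ℤ) (f : SuperE U) : integral (Λ U k f) = integral f := by
  have h := integral_symbolOp_mul (shift k) f 1
  rwa [mul_one, adjSym_shift, symbolOp_apply_one, coeff_shift, pow_zero, Nat.factorial_zero,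
    Nat.cast_one, inv_one, mul_one, one_smul, mul_one] at h

/-! ### Elements linear in the odd variables -/

variable (U) in
/-- The elements of the super ring that are linear in the odd variables. -/
noncomputable def oddLin : Submodule ℝ (Super U) :=
  LinearMap.range (TensorProduct.map (LinearMap.id (R := ℝ) (M := DiffPoly U))
    (ExteriorAlgebra.ι ℝ (M := Fin n × ℕ →₀ ℝ)))

theorem oddLin_anticomm {x y : Super U} (hx : x ∈ oddLin U) (hy : y ∈ oddLin U) :
    x * y = -(y * x) := by
  obtain ⟨s, rfl⟩ := hx
  obtain ⟨t, rfl⟩ := hy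
  induction s using TensorProduct.induction_on with
  | zero => simp
  | tmul p v =>
    induction t using TensorProduct.induction_on with
    | zero => simp
    | tmul q w =>
      have h : ExteriorAlgebra.ι ℝ v * ExteriorAlgebra.ι ℝ w =
          -(ExteriorAlgebra.ι ℝ w * ExteriorAlgebra.ι ℝ v) :=
        eq_neg_of_add_eq_zero_left (ExteriorAlgebra.ι_add_mul_swap v w)
      simp only [TensorProduct.map_tmul, LinearMap.id_apply, Algebra.TensorProduct.tmul_mul_tmul,
        h, TensorProduct.tmul_neg, mul_comm q]
    | add f g hf hg => simp only [mul_add, add_mul, map_add, hf, hg]; abel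
  | add f g hf hg => simp only [add_mul, mul_add, map_add, hf, hg]; abel

theorem dx_mem_oddLin {x : Super U} (hx : x ∈ oddLin U) : dx x ∈ oddLin U := by
  obtain ⟨s, rfl⟩ := hx
  refine ⟨TensorProduct.map totalU.toLinearMap LinearMap.id s +
    TensorProduct.map LinearMap.id shiftT s, ?_⟩
  induction s using TensorProduct.induction_on with
  | zero => simp
  | tmul p v => simp [dx, totalT_ι]
  | add f g hf hg =>
    simp only [map_add] at hf hg ⊢
    rw [← hf, ← hg]
    abel

theorem tmul_one_mul_mem_oddLin (c : DiffPoly U) {x : Super U} (hx : x ∈ oddLin U) :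
    (c ⊗ₜ[ℝ] (1 : Grass n)) * x ∈ oddLin U := by
  obtain ⟨s, rfl⟩ := hx
  induction s using TensorProduct.induction_on with
  | zero => simp
  | tmul p v => exact ⟨(c * p) ⊗ₜ v, by simp⟩
  | add f g hf hg => simpa only [mul_add, map_add] using add_mem hf hg

variable (U) in
/-- The power series in `ε` that are linear in the odd variables. -/
noncomputable def oddE : Submodule ℝ (SuperE U) where
  carrier := {f | ∀ m, PowerSeries.coeff m f ∈ oddLin U}
  add_mem' hf hg m := by
    rw [map_add]
    exact add_mem (hf m) (hg m)
  zero_mem' m := by simp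
  smul_mem' c f hf m := by
    rw [coeff_smulE]
    exact Submodule.smul_mem _ c (hf m)

theorem oddE_anticomm {x y : SuperE U} (hx : x ∈ oddE U) (hy : y ∈ oddE U) :
    x * y = -(y * x) := by
  ext m
  rw [map_neg, PowerSeries.coeff_mul, PowerSeries.coeff_mul, ← Finset.Nat.sum_antidiagonal_swap,
    ← Finset.sum_neg_distrib]
  exact Finset.sum_congr rfl fun p _ => oddLin_anticomm (hx _) (hy _)

theorem oddE_sq {x : SuperE U} (hx : x ∈ oddE U) : x * x = 0 := by
  have h := oddE_anticomm hx hx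
  have h2 : (2 : ℝ) • (x * x) = 0 := by
    rw [two_smul]
    nth_rewrite 1 [h]
    exact neg_add_cancel _
  calc x * x = (1 / 2 : ℝ) • (2 : ℝ) • (x * x) := by
        rw [smul_smul, one_div_mul_cancel two_ne_zero, one_smul]
    _ = 0 := by rw [h2, smul_zero]

theorem symbolOp_mem_oddE (φ : ℝ⟦X⟧) {x : SuperE U} (hx : x ∈ oddE U) :
    symbolOp U φ x ∈ oddE U := by
  intro m
  rw [symbolOp_eq, coeff_conv]
  refine sum_mem fun p _ => ?_
  rw [coeff_symbolSeries, LinearMap.smul_apply]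
  refine Submodule.smul_mem _ _ ?_
  generalize p.1 = k
  induction k with
  | zero => exact hx _
  | succ k ih => rw [pow_succ']; exact dx_mem_oddLin ih

theorem ofFun_mul_mem_oddE (c : (DiffPoly U)⟦X⟧) {x : SuperE U} (hx : x ∈ oddE U) :
    ofFun c * x ∈ oddE U := by
  intro m
  rw [PowerSeries.coeff_mul]
  refine sum_mem fun p _ => ?_
  rw [coeff_ofFun]
  exact tmul_one_mul_mem_oddLin _ (hx _)

theorem θVar_mem_oddE (α : Fin n) : θVar U α ∈ oddE U := by
  intro m
  rw [θVar, PowerSeries.coeff_C]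
  split_ifs
  · exact ⟨1 ⊗ₜ Finsupp.single (α, 0) 1, by simp [Grass.gen]⟩
  · exact zero_mem _

/-! ### Symbols acting on functions -/

/-- The operator `φ(ε∂ₓ)` on functions on the jet space. -/
noncomputable def symbolFun (φ : ℝ⟦X⟧) (c : (DiffPoly U)⟦X⟧) : (DiffPoly U)⟦X⟧ :=
  PowerSeries.mk fun m => ∑ kl ∈ Finset.HasAntidiagonal.antidiagonal m,
    PowerSeries.coeff kl.1 φ • ((totalU.toLinearMap : Module.End ℝ (DiffPoly U)) ^ kl.1)
      (PowerSeries.coeff kl.2 c)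

theorem dx_pow_tmul_one (k : ℕ) (c : DiffPoly U) : (dx ^ k) (c ⊗ₜ[ℝ] (1 : Grass n)) =
    ((totalU.toLinearMap : Module.End ℝ (DiffPoly U)) ^ k) c ⊗ₜ[ℝ] 1 := by
  induction k with
  | zero => rfl
  | succ k ih =>
    rw [pow_succ', Module.End.mul_apply, ih, dx_tmul_one, pow_succ', Module.End.mul_apply]
    rfl

/-- A shifted function is again a function, hence central; the stability of even elements in the
shift calculus rests on this. -/
theorem ofFun_symbolFun (φ : ℝ⟦X⟧) (c : (DiffPoly U)⟦X⟧) :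
    ofFun (symbolFun φ c) = symbolOp U φ (ofFun c) := by
  ext m
  rw [coeff_ofFun, symbolFun, PowerSeries.coeff_mk, TensorProduct.sum_tmul, symbolOp_eq,
    coeff_conv]
  refine Finset.sum_congr rfl fun p _ => ?_
  rw [coeff_ofFun, coeff_symbolSeries, LinearMap.smul_apply, dx_pow_tmul_one,
    TensorProduct.smul_tmul']

end SuperJet

namespace SuperJet

/-! ### Anticommuting families -/

/-- A family `x` of anticommuting elements and a family `c` of central elements of a ring. -/
structure Anticomm {R : Type*} [Ring R] (x c : ℕ → R) : Prop where
  swap : ∀ i j, x i * x j = -(x j * x i)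
  sq : ∀ i, x i * x i = 0
  central : ∀ i y, c i * y = y * c i

namespace Anticomm

set_option linter.unusedSimpArgs false

variable {R : Type*} [Ring R] {x c : ℕ → R}

/-- The inequality orients the exchange: used as a simp rule it sorts odd factors by increasing
index and terminates. The associated variants reach inside right-nested products. -/
theorem swap_lt (h : Anticomm x c) {i j : ℕ} (_ : i < j) : x j * x i = -(x i * x j) := h.swap j i

theorem swap_lt_assoc (h : Anticomm x c) {i j : ℕ} (_ : i < j) (y : R) :
    x j * (x i * y) = -(x i * (x j * y)) := by
  rw [← mul_assoc, h.swap, neg_mul, mul_assoc]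

theorem sq_assoc (h : Anticomm x c) (i : ℕ) (y : R) : x i * (x i * y) = 0 := by
  rw [← mul_assoc, h.sq, zero_mul]

theorem mul_central (h : Anticomm x c) (i j : ℕ) : x i * c j = c j * x i := (h.central _ _).symm

theorem mul_central_assoc (h : Anticomm x c) (i j : ℕ) (y : R) :
    x i * (c j * y) = c j * (x i * y) := by
  rw [← mul_assoc, h.mul_central, mul_assoc]

theorem central_lt_assoc (h : Anticomm x c) {i j : ℕ} (_ : i < j) (y : R) :
    c j * (c i * y) = c i * (c j * y) := by
  rw [← mul_assoc, h.central, mul_assoc]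

/-- The grouping on the right is chosen so that, after the substitution in `first_bracket`, each
bracket is a difference of a monomial and its shift. -/
theorem first_identity (h : Anticomm x c) :
    (x 3 - x 1 + c 0 * x 4 - c 2 * x 7) * -(x 5 * (c 1 * x 6)) + c 0 * (x 5 - x 4) *
      (x 2 * x 4 - x 0 * x 5 + c 3 * (x 5 * x 4) + (x 4 - x 5) * x 8) =
    (c 1 * (c 2 * (x 5 * (x 6 * x 7))) - c 0 * (c 1 * (x 4 * (x 5 * x 6)))) +
      (c 0 * (x 2 * (x 4 * x 5)) - c 1 * (x 3 * (x 5 * x 6))) +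
      (c 1 * (x 1 * (x 5 * x 6)) - c 0 * (x 0 * (x 4 * x 5))) := by
  simp only [mul_add, add_mul, mul_sub, sub_mul, mul_neg, neg_mul, neg_neg, mul_assoc,
    h.swap_lt, h.swap_lt_assoc, h.sq, h.sq_assoc, h.mul_central, h.mul_central_assoc,
    h.central_lt_assoc, Nat.reduceLT, Nat.one_lt_ofNat, mul_zero, zero_mul,
    Nat.ofNat_pos, Nat.one_pos, zero_lt_one]
  abel

/-- The products `x 3 * x 1 * x 3`, `x 5 * x 4 * x 5` and `x 6 * x 7 * x 6` vanish, which removes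
everything quadratic in the composite elements that `x 3`, `x 5`, `x 6` stand for. -/
theorem second_identity (h : Anticomm x c) :
    (c 1 * x 2 - c 0 * x 0 + c 2 * x 3) * (x 1 * x 3) +
      c 0 * x 5 * (x 0 * x 1 + x 4 * x 5) + c 3 * x 6 * (x 7 * x 6) =
    -((c 1 * (x 1 * x 2) + c 0 * (x 0 * x 1)) * x 3) + c 0 * (x 0 * x 1) * x 5 := by
  simp only [mul_add, add_mul, mul_sub, sub_mul, mul_neg, neg_mul, neg_neg, mul_assoc,
    h.swap_lt, h.swap_lt_assoc, h.sq, h.sq_assoc, h.mul_central, h.mul_central_assoc,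
    h.central_lt_assoc, Nat.reduceLT, Nat.one_lt_ofNat, mul_zero, zero_mul,
    Nat.ofNat_pos, Nat.one_pos, zero_lt_one]
  abel

theorem mixed_identity (h : Anticomm x c) :
    (x 3 - x 1 + c 0 * x 4 - c 2 * x 7) * (x 2 * x 9) +
      (c 0 * x 0 - c 1 * x 3 + c 0 * (c 3 * x 4) - c 4 * (c 1 * x 6) + x 11) *
        (x 1 * x 2 + x 5 * x 11) +
      c 0 * (x 5 - x 4) * (x 8 * x 10) +
      -(x 5 * (c 1 * x 6)) * (c 6 * x 3 - c 5 * x 1 + c 4 * x 9) +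
      (x 2 * x 4 - x 0 * x 5 + c 3 * (x 5 * x 4) + (x 4 - x 5) * x 8) * (c 0 * x 10) =
    (-(x 1 * x 2 + x 2 * x 3) +
        (-(c 0 * (x 2 * x 4)) + c 2 * (x 2 * x 7) - c 1 * (c 4 * (x 5 * x 6)))) * x 9 +
      (c 0 * (x 2 * x 4) - c 0 * (x 0 * x 5) - c 0 * (c 3 * (x 4 * x 5))) * x 10 +
      x 1 * x 2 * x 11 +
      (c 0 * (x 0 * x 5) - c 1 * (x 3 * x 5) + c 0 * (c 3 * (x 4 * x 5)) +
        c 1 * (c 4 * (x 5 * x 6))) * x 11 +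
      ((c 0 * x 0 - c 1 * x 3 + c 0 * (c 3 * x 4) - c 4 * (c 1 * x 6)) * (x 1 * x 2) -
        c 1 * (x 5 * (x 6 * (c 6 * x 3 - c 5 * x 1)))) := by
  simp only [mul_add, add_mul, mul_sub, sub_mul, mul_neg, neg_mul, neg_neg, mul_assoc,
    h.swap_lt, h.swap_lt_assoc, h.sq, h.sq_assoc, h.mul_central, h.mul_central_assoc,
    h.central_lt_assoc, Nat.reduceLT, Nat.one_lt_ofNat, mul_zero, zero_mul,
    Nat.ofNat_pos, Nat.one_pos, zero_lt_one]
  abel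

theorem square_identity (h : Anticomm x c) :
    x 0 * x 1 * (c 0 * x 0 - c 1 * x 1) = 0 := by
  simp only [mul_sub, mul_assoc, h.swap_lt, h.swap_lt_assoc, h.sq, h.sq_assoc, h.mul_central,
    h.mul_central_assoc, mul_zero, zero_lt_one, mul_neg, neg_zero, sub_zero]

/-- The group free of composite elements, corrected by quadratic terms times `c 4 * x 2` and `c 5 *
x 5` (later `u t₁` and `v t₂`) and one shift of the former, becomes three pairs of a monomial and
its shift. -/
theorem residual_identity (h : Anticomm x c) :
    -(x 1 * x 2 * (c 3 * x 1 - c 4 * x 2)) - (c 1 * (x 3 * x 5) - c 0 * (x 2 * x 4)) * (c 4 * x 2) +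
      (c 2 * (x 2 * x 7) - c 1 * (x 1 * x 6)) * (c 4 * x 2) +
      (c 0 * (x 2 * x 4) - c 0 * (x 0 * x 5) - c 0 * (c 3 * (x 4 * x 5))) * (c 5 * x 5) -
      (c 1 * (x 3 * x 5) - c 1 * (x 1 * x 6) - c 1 * (c 4 * (x 5 * x 6))) * (c 5 * x 5) +
      ((c 0 * x 0 - c 1 * x 3 + c 0 * (c 3 * x 4) - c 4 * (c 1 * x 6)) * (x 1 * x 2) -
        c 1 * (x 5 * (x 6 * (c 6 * x 3 - c 5 * x 1)))) =
    (c 0 * (c 5 * (x 2 * (x 4 * x 5))) - c 1 * (c 6 * (x 3 * (x 5 * x 6)))) +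
      (c 0 * (c 3 * (x 4 * (x 1 * x 2))) - c 1 * (c 4 * (x 5 * (x 2 * x 3)))) +
      (c 0 * (x 0 * (x 1 * x 2)) - c 1 * (x 1 * (x 2 * x 3))) := by
  simp only [mul_add, add_mul, mul_sub, sub_mul, mul_neg, neg_mul, neg_neg, mul_assoc,
    h.swap_lt, h.swap_lt_assoc, h.sq, h.sq_assoc, h.mul_central, h.mul_central_assoc,
    h.central_lt_assoc, Nat.reduceLT, Nat.one_lt_ofNat, mul_zero, zero_mul,
    Nat.ofNat_pos, Nat.one_pos, zero_lt_one, neg_zero]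
  abel

end Anticomm

/-! ### Shift calculus -/

/-- Shifts `L k` of a ring with a shift-invariant functional `J`, where the elements satisfying `O`
anticommute and the elements satisfying `Z` are central. -/
structure ShiftCalculus {R M : Type*} [Ring R] [AddCommGroup M] (L : ℤ → R → R) (J : R → M)
    (O Z : R → Prop) : Prop where
  L_add : ∀ k f g, L k (f + g) = L k f + L k g
  L_mul : ∀ k f g, L k (f * g) = L k f * L k g
  L_zero : ∀ f, L 0 f = f
  L_L : ∀ j k f, L j (L k f) = L (j + k) f
  J_add : ∀ f g, J (f + g) = J f + J g
  J_L : ∀ k f, J (L k f) = J f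
  odd_add : ∀ f g, O f → O g → O (f + g)
  odd_L : ∀ k f, O f → O (L k f)
  even_L : ∀ k f, Z f → Z (L k f)
  anticomm : ∀ f g, O f → O g → f * g = -(g * f)
  sq : ∀ f, O f → f * f = 0
  central : ∀ f g, Z f → f * g = g * f
  even_mul_odd : ∀ f g, Z f → O g → O (f * g)
  odd_zero : O 0
  even_zero : Z 0
  odd_neg : ∀ f, O f → O (-f)

namespace ShiftCalculus

variable {R M : Type*} [Ring R] [AddCommGroup M] {L : ℤ → R → R} {J : R → M} {O Z : R → Prop}

theorem J_neg (S : ShiftCalculus L J O Z) (f : R) : J (-f) = -J f :=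
  map_neg (AddMonoidHom.mk' J S.J_add) f

theorem J_sub (S : ShiftCalculus L J O Z) (f g : R) : J (f - g) = J f - J g :=
  map_sub (AddMonoidHom.mk' J S.J_add) f g

theorem J_zero (S : ShiftCalculus L J O Z) : J 0 = 0 :=
  map_zero (AddMonoidHom.mk' J S.J_add)

theorem odd_sub (S : ShiftCalculus L J O Z) (f g : R) (hf : O f) (hg : O g) : O (f - g) := by
  rw [sub_eq_add_neg]
  exact S.odd_add _ _ hf (S.odd_neg _ hg)

theorem J_L_mul_L (S : ShiftCalculus L J O Z) (i j : ℤ) (f g : R) :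
    J (L i f * L j g) = J (f * L (j - i) g) := by
  rw [← S.J_L (-i), S.L_mul, S.L_L, S.L_L, neg_add_cancel, S.L_zero, neg_add_eq_sub]

theorem J_L_mul (S : ShiftCalculus L J O Z) (i : ℤ) (f g : R) :
    J (L i f * g) = J (f * L (-i) g) := by
  rw [← S.L_zero g, S.J_L_mul_L, zero_sub, S.L_zero]

/-- Finite lists are extended to sequences by `0`, which counts as both odd and even, so indices
past the end are harmless. -/
theorem anticomm_list (S : ShiftCalculus L J O Z) {l m : List R} (hl : ∀ f ∈ l, O f)
    (hm : ∀ f ∈ m, Z f) : Anticomm (fun i => l.getD i 0) (fun i => m.getD i 0) := by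
  have ho : ∀ i, O (l.getD i 0) := fun i => by
    rcases lt_or_ge i l.length with h | h
    · rw [List.getD_eq_getElem _ _ h]
      exact hl _ (List.getElem_mem h)
    · rw [List.getD_eq_default _ _ h]
      exact S.odd_zero
  have hz : ∀ i, Z (m.getD i 0) := fun i => by
    rcases lt_or_ge i m.length with h | h
    · rw [List.getD_eq_getElem _ _ h]
      exact hm _ (List.getElem_mem h)
    · rw [List.getD_eq_default _ _ h]
      exact S.even_zero
  exact ⟨fun i j => S.anticomm _ _ (ho i) (ho j), fun i => S.sq _ (ho i),
    fun i y => S.central _ y (hz i)⟩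

theorem J_L_sub (S : ShiftCalculus L J O Z) {k : ℤ} {f g : R} (h : g = L k f) : J (g - f) = 0 := by
  rw [S.J_sub, h, S.J_L, sub_self]

theorem J_sub_L (S : ShiftCalculus L J O Z) {k : ℤ} {f g : R} (h : g = L k f) : J (f - g) = 0 := by
  rw [S.J_sub, h, S.J_L, sub_self]

variable {u v w t₁ t₂ t₃ A C : R}

theorem first_bracket (S : ShiftCalculus L J O Z) (hu : Z u) (hw : Z w) (h₁ : O t₁) (h₂ : O t₂)
    (h₃ : O t₃) :
    J ((L 1 t₁ - L (-1) t₁ + w * L (-1) t₂ - L 2 (w * t₂)) * -(t₂ * L 1 (w * t₂)) +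
      w * (t₂ - L (-1) t₂) * (t₁ * L (-1) t₂ - L (-2) t₁ * t₂ + L (-1) u * (t₂ * L (-1) t₂) +
        (L (-1) t₂ - t₂) * t₃)) = 0 := by
  have h := (S.anticomm_list
    (l := [L (-2) t₁, L (-1) t₁, t₁, L 1 t₁, L (-1) t₂, t₂, L 1 t₂, L 2 t₂, t₃])
    (m := [w, L 1 w, L 2 w, L (-1) u]) (by simp [S.odd_L, *]) (by simp [S.even_L, *])).first_identity
  simp only [List.getD_cons_zero, List.getD_cons_succ] at h
  rw [S.L_mul, S.L_mul, h, S.J_add, S.J_add, S.J_L_sub (k := 1), S.J_sub_L (k := 1),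
    S.J_L_sub (k := 1), add_zero, add_zero]
  all_goals simp [S.L_mul, S.L_L, S.L_zero]

/-- Only oddness of `Γ` matters, since it enters as `Γ t₃ Γ`. With `K = v (Λ⁻¹t₁) t₁` the integrand
is `-(ΛK + K) Φ + K (Λ(w t₃) - w t₃)`. Moving the shift off `K` leaves `Φ + Λ⁻¹Φ = Λ⁻¹A - ΛA + Λ²C -
C`, whose `C` part equals `Λ(w t₃) - w t₃`. -/
theorem second_bracket (S : ShiftCalculus L J O Z) (hu : Z u) (hv : Z v) (hw : Z w) (h₁ : O t₁)
    (h₂ : O t₂) (h₃ : O t₃) (hA : O A) (hC : O C) (eA : A + L 1 A = u * t₁)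
    (eC : C + L 1 C = w * t₃) {Φ Γ : R} (eΦ : Φ = A - L 1 A + (L 2 C - L 1 C)) (hΓ : O Γ) :
    J ((L 1 (v * t₁) - v * L (-1) t₁ + u * Φ) * (t₁ * Φ) +
      v * (L 1 (w * t₃) - w * t₃) * (L (-1) t₁ * t₁ + t₂ * (L 1 (w * t₃) - w * t₃)) +
      w * Γ * (t₃ * Γ)) = 0 := by
  have hΦ : O Φ := by
    rw [eΦ]
    exact S.odd_add _ _ (S.odd_sub _ _ hA (S.odd_L _ _ hA))
      (S.odd_sub _ _ (S.odd_L _ _ hC) (S.odd_L _ _ hC))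
  have hD : O (L 1 (w * t₃) - w * t₃) := by
    have := S.even_mul_odd _ _ hw h₃
    exact S.odd_sub _ _ (S.odd_L _ _ this) this
  have h := (S.anticomm_list
    (l := [L (-1) t₁, t₁, L 1 t₁, Φ, t₂, L 1 (w * t₃) - w * t₃, Γ, t₃])
    (m := [v, L 1 v, u, w]) (by simp [S.odd_L, h₁, h₂, h₃, hΦ, hΓ, hD]) (by simp [S.even_L, *])).second_identity
  simp only [List.getD_cons_zero, List.getD_cons_succ] at h
  rw [S.L_mul, h]
  have hK : L 1 v * (t₁ * L 1 t₁) = L 1 (v * (L (-1) t₁ * t₁)) := by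
    simp [S.L_mul, S.L_L, S.L_zero]
  -- `Λ⁻¹A - ΛA` equals `Λ⁻¹(u t₁) - u t₁`, and `K` already contains both `Λ⁻¹t₁` and `t₁`.
  have hKA : v * (L (-1) t₁ * t₁) * (L (-1) A - L 1 A) = 0 := by
    have e : L (-1) A - L 1 A = L (-1) u * L (-1) t₁ - u * t₁ := by
      rw [← S.L_mul, ← eA, S.L_add, S.L_L, neg_add_cancel, S.L_zero]
      abel
    have h := S.anticomm_list (l := [L (-1) t₁, t₁]) (m := [L (-1) u, u])
      (by simp [S.odd_L, *]) (by simp [S.even_L, *])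
    have h' := h.square_identity
    simp only [List.getD_cons_zero, List.getD_cons_succ] at h'
    rw [e, mul_assoc, h', mul_zero]
  rw [hK, ← eC, eΦ]
  generalize v * (L (-1) t₁ * t₁) = K at hKA ⊢
  have hJ := congrArg J hKA
  rw [S.J_zero, mul_sub, S.J_sub] at hJ
  simp only [add_mul, mul_add, mul_sub, S.J_add, S.J_sub, S.J_neg, S.L_add, S.L_L,
    S.J_L_mul, Int.reduceAdd, Int.reduceNeg, S.L_zero, one_add_one_eq_two]
  rw [sub_eq_zero.1 hJ]
  abel

/-- The terms with `Φ`, `Γ` and `Λ(w t₃) - w t₃` are quadratic coefficients times shifts of `A`, `C`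
and `v t₂`. The remaining terms are brought to the same shape by the residual identity, after which
all coefficients cancel modulo shifts. -/
theorem mixed_bracket (S : ShiftCalculus L J O Z) (hu : Z u) (hv : Z v) (hw : Z w) (h₁ : O t₁)
    (h₂ : O t₂) (h₃ : O t₃) (hA : O A) (hC : O C) (eA : A + L 1 A = u * t₁)
    (eC : C + L 1 C = w * t₃) {Φ Γ : R} (eΦ : Φ = A - L 1 A + (L 2 C - L 1 C))
    (eΓ : Γ = A - L (-1) A + (v * t₂ - L (-1) (v * t₂)) + (L 2 C - L (-1) C)) :
    J ((L 1 t₁ - L (-1) t₁ + w * L (-1) t₂ - L 2 (w * t₂)) * (t₁ * Φ) +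
      (w * L (-2) t₁ - L 1 (w * t₁) + w * L (-1) (u * t₂) - u * L 1 (w * t₂) +
        (L 1 (w * t₃) - w * t₃)) * (L (-1) t₁ * t₁ + t₂ * (L 1 (w * t₃) - w * t₃)) +
      w * (t₂ - L (-1) t₂) * (t₃ * Γ) +
      -(t₂ * L 1 (w * t₂)) * (L 1 (v * t₁) - v * L (-1) t₁ + u * Φ) +
      (t₁ * L (-1) t₂ - L (-2) t₁ * t₂ + L (-1) u * (t₂ * L (-1) t₂) + (L (-1) t₂ - t₂) * t₃) *
        (w * Γ)) = 0 := by
  have hΦ : O Φ := by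
    rw [eΦ]
    exact S.odd_add _ _ (S.odd_sub _ _ hA (S.odd_L _ _ hA))
      (S.odd_sub _ _ (S.odd_L _ _ hC) (S.odd_L _ _ hC))
  have hb := S.even_mul_odd _ _ hv h₂
  have hΓ : O Γ := by
    rw [eΓ]
    exact S.odd_add _ _ (S.odd_add _ _ (S.odd_sub _ _ hA (S.odd_L _ _ hA))
      (S.odd_sub _ _ hb (S.odd_L _ _ hb))) (S.odd_sub _ _ (S.odd_L _ _ hC) (S.odd_L _ _ hC))
  have hD : O (L 1 (w * t₃) - w * t₃) := by
    have := S.even_mul_odd _ _ hw h₃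
    exact S.odd_sub _ _ (S.odd_L _ _ this) this
  have h := (S.anticomm_list
    (l := [L (-2) t₁, L (-1) t₁, t₁, L 1 t₁, L (-1) t₂, t₂, L 1 t₂, L 2 t₂, t₃, Φ, Γ,
      L 1 (w * t₃) - w * t₃])
    (m := [w, L 1 w, L 2 w, L (-1) u, u, v, L 1 v])
    (by simp [S.odd_L, h₁, h₂, h₃, hΦ, hΓ, hD]) (by simp [S.even_L, *]))
  have h1 := h.mixed_identity
  have h2 := h.residual_identity
  simp only [List.getD_cons_zero, List.getD_cons_succ] at h1 h2
  -- The residual identity under the integral: its right side telescopes away, so the group without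
  -- composite elements can be traded for the correction terms.
  have h3 : J (-(L (-1) t₁ * t₁ * (L (-1) u * L (-1) t₁ - u * t₁)) -
      (L 1 w * (L 1 t₁ * t₂) - w * (t₁ * L (-1) t₂)) * (u * t₁) +
      (L 2 w * (t₁ * L 2 t₂) - L 1 w * (L (-1) t₁ * L 1 t₂)) * (u * t₁) +
      (w * (t₁ * L (-1) t₂) - w * (L (-2) t₁ * t₂) - w * (L (-1) u * (L (-1) t₂ * t₂))) * (v * t₂) -
      (L 1 w * (L 1 t₁ * t₂) - L 1 w * (L (-1) t₁ * L 1 t₂) - L 1 w * (u * (t₂ * L 1 t₂))) *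
        (v * t₂) +
      ((w * L (-2) t₁ - L 1 w * L 1 t₁ + w * (L (-1) u * L (-1) t₂) - u * (L 1 w * L 1 t₂)) *
          (L (-1) t₁ * t₁) -
        L 1 w * (t₂ * (L 1 t₂ * (L 1 v * L 1 t₁ - v * L (-1) t₁))))) = 0 := by
    rw [h2, S.J_add, S.J_add, S.J_sub_L (k := 1), S.J_sub_L (k := 1), S.J_sub_L (k := 1),
      add_zero, add_zero]
    all_goals simp [S.L_mul, S.L_L, S.L_zero]
  -- Each quadratic coefficient is a shift of one of four base elements, named `p`, `q`, `r`, `K`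
  -- below.
  have eP : L 1 w * (L 1 t₁ * t₂) = L 1 (w * (t₁ * L (-1) t₂)) := by
    simp [S.L_mul, S.L_L, S.L_zero]
  have eQ1 : L 1 w * (L (-1) t₁ * L 1 t₂) = L 1 (w * (L (-2) t₁ * t₂)) := by
    simp [S.L_mul, S.L_L]
  have eQ2 : L 2 w * (t₁ * L 2 t₂) = L 2 (w * (L (-2) t₁ * t₂)) := by
    simp [S.L_mul, S.L_L, S.L_zero]
  have eR : L 1 w * (u * (t₂ * L 1 t₂)) = L 1 (w * (L (-1) u * (L (-1) t₂ * t₂))) := by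
    simp [S.L_mul, S.L_L, S.L_zero]
  have eK : t₁ * L 1 t₁ = L 1 (L (-1) t₁ * t₁) := by
    simp [S.L_mul, S.L_L, S.L_zero]
  have ea : L (-1) u * L (-1) t₁ = L (-1) (u * t₁) := (S.L_mul _ _ _).symm
  rw [eP, eQ1, eQ2, eR, ea, ← eA, S.J_add] at h3
  rw [S.L_mul 2 w t₂, S.L_mul 1 w t₁, S.L_mul (-1) u t₂, S.L_mul 1 w t₂, S.L_mul 1 v t₁, h1, S.J_add,
    eq_neg_of_add_eq_zero_right h3, eP, eQ2, eR, eK, ← eC, eΦ, eΓ]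
  clear h1 h2 h3 h
  -- From here only additivity and invariance are used: all shifts move to the second factor and the
  -- pairings of `p`, `q`, `r`, `K` with `A`, `b`, `C` cancel.
  generalize w * (t₁ * L (-1) t₂) = p
  generalize w * (L (-2) t₁ * t₂) = q
  generalize w * (L (-1) u * (L (-1) t₂ * t₂)) = r
  generalize L (-1) t₁ * t₁ = K
  generalize v * t₂ = b
  simp only [add_mul, mul_add, mul_sub, sub_mul, neg_mul, S.J_add, S.J_sub, S.J_neg, S.L_add,
    S.L_L, S.J_L_mul, Int.reduceAdd, Int.reduceNeg, S.L_zero, one_add_one_eq_two]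
  abel

end ShiftCalculus
end SuperJet

namespace SuperJet

variable {n : ℕ} {U : Opens (Fin n → ℝ)}

/-! ### The super jet space as a shift calculus -/

theorem shiftCalculus (U : Opens (Fin n → ℝ)) : ShiftCalculus (fun k f => Λ U k f)
    (fun f : SuperE U => integral f) (fun f => f ∈ oddE U) (fun f => f ∈ Set.range ofFun) where
  L_add k f g := map_add _ f g
  L_mul := Λ_mul
  L_zero f := by rw [Λ_zero]; rfl
  L_L := Λ_Λ
  J_add f g := map_add _ f g
  J_L := integral_Λ
  odd_add f g := add_mem
  odd_L k f := symbolOp_mem_oddE _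
  even_L k f := by
    rintro ⟨c, rfl⟩
    exact ⟨_, ofFun_symbolFun _ c⟩
  anticomm f g := oddE_anticomm
  sq f := oddE_sq
  central f g := by
    rintro ⟨c, rfl⟩
    exact ofFun_mul_comm c g
  even_mul_odd f g := by
    rintro ⟨c, rfl⟩
    exact ofFun_mul_mem_oddE c
  odd_zero := zero_mem _
  even_zero := ⟨0, map_zero _⟩
  odd_neg f := neg_mem

theorem uVar_mem (α : Fin n) : uVar U α ∈ Set.range (ofFun (U := U)) := ⟨_, rfl⟩

/-! ### Symbols with denominators -/

theorem constantCoeff_shift (k : ℤ) : PowerSeries.constantCoeff (shift k) = 1 := by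
  rw [← PowerSeries.coeff_zero_eq_constantCoeff_apply, coeff_shift]
  simp

theorem one_add_shift_mul_inv (k : ℤ) : (1 + shift k) * (1 + shift k)⁻¹ = 1 := by
  refine PowerSeries.mul_inv_cancel _ ?_
  rw [map_add, constantCoeff_shift, map_one]
  norm_num

theorem shift_mul_shift_neg (k : ℤ) : shift k * shift (-k) = 1 := by
  rw [← shift_add, add_neg_cancel, shift_zero]

/-- Reduces the denominator `1 + Λ⁻¹` to `1 + Λ`, so that the single operator `invOp` serves all
entries of `P₂`. -/
theorem inv_one_add_shift_neg (k : ℤ) : (1 + shift (-k))⁻¹ = shift k * (1 + shift k)⁻¹ := by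
  have h1 := one_add_shift_mul_inv k
  have h2 := one_add_shift_mul_inv (-k)
  have h3 := shift_mul_shift_neg k
  linear_combination -(1 + shift (-k))⁻¹ * h1 + shift k * (1 + shift k)⁻¹ * h2 -
    (1 + shift k)⁻¹ * (1 + shift (-k))⁻¹ * h3

theorem adjSym_inv_one_add_shift (k : ℤ) :
    adjSym (1 + shift k)⁻¹ = (1 + shift (-k))⁻¹ := by
  have h1 := congrArg adjSym (one_add_shift_mul_inv k)
  rw [map_mul, map_add, map_one, adjSym_shift] at h1
  have h2 := one_add_shift_mul_inv (-k)
  linear_combination (1 + shift (-k))⁻¹ * h1 - adjSym (1 + shift k)⁻¹ * h2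

variable (U) in
/-- The operator `(1 + Λ)⁻¹`. -/
noncomputable def invOp : Op U := symbolOp U (1 + shift 1)⁻¹

/-- The implicit equation for `(1+Λ)⁻¹` that the bracket computations take as `eA` and `eC`. -/
theorem invOp_add (f : SuperE U) : invOp U f + Λ U 1 (invOp U f) = f := by
  have h := congrArg (fun φ => symbolOp U φ f) (one_add_shift_mul_inv 1)
  rw [mul_comm, symbolOp_mul_apply, symbolOp_add, symbolOp_one, LinearMap.add_apply, map_add] at h
  refine Eq.trans ?_ h
  rw [Λ, invOp, ← symbolOp_mul_apply, ← symbolOp_mul_apply, mul_comm]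
  rfl

theorem AdjPair.congr {P P' Q Q' : Op U} (h : AdjPair P P') (e : P = Q) (e' : P' = Q') :
    AdjPair Q Q' := e ▸ e' ▸ h

theorem op_neg_sub (P Q : Op U) : Q - P = -(P - Q) :=
  LinearMap.ext fun f => (neg_sub (P f) (Q f)).symm

theorem AdjPair.zero : AdjPair (0 : Op U) (-0) := by
  have := (adjPair_symbolOp (U := U) 0).smul 0
  rw [zero_smul, zero_smul] at this
  exact this.congr rfl (LinearMap.ext fun f => neg_zero.symm)

theorem adjPair_Λ (k : ℤ) : AdjPair (Λ U k) (Λ U (-k)) := by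
  have := adjPair_symbolOp (U := U) (shift k)
  rwa [adjSym_shift] at this

theorem adjPair_uVar (α : Fin n) : AdjPair (mulOp (uVar U α)) (mulOp (uVar U α)) :=
  adjPair_ofFun _

theorem adjPair_one : AdjPair (1 : Op U) 1 := by
  have := adjPair_Λ (U := U) 0
  rwa [neg_zero, Λ_zero] at this

/-! ### Skew-symmetry -/

set_option linter.unusedSimpArgs false in
theorem adjPair_P₁ (U : Opens (Fin 3 → ℝ)) (α β : Fin 3) : AdjPair (P₁ U α β) (-P₁ U β α) := by
  have hu := adjPair_uVar (U := U) 0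
  have hw := adjPair_uVar (U := U) 2
  have hL := fun k => adjPair_Λ (U := U) k
  fin_cases α <;> fin_cases β
  · exact ((hL 1).sub (hL (-1))).congr rfl (op_neg_sub _ _)
  · exact ((hw.mul (hL (-1))).sub ((hL 2).mul hw)).congr rfl (op_neg_sub _ _)
  · exact AdjPair.zero
  · exact ((hw.mul (hL (-2))).sub ((hL 1).mul hw)).congr rfl (op_neg_sub _ _)
  · exact (((hw.mul (hL (-1))).mul hu).sub ((hu.mul (hL 1)).mul hw)).congr rfl
      (by
        rw [← mul_assoc, ← mul_assoc]
        exact op_neg_sub _ _)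
  · exact (((hL 1).sub adjPair_one).mul hw).congr rfl (by
      change mulOp (uVar U 2) * (Λ U (-1) - 1) = -(mulOp (uVar U 2) * (1 - Λ U (-1)))
      refine LinearMap.ext fun f => ?_
      simp only [LinearMap.sub_apply, LinearMap.neg_apply, LinearMap.add_apply,
        Module.End.mul_apply, Module.End.one_apply, map_sub, map_neg, map_add]
      abel)
  · exact AdjPair.zero
  · exact (hw.mul (adjPair_one.sub (hL (-1)))).congr rfl (by
      change (1 - Λ U (- -1)) * mulOp (uVar U 2) = -((Λ U 1 - 1) * mulOp (uVar U 2))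
      rw [neg_neg]
      refine LinearMap.ext fun f => ?_
      simp only [LinearMap.sub_apply, LinearMap.neg_apply, LinearMap.add_apply,
        Module.End.mul_apply, Module.End.one_apply, map_sub, map_neg, map_add]
      abel)
  · exact AdjPair.zero

set_option linter.unusedSimpArgs false in
-- For the rational entries skewness is a parity statement on symbols: `(1-Λ)/(1+Λ)` and
-- `(Λ²-Λ⁻¹)/(Λ+1)` are odd in `ε∂ₓ`, while the two off-diagonal symbols are exchanged up to sign.
theorem adjPair_P₂ (U : Opens (Fin 3 → ℝ)) (α β : Fin 3) : AdjPair (P₂ U α β) (-P₂ U β α) := by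
  have hu := adjPair_uVar (U := U) 0
  have hv := adjPair_uVar (U := U) 1
  have hw := adjPair_uVar (U := U) 2
  have hL := fun k => adjPair_Λ (U := U) k
  have hS : ∀ {φ ψ : ℝ⟦X⟧}, adjSym φ = -ψ → AdjPair (symbolOp U φ) (-symbolOp U ψ) := by
    intro φ ψ h
    have := adjPair_symbolOp (U := U) φ
    rw [h] at this
    exact this.congr rfl (map_neg (symbolHom U) ψ)
  have hφ := hS (φ := (1 - shift 1) * (1 + shift 1)⁻¹) (ψ := (1 - shift 1) * (1 + shift 1)⁻¹) (by
    rw [map_mul, map_sub, map_one, adjSym_shift, adjSym_inv_one_add_shift, inv_one_add_shift_neg]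
    linear_combination (-(1 + shift 1)⁻¹) * shift_mul_shift_neg 1)
  have hψ := hS (φ := (shift 1 - 1) * (1 + shift (-1))⁻¹)
    (ψ := (1 - shift (-1)) * (shift 1 + 1)⁻¹) (by
    rw [map_mul, map_sub, map_one, adjSym_shift, adjSym_inv_one_add_shift, neg_neg,
      add_comm (shift 1)]
    ring)
  have hκ := hS (φ := (1 - shift (-1)) * (shift 1 + 1)⁻¹)
    (ψ := (shift 1 - 1) * (1 + shift (-1))⁻¹) (by
    rw [map_mul, map_sub, map_one, add_comm (shift 1), adjSym_shift, adjSym_inv_one_add_shift,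
      neg_neg]
    ring)
  have hχ := hS (φ := (shift 2 - shift (-1)) * (shift 1 + 1)⁻¹)
    (ψ := (shift 2 - shift (-1)) * (shift 1 + 1)⁻¹) (by
    rw [map_mul, map_sub, add_comm (shift 1), adjSym_shift, adjSym_shift, adjSym_inv_one_add_shift,
      neg_neg, inv_one_add_shift_neg, mul_comm (shift 1), mul_comm (_ - _), mul_comm (_ - _),
      mul_assoc, mul_sub, ← shift_add, ← shift_add]
    norm_num
    ring)
  fin_cases α <;> fin_cases β
  · refine ((((hL 1).mul hv).sub (hv.mul (hL (-1)))).add ((hu.mul hφ).mul hu)).congr rfl ?_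
    change mulOp (uVar U 1) * Λ U (-1) - Λ U (- -1) * mulOp (uVar U 1) + mulOp (uVar U 0) *
      (-symbolOp U ((1 - shift 1) * (1 + shift 1)⁻¹) * mulOp (uVar U 0)) =
      -(Λ U 1 * mulOp (uVar U 1) - mulOp (uVar U 1) * Λ U (-1) +
      mulOp (uVar U 0) * symbolOp U ((1 - shift 1) * (1 + shift 1)⁻¹) * mulOp (uVar U 0))
    rw [neg_neg]
    refine LinearMap.ext fun f => ?_
    simp only [LinearMap.sub_apply, LinearMap.neg_apply, LinearMap.add_apply,
      Module.End.mul_apply, Module.End.one_apply, map_sub, map_neg, map_add]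
    abel
  · exact AdjPair.zero
  · refine ((hu.mul hψ).mul hw).congr rfl ?_
    change mulOp (uVar U 2) * (-symbolOp U ((1 - shift (-1)) * (shift 1 + 1)⁻¹) *
      mulOp (uVar U 0)) = -(mulOp (uVar U 2) *
      symbolOp U ((1 - shift (-1)) * (shift 1 + 1)⁻¹) * mulOp (uVar U 0))
    refine LinearMap.ext fun f => ?_
    simp only [LinearMap.sub_apply, LinearMap.neg_apply, LinearMap.add_apply,
      Module.End.mul_apply, Module.End.one_apply, map_sub, map_neg, map_add]
  · exact AdjPair.zero
  · exact AdjPair.zero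
  · refine ((hv.mul ((hL 1).sub adjPair_one)).mul hw).congr rfl ?_
    change mulOp (uVar U 2) * ((Λ U (-1) - 1) * mulOp (uVar U 1)) =
      -(mulOp (uVar U 2) * (1 - Λ U (-1)) * mulOp (uVar U 1))
    refine LinearMap.ext fun f => ?_
    simp only [LinearMap.sub_apply, LinearMap.neg_apply, LinearMap.add_apply,
      Module.End.mul_apply, Module.End.one_apply, map_sub, map_neg, map_add]
    abel
  · refine ((hw.mul hκ).mul hu).congr rfl ?_
    change mulOp (uVar U 0) * (-symbolOp U ((shift 1 - 1) * (1 + shift (-1))⁻¹) *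
      mulOp (uVar U 2)) = -(mulOp (uVar U 0) *
      symbolOp U ((shift 1 - 1) * (1 + shift (-1))⁻¹) * mulOp (uVar U 2))
    refine LinearMap.ext fun f => ?_
    simp only [LinearMap.sub_apply, LinearMap.neg_apply, LinearMap.add_apply,
      Module.End.mul_apply, Module.End.one_apply, map_sub, map_neg, map_add]
  · refine ((hw.mul (adjPair_one.sub (hL (-1)))).mul hv).congr rfl ?_
    change mulOp (uVar U 1) * ((1 - Λ U (- -1)) * mulOp (uVar U 2)) =
      -(mulOp (uVar U 1) * (Λ U 1 - 1) * mulOp (uVar U 2))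
    rw [neg_neg]
    refine LinearMap.ext fun f => ?_
    simp only [LinearMap.sub_apply, LinearMap.neg_apply, LinearMap.add_apply,
      Module.End.mul_apply, Module.End.one_apply, map_sub, map_neg, map_add]
    abel
  · refine ((hw.mul hχ).mul hw).congr rfl ?_
    change mulOp (uVar U 2) * (-symbolOp U ((shift 2 - shift (-1)) * (shift 1 + 1)⁻¹) *
      mulOp (uVar U 2)) = -(mulOp (uVar U 2) *
      symbolOp U ((shift 2 - shift (-1)) * (shift 1 + 1)⁻¹) * mulOp (uVar U 2))
    refine LinearMap.ext fun f => ?_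
    simp only [LinearMap.sub_apply, LinearMap.neg_apply, LinearMap.add_apply,
      Module.End.mul_apply, Module.End.one_apply, map_sub, map_neg, map_add]

end SuperJet

namespace SuperJet

/-! ### Variational derivatives of the two bivectors -/

theorem symbolOp_φ {n : ℕ} {U : Opens (Fin n → ℝ)} (f : SuperE U) : symbolOp U ((1 - shift 1) * (1 + shift 1)⁻¹) f =
    invOp U f - Λ U 1 (invOp U f) := by
  rw [symbolOp_mul_apply, symbolOp_sub, symbolOp_one]
  rfl

theorem symbolOp_ψ {n : ℕ} {U : Opens (Fin n → ℝ)} (f : SuperE U) :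
    symbolOp U ((shift 1 - 1) * (1 + shift (-1))⁻¹) f =
    Λ U 2 (invOp U f) - Λ U 1 (invOp U f) := by
  rw [inv_one_add_shift_neg, ← mul_assoc, sub_mul, one_mul, ← shift_add, symbolOp_mul_apply,
    symbolOp_sub]
  rfl

theorem symbolOp_κ {n : ℕ} {U : Opens (Fin n → ℝ)} (f : SuperE U) :
    symbolOp U ((1 - shift (-1)) * (shift 1 + 1)⁻¹) f =
    invOp U f - Λ U (-1) (invOp U f) := by
  rw [add_comm, symbolOp_mul_apply, symbolOp_sub, symbolOp_one]
  rfl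

theorem symbolOp_χ {n : ℕ} {U : Opens (Fin n → ℝ)} (f : SuperE U) :
    symbolOp U ((shift 2 - shift (-1)) * (shift 1 + 1)⁻¹) f =
    Λ U 2 (invOp U f) - Λ U (-1) (invOp U f) := by
  rw [add_comm (shift 1), symbolOp_mul_apply, symbolOp_sub]
  rfl

variable (U : Opens (Fin 3 → ℝ))

theorem P₁_apply (α : Fin 3) (f : Fin 3 → SuperE U) : ∑ β, P₁ U α β (f β) =
    ![Λ U 1 (f 0) - Λ U (-1) (f 0) + uVar U 2 * Λ U (-1) (f 1) - Λ U 2 (uVar U 2 * f 1),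
      uVar U 2 * Λ U (-2) (f 0) - Λ U 1 (uVar U 2 * f 0) +
        uVar U 2 * Λ U (-1) (uVar U 0 * f 1) - uVar U 0 * Λ U 1 (uVar U 2 * f 1) +
        (Λ U 1 (uVar U 2 * f 2) - uVar U 2 * f 2),
      uVar U 2 * (f 1 - Λ U (-1) (f 1))] α := by
  rw [Fin.sum_univ_three]
  fin_cases α <;> simp [P₁, mulOp_apply]
  · abel
  · abel

theorem P₂_apply (α : Fin 3) (f : Fin 3 → SuperE U) : ∑ β, P₂ U α β (f β) =
    ![Λ U 1 (uVar U 1 * f 0) - uVar U 1 * Λ U (-1) (f 0) + uVar U 0 *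
        (invOp U (uVar U 0 * f 0) - Λ U 1 (invOp U (uVar U 0 * f 0)) +
          (Λ U 2 (invOp U (uVar U 2 * f 2)) - Λ U 1 (invOp U (uVar U 2 * f 2)))),
      uVar U 1 * (Λ U 1 (uVar U 2 * f 2) - uVar U 2 * f 2),
      uVar U 2 * (invOp U (uVar U 0 * f 0) - Λ U (-1) (invOp U (uVar U 0 * f 0)) +
        (uVar U 1 * f 1 - Λ U (-1) (uVar U 1 * f 1)) +
        (Λ U 2 (invOp U (uVar U 2 * f 2)) - Λ U (-1) (invOp U (uVar U 2 * f 2))))] α := by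
  rw [Fin.sum_univ_three]
  fin_cases α <;> simp [P₂, mulOp_apply, symbolOp_φ, symbolOp_ψ, symbolOp_κ, symbolOp_χ, mul_add]
  · abel

theorem eulerU_Λ (γ : Fin 3) (k : ℤ) (f h : SuperE U) :
    eulerU γ (Λ U k f) h = eulerU γ f (Λ U (-k) h) := by
  rw [Λ, eulerU_symbolOp, adjSym_shift]
  rfl

/-- The adjoint of `(1+Λ)⁻¹` is `(1+Λ⁻¹)⁻¹ = Λ(1+Λ)⁻¹`. -/
theorem eulerU_invOp (γ : Fin 3) (f h : SuperE U) :
    eulerU γ (invOp U f) h = eulerU γ f (Λ U 1 (invOp U h)) := by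
  rw [invOp, eulerU_symbolOp, adjSym_inv_one_add_shift, inv_one_add_shift_neg, symbolOp_mul_apply]
  rfl

theorem eulerU_uVar_mul (γ α : Fin 3) (f h : SuperE U) : eulerU γ (uVar U α * f) h =
    (if α = γ then h * f else 0) + eulerU γ f (h * uVar U α) := by
  rw [← eulerU_uVar]
  exact eulerU_ofFun_mul _ _ _ _

/-- By skew-symmetry every contribution to `δI/δu` occurs twice, once from each of two transposed
positions or adjoint terms; this removes the doubling. -/
theorem half_smul_eq {x y : SuperE U} (h : x = y + y) : (1 / 2 : ℝ) • x = y := by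
  rw [h, ← two_smul ℝ, smul_smul]
  norm_num

theorem SuperE.mul_sub (f g h : SuperE U) : f * (g - h) = f * g - f * h := _root_.mul_sub f g h

theorem SuperE.sub_mul (f g h : SuperE U) : (f - g) * h = f * h - g * h := _root_.sub_mul f g h

theorem θVar_mul_uVar (α β : Fin 3) : θVar U α * uVar U β = uVar U β * θVar U α :=
  (ofFun_mul_comm _ _).symm

theorem invOp_Λ (k : ℤ) (f : SuperE U) : invOp U (Λ U k f) = Λ U k (invOp U f) := by
  rw [invOp, Λ, ← symbolOp_mul_apply, mul_comm, symbolOp_mul_apply]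

theorem Λ_zero_apply (f : SuperE U) : Λ U 0 f = f := by rw [Λ_zero]; rfl

theorem uVar_mul_mem_oddE (α : Fin 3) {f : SuperE U} (hf : f ∈ oddE U) :
    uVar U α * f ∈ oddE U := ofFun_mul_mem_oddE _ hf

theorem invOp_mem_oddE {f : SuperE U} (hf : f ∈ oddE U) : invOp U f ∈ oddE U :=
  symbolOp_mem_oddE _ hf

theorem Λ_mul_θVar (k : ℤ) (α : Fin 3) {f : SuperE U} (hf : f ∈ oddE U) :
    Λ U k f * θVar U α = -(θVar U α * Λ U k f) :=
  oddE_anticomm (symbolOp_mem_oddE _ hf) (θVar_mem_oddE α)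

theorem invOp_mul_θVar (α : Fin 3) {f : SuperE U} (hf : f ∈ oddE U) :
    invOp U f * θVar U α = -(θVar U α * invOp U f) :=
  oddE_anticomm (symbolOp_mem_oddE _ hf) (θVar_mem_oddE α)

theorem uVar_mul_θVar_mul (α β γ : Fin 3) :
    uVar U γ * θVar U β * θVar U α = -(θVar U α * (uVar U γ * θVar U β)) :=
  oddE_anticomm (uVar_mul_mem_oddE U _ (θVar_mem_oddE β)) (θVar_mem_oddE α)

theorem sum_eulerU (γ : Fin 3) (P : Matrix (Fin 3) (Fin 3) (Op U)) : δu γ (bivector P) =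
    (1 / 2 : ℝ) • ∑ α, eulerU γ (∑ β, P α β (θVar U β)) (θVar U α) := by
  rw [δu_bivector]
  simp only [map_sum, LinearMap.sum_apply]

/-- The middle entry is zero because `P₁` does not involve `v`. -/
theorem δu_P₁ (γ : Fin 3) : δu γ (bivector (P₁ U)) =
    ![-(θVar U 1 * Λ U 1 (uVar U 2 * θVar U 1)), 0,
      θVar U 0 * Λ U (-1) (θVar U 1) - Λ U (-2) (θVar U 0) * θVar U 1 +
        Λ U (-1) (uVar U 0) * (θVar U 1 * Λ U (-1) (θVar U 1)) +
        (Λ U (-1) (θVar U 1) - θVar U 1) * θVar U 2] γ := by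
  rw [sum_eulerU]
  refine half_smul_eq U ?_
  simp only [P₁_apply]
  rw [Fin.sum_univ_three]
  have h : θVar U 1 * Λ U (-1) (uVar U 0 * θVar U 1) =
      Λ U (-1) (uVar U 0) * (θVar U 1 * Λ U (-1) (θVar U 1)) := by
    rw [Λ_mul, ← mul_assoc, ← mul_assoc]
    congr 1
    exact ((shiftCalculus U).central _ _ ((shiftCalculus U).even_L _ _ (uVar_mem 0))).symm
  have h' : θVar U 2 * θVar U 1 = -(θVar U 1 * θVar U 2) :=
    oddE_anticomm (θVar_mem_oddE _) (θVar_mem_oddE _)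
  fin_cases γ <;> simp [map_sub, map_add, eulerU_Λ, eulerU_uVar_mul, eulerU_θVar, SuperE.mul_sub,
    SuperE.sub_mul, θVar_mul_uVar, Λ_mul_θVar, θVar_mem_oddE, uVar_mul_mem_oddE, h, h']
  all_goals abel

set_option linter.unusedSimpArgs false in
theorem δu_zero_P₂ : δu 0 (bivector (P₂ U)) =
    θVar U 0 * (invOp U (uVar U 0 * θVar U 0) - Λ U 1 (invOp U (uVar U 0 * θVar U 0)) +
          (Λ U 2 (invOp U (uVar U 2 * θVar U 2)) - Λ U 1 (invOp U (uVar U 2 * θVar U 2)))) := by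
  rw [sum_eulerU]
  refine half_smul_eq U ?_
  simp only [P₂_apply]
  rw [Fin.sum_univ_three]
  simp only [Matrix.cons_val, map_sub, map_add, eulerU_Λ, eulerU_uVar_mul, eulerU_θVar,
    eulerU_invOp, LinearMap.add_apply, LinearMap.sub_apply, Fin.reduceEq, if_true, if_false,
    SuperE.mul_sub, θVar_mul_uVar, mul_add, zero_add, add_zero]
  have hu := fun α β => uVar_mul_mem_oddE U α (θVar_mem_oddE (U := U) β)
  simp only [invOp_Λ, Λ_Λ, Int.reduceNeg, Int.reduceAdd, neg_neg, Λ_zero_apply, sub_zero, zero_add,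
    add_zero, uVar_mul_θVar_mul, fun k α β γ => Λ_mul_θVar U k γ (hu α β),
    fun k α β => Λ_mul_θVar U k β (θVar_mem_oddE (U := U) α),
    fun α β γ => invOp_mul_θVar U γ (hu α β),
    fun k α β γ => Λ_mul_θVar U k γ (invOp_mem_oddE U (hu α β))]
  abel

set_option linter.unusedSimpArgs false in
theorem δu_one_P₂ : δu 1 (bivector (P₂ U)) =
    Λ U (-1) (θVar U 0) * θVar U 0 + θVar U 1 * (Λ U 1 (uVar U 2 * θVar U 2) - uVar U 2 * θVar U 2) := by
  rw [sum_eulerU]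
  refine half_smul_eq U ?_
  simp only [P₂_apply]
  rw [Fin.sum_univ_three]
  simp only [Matrix.cons_val, map_sub, map_add, eulerU_Λ, eulerU_uVar_mul, eulerU_θVar,
    eulerU_invOp, LinearMap.add_apply, LinearMap.sub_apply, Fin.reduceEq, if_true, if_false,
    SuperE.mul_sub, θVar_mul_uVar, mul_add, zero_add, add_zero]
  have hu := fun α β => uVar_mul_mem_oddE U α (θVar_mem_oddE (U := U) β)
  simp only [invOp_Λ, Λ_Λ, Int.reduceNeg, Int.reduceAdd, neg_neg, Λ_zero_apply, sub_zero, zero_add,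
    add_zero, uVar_mul_θVar_mul, fun k α β γ => Λ_mul_θVar U k γ (hu α β),
    fun k α β => Λ_mul_θVar U k β (θVar_mem_oddE (U := U) α),
    fun α β γ => invOp_mul_θVar U γ (hu α β),
    fun k α β γ => Λ_mul_θVar U k γ (invOp_mem_oddE U (hu α β))]
  abel

set_option linter.unusedSimpArgs false in
theorem δu_two_P₂ : δu 2 (bivector (P₂ U)) =
    θVar U 2 * (invOp U (uVar U 0 * θVar U 0) - Λ U (-1) (invOp U (uVar U 0 * θVar U 0)) +
        (uVar U 1 * θVar U 1 - Λ U (-1) (uVar U 1 * θVar U 1)) +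
        (Λ U 2 (invOp U (uVar U 2 * θVar U 2)) - Λ U (-1) (invOp U (uVar U 2 * θVar U 2)))) := by
  rw [sum_eulerU]
  refine half_smul_eq U ?_
  simp only [P₂_apply]
  rw [Fin.sum_univ_three]
  simp only [Matrix.cons_val, map_sub, map_add, eulerU_Λ, eulerU_uVar_mul, eulerU_θVar,
    eulerU_invOp, LinearMap.add_apply, LinearMap.sub_apply, Fin.reduceEq, if_true, if_false,
    SuperE.mul_sub, θVar_mul_uVar, mul_add, zero_add, add_zero]
  have hu := fun α β => uVar_mul_mem_oddE U α (θVar_mem_oddE (U := U) β)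
  simp only [invOp_Λ, Λ_Λ, Int.reduceNeg, Int.reduceAdd, neg_neg, Λ_zero_apply, sub_zero, zero_add,
    add_zero, uVar_mul_θVar_mul, fun k α β γ => Λ_mul_θVar U k γ (hu α β),
    fun k α β => Λ_mul_θVar U k β (θVar_mem_oddE (U := U) α),
    fun α β γ => invOp_mul_θVar U γ (hu α β),
    fun k α β γ => Λ_mul_θVar U k γ (invOp_mem_oddE U (hu α β))]
  abel

theorem δu_P₂ (γ : Fin 3) : δu γ (bivector (P₂ U)) =
    ![θVar U 0 * (invOp U (uVar U 0 * θVar U 0) - Λ U 1 (invOp U (uVar U 0 * θVar U 0)) +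
        (Λ U 2 (invOp U (uVar U 2 * θVar U 2)) - Λ U 1 (invOp U (uVar U 2 * θVar U 2)))),
      Λ U (-1) (θVar U 0) * θVar U 0 +
        θVar U 1 * (Λ U 1 (uVar U 2 * θVar U 2) - uVar U 2 * θVar U 2),
      θVar U 2 * (invOp U (uVar U 0 * θVar U 0) - Λ U (-1) (invOp U (uVar U 0 * θVar U 0)) +
        (uVar U 1 * θVar U 1 - Λ U (-1) (uVar U 1 * θVar U 1)) +
        (Λ U 2 (invOp U (uVar U 2 * θVar U 2)) - Λ U (-1) (invOp U (uVar U 2 * θVar U 2))))] γ := by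
  fin_cases γ
  · exact δu_zero_P₂ U
  · exact δu_one_P₂ U
  · exact δu_two_P₂ U

theorem δθ_P₁ (γ : Fin 3) : δθ γ (bivector (P₁ U)) =
    ![Λ U 1 (θVar U 0) - Λ U (-1) (θVar U 0) + uVar U 2 * Λ U (-1) (θVar U 1) -
        Λ U 2 (uVar U 2 * θVar U 1),
      uVar U 2 * Λ U (-2) (θVar U 0) - Λ U 1 (uVar U 2 * θVar U 0) +
        uVar U 2 * Λ U (-1) (uVar U 0 * θVar U 1) - uVar U 0 * Λ U 1 (uVar U 2 * θVar U 1) +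
        (Λ U 1 (uVar U 2 * θVar U 2) - uVar U 2 * θVar U 2),
      uVar U 2 * (θVar U 1 - Λ U (-1) (θVar U 1))] γ :=
  (δθ_bivector (adjPair_P₁ U) γ).trans (P₁_apply U γ _)

theorem δθ_P₂ (γ : Fin 3) : δθ γ (bivector (P₂ U)) =
    ![Λ U 1 (uVar U 1 * θVar U 0) - uVar U 1 * Λ U (-1) (θVar U 0) + uVar U 0 *
        (invOp U (uVar U 0 * θVar U 0) - Λ U 1 (invOp U (uVar U 0 * θVar U 0)) +
          (Λ U 2 (invOp U (uVar U 2 * θVar U 2)) - Λ U 1 (invOp U (uVar U 2 * θVar U 2)))),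
      uVar U 1 * (Λ U 1 (uVar U 2 * θVar U 2) - uVar U 2 * θVar U 2),
      uVar U 2 * (invOp U (uVar U 0 * θVar U 0) - Λ U (-1) (invOp U (uVar U 0 * θVar U 0)) +
        (uVar U 1 * θVar U 1 - Λ U (-1) (uVar U 1 * θVar U 1)) +
        (Λ U 2 (invOp U (uVar U 2 * θVar U 2)) - Λ U (-1) (invOp U (uVar U 2 * θVar U 2))))] γ :=
  (δθ_bivector (adjPair_P₂ U) γ).trans (P₂_apply U γ _)

end SuperJet

namespace SuperJet
variable (U : Opens (Fin 3 → ℝ))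

/-! ### Parity of the variational derivatives -/

theorem commute_mul_odd {x y z : SuperE U} (hx : x ∈ oddE U) (hy : y ∈ oddE U) (hz : z ∈ oddE U) :
    Commute (x * y) z := by
  have h1 : x * -(z * y) = -(x * (z * y)) :=
    map_neg (AddMonoidHom.mulLeft x) (z * y)
  have h2 : -(x * z) * y = -(x * z * y) :=
    map_neg (AddMonoidHom.mulRight y) (x * z)
  rw [Commute, SemiconjBy, mul_assoc, oddE_anticomm hy hz, h1, ← mul_assoc z, oddE_anticomm hz hx,
    h2, mul_assoc]

theorem commute_δu_P₁ (γ : Fin 3) {z : SuperE U} (hz : z ∈ oddE U) :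
    Commute (δu γ (bivector (P₁ U))) z := by
  rw [δu_P₁]
  have hθ := fun α => θVar_mem_oddE (U := U) α
  have hΛ : ∀ k α, Λ U k (θVar U α) ∈ oddE U := fun k α => symbolOp_mem_oddE _ (hθ α)
  fin_cases γ
  · exact (commute_mul_odd U (hθ _) (symbolOp_mem_oddE _ (uVar_mul_mem_oddE U _ (hθ _))) hz).neg_left
  · exact Commute.zero_left z
  · refine Commute.add_left (Commute.add_left (Commute.sub_left ?_ ?_) (Commute.mul_left ?_ ?_)) ?_
    · exact commute_mul_odd U (hθ _) (hΛ _ _) hz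
    · exact commute_mul_odd U (hΛ _ _) (hθ _) hz
    · exact (shiftCalculus U).central _ _ ((shiftCalculus U).even_L _ _ (uVar_mem 0))
    · exact commute_mul_odd U (hθ _) (hΛ _ _) hz
    · exact commute_mul_odd U (sub_mem (hΛ _ _) (hθ _)) (hθ _) hz

theorem commute_δu_P₂ (γ : Fin 3) {z : SuperE U} (hz : z ∈ oddE U) :
    Commute (δu γ (bivector (P₂ U))) z := by
  rw [δu_P₂]
  have hθ := fun α => θVar_mem_oddE (U := U) α
  have hu := fun α β => uVar_mul_mem_oddE U α (hθ β)
  have hi := fun α β => invOp_mem_oddE U (hu α β)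
  have hΛ : ∀ k {f : SuperE U}, f ∈ oddE U → Λ U k f ∈ oddE U := fun k f => symbolOp_mem_oddE _
  fin_cases γ
  · exact commute_mul_odd U (hθ _) (add_mem (sub_mem (hi _ _) (hΛ _ (hi _ _)))
      (sub_mem (hΛ _ (hi _ _)) (hΛ _ (hi _ _)))) hz
  · exact (commute_mul_odd U (hΛ _ (hθ _)) (hθ _) hz).add_left
      (commute_mul_odd U (hθ _) (sub_mem (hΛ _ (hu _ _)) (hu _ _)) hz)
  · exact commute_mul_odd U (hθ _) (add_mem (add_mem (sub_mem (hi _ _) (hΛ _ (hi _ _)))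
      (sub_mem (hu _ _) (hΛ _ (hu _ _)))) (sub_mem (hΛ _ (hi _ _)) (hΛ _ (hi _ _)))) hz

theorem δθ_P₁_mem (γ : Fin 3) : δθ γ (bivector (P₁ U)) ∈ oddE U := by
  rw [δθ_P₁]
  have hθ := fun α => θVar_mem_oddE (U := U) α
  have hu : ∀ α {f : SuperE U}, f ∈ oddE U → uVar U α * f ∈ oddE U := uVar_mul_mem_oddE U
  have hΛ : ∀ k {f : SuperE U}, f ∈ oddE U → Λ U k f ∈ oddE U := fun k f => symbolOp_mem_oddE _
  fin_cases γ
  · exact sub_mem (add_mem (sub_mem (hΛ _ (hθ _)) (hΛ _ (hθ _))) (hu _ (hΛ _ (hθ _))))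
      (hΛ _ (hu _ (hθ _)))
  · exact add_mem (sub_mem (add_mem (sub_mem (hu _ (hΛ _ (hθ _))) (hΛ _ (hu _ (hθ _))))
      (hu _ (hΛ _ (hu _ (hθ _))))) (hu _ (hΛ _ (hu _ (hθ _)))))
      (sub_mem (hΛ _ (hu _ (hθ _))) (hu _ (hθ _)))
  · exact hu _ (sub_mem (hθ _) (hΛ _ (hθ _)))

theorem δθ_P₂_mem (γ : Fin 3) : δθ γ (bivector (P₂ U)) ∈ oddE U := by
  rw [δθ_P₂]
  have hθ := fun α => θVar_mem_oddE (U := U) α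
  have hu : ∀ α {f : SuperE U}, f ∈ oddE U → uVar U α * f ∈ oddE U := uVar_mul_mem_oddE U
  have hi := fun α β => invOp_mem_oddE U (hu α (hθ β))
  have hΛ : ∀ k {f : SuperE U}, f ∈ oddE U → Λ U k f ∈ oddE U := fun k f => symbolOp_mem_oddE _
  fin_cases γ
  · exact add_mem (sub_mem (hΛ _ (hu _ (hθ _))) (hu _ (hΛ _ (hθ _))))
      (hu _ (add_mem (sub_mem (hi _ _) (hΛ _ (hi _ _))) (sub_mem (hΛ _ (hi _ _)) (hΛ _ (hi _ _)))))
  · exact hu _ (sub_mem (hΛ _ (hu _ (hθ _))) (hu _ (hθ _)))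
  · exact hu _ (add_mem (add_mem (sub_mem (hi _ _) (hΛ _ (hi _ _)))
      (sub_mem (hu _ (hθ _)) (hΛ _ (hu _ (hθ _))))) (sub_mem (hΛ _ (hi _ _)) (hΛ _ (hi _ _))))

/-! ### Schouten brackets -/

theorem schouten_two (F G : LocalFunctional U) : schouten 2 F G =
    integral (∑ α, (δθ α F * δu α G + δu α F * δθ α G)) := by
  have h : ∀ x : SuperE U, (-1) ^ 2 * x = x := fun x =>
    (congrArg (· * x) neg_one_sq).trans (one_mul x)
  rw [schouten]
  congr 1
  exact Finset.sum_congr rfl fun α _ => congrArg _ (h _)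

theorem schouten_two_add_left (F F' G : LocalFunctional U) :
    schouten 2 (F + F') G = schouten 2 F G + schouten 2 F' G := by
  rw [schouten_two, schouten_two, schouten_two, ← map_add, ← Finset.sum_add_distrib]
  congr 1
  refine Finset.sum_congr rfl fun α _ => ?_
  rw [map_add, map_add, add_mul, add_mul]
  abel

theorem schouten_two_add_right (F G G' : LocalFunctional U) :
    schouten 2 F (G + G') = schouten 2 F G + schouten 2 F G' := by
  rw [schouten_two, schouten_two, schouten_two, ← map_add, ← Finset.sum_add_distrib]
  congr 1
  refine Finset.sum_congr rfl fun α _ => ?_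
  rw [map_add, map_add, mul_add, mul_add]
  abel

theorem schouten_two_smul_left (c : ℝ) (F G : LocalFunctional U) :
    schouten 2 (c • F) G = c • schouten 2 F G := by
  rw [schouten_two, schouten_two, ← map_smul, Finset.smul_sum]
  congr 1
  refine Finset.sum_congr rfl fun α _ => ?_
  rw [map_smul, map_smul, SuperE.smul_mul, SuperE.smul_mul, smul_add]

theorem schouten_two_smul_right (c : ℝ) (F G : LocalFunctional U) :
    schouten 2 F (c • G) = c • schouten 2 F G := by
  rw [schouten_two, schouten_two, ← map_smul, Finset.smul_sum]
  congr 1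
  refine Finset.sum_congr rfl fun α _ => ?_
  rw [map_smul, map_smul, SuperE.mul_smul, SuperE.mul_smul, smul_add]

/-- When the factors commute, the two halves of the bracket coincide, so one half suffices. -/
theorem schouten_self {F : LocalFunctional U} (h : ∀ α, Commute (δu α F) (δθ α F))
    (h0 : integral (δθ 0 F * δu 0 F + δθ 1 F * δu 1 F + δθ 2 F * δu 2 F) = 0) :
    schouten 2 F F = 0 := by
  rw [schouten_two, Finset.sum_add_distrib, map_add]
  simp only [fun α => (h α).eq]
  rw [Fin.sum_univ_three, h0, add_zero]

theorem schouten_P₁_P₁ : schouten 2 (bivector (P₁ U)) (bivector (P₁ U)) = 0 := by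
  refine schouten_self U (fun α => commute_δu_P₁ U α (δθ_P₁_mem U α)) ?_
  simp only [δθ_P₁, δu_P₁]
  have h := (shiftCalculus U).first_bracket (uVar_mem 0) (uVar_mem 2) (θVar_mem_oddE 0)
    (θVar_mem_oddE 1) (θVar_mem_oddE 2)
  refine Eq.trans (congrArg integral ?_) h
  exact congrArg₂ _ ((congrArg₂ _ rfl (mul_zero _)).trans (add_zero _)) rfl

theorem schouten_P₂_P₂ : schouten 2 (bivector (P₂ U)) (bivector (P₂ U)) = 0 := by
  refine schouten_self U (fun α => commute_δu_P₂ U α (δθ_P₂_mem U α)) ?_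
  simp only [δθ_P₂, δu_P₂]
  have hθ := fun α => θVar_mem_oddE (U := U) α
  have hu := fun α β => uVar_mul_mem_oddE U α (hθ β)
  have hi := fun α β => invOp_mem_oddE U (hu α β)
  have hΛ : ∀ k {f : SuperE U}, f ∈ oddE U → Λ U k f ∈ oddE U := fun k f => symbolOp_mem_oddE _
  exact (shiftCalculus U).second_bracket (uVar_mem 0) (uVar_mem 1) (uVar_mem 2) (hθ 0) (hθ 1)
    (hθ 2) (hi 0 0) (hi 2 2) (invOp_add _) (invOp_add _) rfl
    (add_mem (add_mem (sub_mem (hi _ _) (hΛ _ (hi _ _)))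
      (sub_mem (hu _ _) (hΛ _ (hu _ _)))) (sub_mem (hΛ _ (hi _ _)) (hΛ _ (hi _ _))))

theorem schouten_P₁_P₂ : schouten 2 (bivector (P₁ U)) (bivector (P₂ U)) = 0 := by
  have hθ := fun α => θVar_mem_oddE (U := U) α
  have hi := fun α β => invOp_mem_oddE U (uVar_mul_mem_oddE U α (hθ β))
  have h := (shiftCalculus U).mixed_bracket (uVar_mem 0) (uVar_mem 1) (uVar_mem 2) (hθ 0) (hθ 1)
    (hθ 2) (hi 0 0) (hi 2 2) (invOp_add _) (invOp_add _) rfl rfl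
  -- Regroups the terms by coordinate and inserts the product with `δI₁/δv = 0`, which the stated
  -- integrand omits.
  have e (a b c d y f : SuperE U) : a + b + c + d + f = a + d + (b + 0 * y) + (c + f) := by
    rw [zero_mul]
    abel
  have h0 : δu 1 (bivector (P₁ U)) = 0 := δu_P₁ U 1
  rw [e _ _ _ _ (δθ 1 (bivector (P₂ U)))] at h
  rw [schouten_two, Fin.sum_univ_three, h0]
  simp only [δθ_P₁ U 0, δθ_P₁ U 1, δθ_P₁ U 2, δu_P₂, δu_P₁, δθ_P₂ U 0, δθ_P₂ U 2, Matrix.cons_val]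
  exact h

theorem schouten_P₂_P₁ : schouten 2 (bivector (P₂ U)) (bivector (P₁ U)) = 0 := by
  refine Eq.trans ?_ (schouten_P₁_P₂ U)
  rw [schouten_two, schouten_two]
  refine congrArg integral (Finset.sum_congr rfl fun α _ => ?_)
  rw [(commute_δu_P₁ U α (δθ_P₂_mem U α)).eq, (commute_δu_P₂ U α (δθ_P₁_mem U α)).eq, add_comm]

theorem bivector_add (P Q : Matrix (Fin 3) (Fin 3) (Op U)) :
    bivector (P + Q) = bivector P + bivector Q := by
  rw [bivector, bivector, bivector, ← smul_add, ← map_add]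
  simp only [← Finset.sum_add_distrib, Matrix.add_apply, LinearMap.add_apply, mul_add]

theorem bivector_smul (c : ℝ) (P : Matrix (Fin 3) (Fin 3) (Op U)) :
    bivector (c • P) = c • bivector P := by
  rw [bivector, bivector, smul_comm c, ← integral.map_smul c]
  simp only [Finset.smul_sum, Matrix.smul_apply, LinearMap.smul_apply, SuperE.mul_smul]

/-- Adjointness is linear and the bracket bilinear, so the four vanishing brackets settle every
linear combination. -/
theorem isBihamiltonian (U : Opens (Fin 3 → ℝ)) : IsBihamiltonian (P₁ U) (P₂ U) := by
  refine ⟨⟨fun α β => (adjPair_P₁ U α β).isAdjoint, schouten_P₁_P₁ U⟩,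
    ⟨fun α β => (adjPair_P₂ U α β).isAdjoint, schouten_P₂_P₂ U⟩, fun a b => ⟨fun α β => ?_, ?_⟩⟩
  · refine ((((adjPair_P₁ U α β).smul a).add ((adjPair_P₂ U α β).smul b)).congr rfl ?_).isAdjoint
    refine LinearMap.ext fun f => ?_
    change a • -(P₁ U β α f) + b • -(P₂ U β α f) = -(a • P₁ U β α f + b • P₂ U β α f)
    rw [smul_neg, smul_neg, neg_add]
  · simp only [bivector_add, bivector_smul, schouten_two_add_left, schouten_two_add_right,
      schouten_two_smul_left, schouten_two_smul_right, schouten_P₁_P₁, schouten_P₂_P₂,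
      schouten_P₁_P₂, schouten_P₂_P₁, smul_zero, add_zero]

end SuperJet

namespace SuperJet

/-! ### Fréchet derivatives -/

section Frechet

variable {n : ℕ} {U : Opens (Fin n → ℝ)}

theorem finOp_eq_sum_range {q : ℕ →₀ DiffPoly U} {N : ℕ} (h : ∀ s, N ≤ s → q s = 0) :
    finOp q = ∑ s ∈ Finset.range N,
      Algebra.lmul ℝ (Super U) (q s ⊗ₜ[ℝ] (1 : Grass n)) * dx ^ s := by
  refine Finset.sum_subset (fun s hs => ?_) (fun s _ hs => ?_)
  · by_contra hN
    exact Finsupp.mem_support_iff.1 hs (h s (by simpa using hN))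
  · simp [Finsupp.notMem_support_iff.1 hs]

/-- The Fréchet derivative `∑_s ∂p/∂u^{β,s} ∂ₓ^s` of a differential polynomial. -/
noncomputable def frechetFin (β : Fin n) (p : DiffPoly U) : Module.End ℝ (Super U) :=
  finOp (Finsupp.ofSupportFinite (fun s => pdU β s p) (pdU_finite β p))

theorem frechetFin_eq {β : Fin n} {p : DiffPoly U} {N : ℕ} (h : ∀ s, N ≤ s → pdU β s p = 0) :
    frechetFin β p = ∑ s ∈ Finset.range N,
      Algebra.lmul ℝ (Super U) (pdU β s p ⊗ₜ[ℝ] (1 : Grass n)) * dx ^ s :=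
  finOp_eq_sum_range h

theorem exists_pdU_eq_zero (β : Fin n) (p : DiffPoly U) :
    ∃ N, ∀ s, N ≤ s → pdU β s p = 0 := by
  obtain ⟨N, hN⟩ := (pdU_finite β p).bddAbove
  refine ⟨N + 1, fun s hs => ?_⟩
  by_contra h
  have := hN h
  omega

theorem exists_pdU_eq_zero₂ (β : Fin n) (p q : DiffPoly U) :
    ∃ N, (∀ s, N ≤ s → pdU β s p = 0) ∧ ∀ s, N ≤ s → pdU β s q = 0 := by
  obtain ⟨N, hN⟩ := exists_pdU_eq_zero β p
  obtain ⟨M, hM⟩ := exists_pdU_eq_zero β q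
  exact ⟨max N M, fun s hs => hN s (le_trans (le_max_left _ _) hs),
    fun s hs => hM s (le_trans (le_max_right _ _) hs)⟩

theorem frechetFin_add (β : Fin n) (p q : DiffPoly U) :
    frechetFin β (p + q) = frechetFin β p + frechetFin β q := by
  obtain ⟨N, hp, hq⟩ := exists_pdU_eq_zero₂ β p q
  rw [frechetFin_eq hp, frechetFin_eq hq,
    frechetFin_eq (N := N) fun s hs => by rw [map_add, hp s hs, hq s hs, add_zero],
    ← Finset.sum_add_distrib]
  refine Finset.sum_congr rfl fun s _ => ?_
  rw [map_add, TensorProduct.add_tmul, map_add, add_mul]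

theorem frechetFin_smul (β : Fin n) (c : ℝ) (p : DiffPoly U) :
    frechetFin β (c • p) = c • frechetFin β p := by
  obtain ⟨N, hp⟩ := exists_pdU_eq_zero β p
  rw [frechetFin_eq hp,
    frechetFin_eq (N := N) fun s hs => by
      rw [Derivation.map_smul, hp s hs, smul_zero], Finset.smul_sum]
  refine Finset.sum_congr rfl fun s _ => ?_
  rw [Derivation.map_smul, ← TensorProduct.smul_tmul', map_smul, smul_mul_assoc]

theorem frechetFin_mul (β : Fin n) (p q : DiffPoly U) : frechetFin β (p * q) =
    Algebra.lmul ℝ (Super U) (p ⊗ₜ[ℝ] (1 : Grass n)) * frechetFin β q +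
      Algebra.lmul ℝ (Super U) (q ⊗ₜ[ℝ] (1 : Grass n)) * frechetFin β p := by
  obtain ⟨N, hp, hq⟩ := exists_pdU_eq_zero₂ β p q
  rw [frechetFin_eq hp, frechetFin_eq hq,
    frechetFin_eq (N := N) fun s hs => by
      rw [Derivation.leibniz, hp s hs, hq s hs, smul_zero, smul_zero, add_zero],
    Finset.mul_sum, Finset.mul_sum, ← Finset.sum_add_distrib]
  refine Finset.sum_congr rfl fun s _ => ?_
  have h : ∀ a b : DiffPoly U, (a * b) ⊗ₜ[ℝ] (1 : Grass n) = a ⊗ₜ 1 * b ⊗ₜ 1 := fun a b => by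
    rw [Algebra.TensorProduct.tmul_mul_tmul, one_mul]
  rw [Derivation.leibniz, smul_eq_mul, smul_eq_mul, TensorProduct.add_tmul, h, h, map_add, map_mul,
    map_mul, add_mul, mul_assoc, mul_assoc]

/-- The rule `∂_{u^{s+1}} ∂ₓ = ∂ₓ ∂_{u^{s+1}} + ∂_{u^s}` is, coefficient by coefficient, the Leibniz
expansion of `∂ₓ ∘ (c ∂ₓ^s)`. It lets every symbol pull out of the Fréchet derivative. -/
theorem frechetFin_totalU (β : Fin n) (p : DiffPoly U) :
    frechetFin β (totalU p) = dx * frechetFin β p := by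
  obtain ⟨N, hp⟩ := exists_pdU_eq_zero β p
  have ht : ∀ s, N + 1 ≤ s → pdU β s (totalU p) = 0 := fun s hs => by
    obtain ⟨t, rfl⟩ : ∃ t, s = t + 1 := ⟨s - 1, by omega⟩
    rw [pdU_succ_totalU, hp _ (by omega), hp _ (by omega), map_zero, add_zero]
  have hd (c : DiffPoly U) (s : ℕ) : (dx : Module.End ℝ (Super U)) *
      (Algebra.lmul ℝ (Super U) (c ⊗ₜ[ℝ] (1 : Grass n)) * dx ^ s) =
      Algebra.lmul ℝ (Super U) (totalU c ⊗ₜ[ℝ] (1 : Grass n)) * dx ^ s +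
      Algebra.lmul ℝ (Super U) (c ⊗ₜ[ℝ] (1 : Grass n)) * dx ^ (s + 1) := by
    refine LinearMap.ext fun f => ?_
    simp [dx_mul, dx_tmul_one, pow_succ']
  rw [frechetFin_eq hp, frechetFin_eq ht, Finset.mul_sum, Finset.sum_range_succ', pdU_zero_totalU]
  simp only [hd, pdU_succ_totalU, TensorProduct.add_tmul, map_add, add_mul]
  rw [Finset.sum_add_distrib, Finset.sum_add_distrib, add_right_comm,
    ← Finset.sum_range_succ' (fun s => Algebra.lmul ℝ (Super U)
      (totalU (pdU β s p) ⊗ₜ[ℝ] (1 : Grass n)) * dx ^ s), Finset.sum_range_succ, hp N le_rfl,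
    map_zero, TensorProduct.zero_tmul, map_zero, zero_mul, add_zero]

theorem frechetFin_C (β : Fin n) (c : Smooth U) : frechetFin β (MvPolynomial.C c) =
    Algebra.lmul ℝ (Super U) (MvPolynomial.C (Smooth.pd β c) ⊗ₜ[ℝ] (1 : Grass n)) := by
  rw [frechetFin_eq (N := 1)]
  · simp [pdU, onCoeffs_C]
  · intro s hs
    obtain ⟨t, rfl⟩ : ∃ t, s = t + 1 := ⟨s - 1, by omega⟩
    simp [pdU]

/-- The Fréchet derivative as a linear map. -/
noncomputable def frechetLin (β : Fin n) : DiffPoly U →ₗ[ℝ] Module.End ℝ (Super U) where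
  toFun := frechetFin β
  map_add' := frechetFin_add β
  map_smul' := frechetFin_smul β

theorem frechet_eq (z : (DiffPoly U)⟦X⟧) (β : Fin n) :
    frechet z β = conv (PowerSeries.mk fun k => frechetLin β (PowerSeries.coeff k z)) :=
  diffOp_eq _

theorem frechet_add (f g : (DiffPoly U)⟦X⟧) (β : Fin n) :
    frechet (f + g) β = frechet f β + frechet g β := by
  rw [frechet_eq, frechet_eq, frechet_eq, ← map_add]
  congr 1
  ext1 k
  simp

theorem frechet_smul (c : ℝ) (f : (DiffPoly U)⟦X⟧) (β : Fin n) :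
    frechet (c • f) β = c • frechet f β := by
  rw [frechet_eq, frechet_eq, ← map_smul]
  congr 1
  ext1 k
  rw [(PowerSeries.coeff k).map_smul_of_tower c, PowerSeries.coeff_mk, PowerSeries.coeff_mk,
    coeff_smulE, map_smul]

theorem coeff_lmulSeries_ofFun (f : (DiffPoly U)⟦X⟧) (k : ℕ) :
    PowerSeries.coeff k (lmulSeries (ofFun f)) =
      Algebra.lmul ℝ (Super U) (PowerSeries.coeff k f ⊗ₜ[ℝ] (1 : Grass n)) := by
  simp [lmulSeries, ofFun]

theorem frechet_mul (f g : (DiffPoly U)⟦X⟧) (β : Fin n) : frechet (f * g) β =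
    mulOp (ofFun f) * frechet g β + mulOp (ofFun g) * frechet f β := by
  rw [frechet_eq, frechet_eq, frechet_eq, mulOp_eq, mulOp_eq, ← map_mul, ← map_mul, ← map_add]
  congr 1
  ext1 m
  simp only [map_add, PowerSeries.coeff_mul, PowerSeries.coeff_mk, map_sum, coeff_lmulSeries_ofFun]
  rw [← Finset.Nat.sum_antidiagonal_swap (f := fun p : ℕ × ℕ => Algebra.lmul ℝ (Super U)
    (PowerSeries.coeff p.1 g ⊗ₜ[ℝ] (1 : Grass n)) * frechetLin β (PowerSeries.coeff p.2 f)),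
    ← Finset.sum_add_distrib]
  exact Finset.sum_congr rfl fun p _ => frechetFin_mul β _ _

theorem frechet_symbolFun (φ : ℝ⟦X⟧) (f : (DiffPoly U)⟦X⟧) (β : Fin n) :
    frechet (symbolFun φ f) β = symbolOp U φ * frechet f β := by
  have h (k : ℕ) (p : DiffPoly U) : frechetLin β
      (((totalU.toLinearMap : Module.End ℝ (DiffPoly U)) ^ k) p) = dx ^ k * frechetLin β p := by
    induction k with
    | zero => simp
    | succ k ih =>
      rw [pow_succ', pow_succ', Module.End.mul_apply, mul_assoc, ← ih]
      exact frechetFin_totalU β _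
  rw [frechet_eq, frechet_eq, symbolOp_eq, ← map_mul]
  congr 1
  ext1 m
  rw [PowerSeries.coeff_mk, symbolFun, PowerSeries.coeff_mk, map_sum, PowerSeries.coeff_mul]
  refine Finset.sum_congr rfl fun p _ => ?_
  rw [map_smul, h, coeff_symbolSeries, PowerSeries.coeff_mk, smul_mul_assoc]

theorem frechet_C (c : Smooth U) (β : Fin n) :
    frechet (PowerSeries.C (MvPolynomial.C c)) β =
      mulOp (ofFun (PowerSeries.C (MvPolynomial.C (Smooth.pd β c)))) := by
  rw [frechet_eq, mulOp_eq]
  congr 1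
  ext1 m
  rw [PowerSeries.coeff_mk, coeff_lmulSeries_ofFun, PowerSeries.coeff_C, PowerSeries.coeff_C]
  split_ifs
  · exact frechetFin_C β c
  · simp

theorem frechet_coord (α β : Fin n) :
    frechet (PowerSeries.C (MvPolynomial.C (Smooth.coord U α))) β = if α = β then 1 else 0 := by
  rw [frechet_C, Smooth.pd_coord]
  split_ifs
  · rw [map_one, map_one, map_one, mulOp, map_one]
  · rw [map_zero, map_zero, map_zero, mulOp, map_zero]

end Frechet

end SuperJet

namespace SuperJet

/-! ### Flat coordinates of the first operator -/

section Coordinates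

variable {U : Opens (Fin 3 → ℝ)}

/-- The function `log w`. -/
noncomputable def logW (hw : ∀ x ∈ U, 0 < x 2) : Smooth U :=
  ⟨fun x => Real.log (x.1 2), fun x => by
    refine (contMDiffAt_subtype_iff (f := fun x : Fin 3 → ℝ => Real.log (x 2))).mpr ?_
    rw [contMDiffAt_iff_contDiffAt]
    exact (contDiff_apply ℝ ℝ (2 : Fin 3)).contDiffAt.log (hw x x.2).ne'⟩

/-- The function `1 / w`. -/
noncomputable def invW (hw : ∀ x ∈ U, 0 < x 2) : Smooth U :=
  ⟨fun x => (x.1 2)⁻¹, fun x => by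
    refine (contMDiffAt_subtype_iff (f := fun x : Fin 3 → ℝ => (x 2)⁻¹)).mpr ?_
    rw [contMDiffAt_iff_contDiffAt]
    exact (contDiff_apply ℝ ℝ (2 : Fin 3)).contDiffAt.inv (hw x x.2).ne'⟩

theorem pd_logW (hw : ∀ x ∈ U, 0 < x 2) (β : Fin 3) :
    Smooth.pd β (logW hw) = if 2 = β then invW hw else 0 := by
  ext x
  rw [Smooth.pd_apply, (Smooth.eventuallyEq (f := logW hw)
    (g := fun y => Real.log (y 2)) (fun _ => rfl) x).fderiv_eq (𝕜 := ℝ)]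
  have h : HasFDerivAt (fun y : Fin 3 → ℝ => Real.log (y 2))
      ((x.1 2)⁻¹ • ContinuousLinearMap.proj (R := ℝ) (φ := fun _ : Fin 3 => ℝ) 2) x.1 :=
    (ContinuousLinearMap.proj (R := ℝ) (φ := fun _ : Fin 3 => ℝ) 2).hasFDerivAt.log
      (hw x x.2).ne'
  rw [h.fderiv]
  simp only [smul_apply, ContinuousLinearMap.proj_apply, Pi.single_apply]
  split_ifs
  · exact mul_one _
  · exact mul_zero _

theorem coord_mul_invW (hw : ∀ x ∈ U, 0 < x 2) : Smooth.coord U 2 * invW hw = 1 := by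
  ext x
  exact mul_inv_cancel₀ (hw x x.2).ne'

variable (U) in
/-- The coordinate function `u^α` as a power series in `ε`. -/
noncomputable def coordFun (α : Fin 3) : (DiffPoly U)⟦X⟧ :=
  PowerSeries.C (MvPolynomial.C (Smooth.coord U α))

/-- The coordinates in which the first operator is constant. -/
noncomputable def flatCoord (hw : ∀ x ∈ U, 0 < x 2) : Fin 3 → (DiffPoly U)⟦X⟧ :=
  ![coordFun U 1 + symbolFun (shift (-1)) (coordFun U 0) * coordFun U 2 +
      symbolFun (shift (-1)) (coordFun U 2) * coordFun U 2,
    √2 • symbolFun (shift 1 + 1)⁻¹ (coordFun U 0 + coordFun U 2),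
    PowerSeries.C (MvPolynomial.C (logW hw))]

theorem ofFun_smul (c : ℝ) (f : (DiffPoly U)⟦X⟧) : ofFun (c • f) = c • ofFun f := by
  ext k
  rw [coeff_ofFun, coeff_smulE, coeff_smulE, coeff_ofFun, TensorProduct.smul_tmul']

variable (U) in
/-- Multiplication by `1 / w`. -/
noncomputable def divW (hw : ∀ x ∈ U, 0 < x 2) : Op U :=
  mulOp (ofFun (PowerSeries.C (MvPolynomial.C (invW hw))))

theorem divW_mul (hw : ∀ x ∈ U, 0 < x 2) (f : SuperE U) : divW U hw (uVar U 2 * f) = f := by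
  rw [divW, mulOp_apply, ← mul_assoc, uVar, ← map_mul, ← map_mul, ← map_mul, mul_comm (invW hw),
    coord_mul_invW, map_one, map_one, map_one, one_mul]

theorem mul_divW (hw : ∀ x ∈ U, 0 < x 2) (f : SuperE U) : uVar U 2 * divW U hw f = f := by
  rw [divW, mulOp_apply, ← mul_assoc, uVar, ← map_mul, ← map_mul, ← map_mul,
    coord_mul_invW, map_one, map_one, map_one, one_mul]

/-- Product rule and extraction of symbols. The term `(Λ⁻¹w) w` contributes twice to the `w` column:
as multiplication by `Λ⁻¹w` and as `w Λ⁻¹`. -/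
theorem frechet_flatCoord (hw : ∀ x ∈ U, 0 < x 2) :
    (Matrix.of fun α β => frechet (flatCoord hw α) β) =
    !![mulOp (uVar U 2) * Λ U (-1), 1, mulOp (Λ U (-1) (uVar U 0)) +
        (mulOp (Λ U (-1) (uVar U 2)) + mulOp (uVar U 2) * Λ U (-1));
      √2 • invOp U, 0, √2 • invOp U;
      0, 0, divW U hw] := by
  have hc (α β : Fin 3) : frechet (coordFun U α) β = if α = β then 1 else 0 := frechet_coord α β
  have hl (β : Fin 3) : frechet (PowerSeries.C (MvPolynomial.C (logW hw))) β =
      if 2 = β then divW U hw else 0 := by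
    rw [frechet_C, pd_logW]
    split_ifs
    · rfl
    · rw [map_zero, map_zero, map_zero, mulOp, map_zero]
  have he : symbolOp U (shift 1 + 1)⁻¹ = invOp U := by rw [add_comm, invOp]
  have h0 (β : Fin 3) : frechet (flatCoord hw 0) β = (if 1 = β then 1 else 0) +
      (mulOp (Λ U (-1) (uVar U 0)) * (if 2 = β then 1 else 0) +
        mulOp (uVar U 2) * (Λ U (-1) * if 0 = β then 1 else 0)) +
      (mulOp (Λ U (-1) (uVar U 2)) * (if 2 = β then 1 else 0) +
        mulOp (uVar U 2) * (Λ U (-1) * if 2 = β then 1 else 0)) := by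
    refine (frechet_add _ _ β).trans ?_
    rw [frechet_add, frechet_mul, frechet_mul, frechet_symbolFun, frechet_symbolFun, hc, hc, hc,
      ofFun_symbolFun, ofFun_symbolFun]
    rfl
  have h1 (β : Fin 3) : frechet (flatCoord hw 1) β =
      √2 • (invOp U * ((if 0 = β then 1 else 0) + (if 2 = β then 1 else 0))) := by
    refine (frechet_smul _ _ β).trans ?_
    rw [frechet_symbolFun, frechet_add, hc, hc, he]
  ext1 α β
  rw [Matrix.of_apply]
  fin_cases α
  · refine (h0 β).trans ?_
    fin_cases β <;> simp
  · refine (h1 β).trans ?_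
    fin_cases β <;> simp
  · refine (hl β).trans ?_
    fin_cases β <;> simp

variable (U) in
/-- The adjoint of the Jacobian operator of the flat coordinates. -/
noncomputable def flatAdjoint (hw : ∀ x ∈ U, 0 < x 2) : Matrix (Fin 3) (Fin 3) (Op U) :=
  !![Λ U 1 * mulOp (uVar U 2), √2 • (Λ U 1 * invOp U), 0;
    1, 0, 0;
    mulOp (Λ U (-1) (uVar U 0)) + (mulOp (Λ U (-1) (uVar U 2)) + Λ U 1 * mulOp (uVar U 2)),
      √2 • (Λ U 1 * invOp U), divW U hw]

theorem adjPair_invOp : AdjPair (invOp U) (Λ U 1 * invOp U) := by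
  refine (adjPair_symbolOp (1 + shift 1)⁻¹).congr rfl (LinearMap.ext fun f => ?_)
  rw [adjSym_inv_one_add_shift, inv_one_add_shift_neg, symbolOp_mul_apply]
  rfl

theorem isAdjoint_flatCoord (hw : ∀ x ∈ U, 0 < x 2) (α β : Fin 3) :
    IsAdjoint (frechet (flatCoord hw α) β) (flatAdjoint U hw β α) := by
  have h : frechet (flatCoord hw α) β = _ := congrFun (congrFun (frechet_flatCoord hw) α) β
  rw [h]
  have hw' : AdjPair (mulOp (uVar U 2) * Λ U (-1)) (Λ U 1 * mulOp (uVar U 2)) :=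
    (adjPair_uVar 2).mul (adjPair_Λ (-1))
  have hm (γ : Fin 3) : AdjPair (mulOp (Λ U (-1) (uVar U γ))) (mulOp (Λ U (-1) (uVar U γ))) := by
    have := adjPair_ofFun (symbolFun (shift (-1)) (coordFun U γ))
    rw [ofFun_symbolFun] at this
    exact this
  have hs := (adjPair_invOp (U := U)).smul √2
  fin_cases α <;> fin_cases β
  · exact hw'.isAdjoint
  · exact adjPair_one.isAdjoint
  · exact ((hm 0).add ((hm 2).add hw')).isAdjoint
  · exact hs.isAdjoint
  · exact AdjPair.zero.isAdjoint
  · exact hs.isAdjoint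
  · exact AdjPair.zero.isAdjoint
  · exact AdjPair.zero.isAdjoint
  · exact (adjPair_ofFun _).isAdjoint

end Coordinates

end SuperJet

namespace SuperJet

section Coordinates

variable {U : Opens (Fin 3 → ℝ)}

/-! ### Conjugation of the first operator by the Jacobian -/

theorem mul_left_comm_of_mem {a b : SuperE U} (ha : a ∈ Set.range ofFun) (f : SuperE U) :
    a * (b * f) = b * (a * f) := by
  rw [← mul_assoc, ← mul_assoc, ((shiftCalculus U).central a b ha : a * b = b * a)]

theorem flatCoord_apply (hw : ∀ x ∈ U, 0 < x 2) (α : Fin 3) (f : Fin 3 → SuperE U) :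
    ∑ β, frechet (flatCoord hw α) β (f β) =
    ![uVar U 2 * Λ U (-1) (f 0) + f 1 + (Λ U (-1) (uVar U 0) * f 2 +
        (Λ U (-1) (uVar U 2) * f 2 + uVar U 2 * Λ U (-1) (f 2))),
      √2 • invOp U (f 0) + √2 • invOp U (f 2), divW U hw (f 2)] α := by
  have h (β : Fin 3) : frechet (flatCoord hw α) β = _ :=
    congrFun (congrFun (frechet_flatCoord hw) α) β
  simp only [h]
  rw [Fin.sum_univ_three]
  fin_cases α <;> simp [mulOp_apply]

/-- The positive shifts cancel and every entry is left with a factor `w`. The outer entries are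
opposite, so the row of `z²` kills them, and division by `w` in the row of `z³` leaves `1 - Λ⁻¹`. -/
theorem P₁_flatAdjoint_zero (hw : ∀ x ∈ U, 0 < x 2) (α : Fin 3) (f : SuperE U) :
    ∑ β, P₁ U α β (flatAdjoint U hw β 0 f) =
    ![uVar U 2 * Λ U (-1) f - uVar U 2 * f,
      uVar U 2 * (Λ U (-1) (uVar U 2) * Λ U (-1) f) - uVar U 2 * (Λ U (-1) (uVar U 2) * f) +
        (uVar U 2 * (Λ U (-1) (uVar U 0) * Λ U (-1) f) - uVar U 2 * (Λ U (-1) (uVar U 0) * f)),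
      uVar U 2 * f - uVar U 2 * Λ U (-1) f] α := by
  rw [P₁_apply]
  have e0 : flatAdjoint U hw 0 0 f = Λ U 1 (uVar U 2 * f) := rfl
  have e1 : flatAdjoint U hw 1 0 f = f := rfl
  have e2 : flatAdjoint U hw 2 0 f = Λ U (-1) (uVar U 0) * f +
    (Λ U (-1) (uVar U 2) * f + Λ U 1 (uVar U 2 * f)) := rfl
  rw [e0, e1, e2]
  have hl : ∀ g : SuperE U, uVar U 0 * (Λ U 1 (uVar U 2) * g) = Λ U 1 (uVar U 2) * (uVar U 0 * g) :=
    mul_left_comm_of_mem (uVar_mem 0)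
  have hl' : ∀ g : SuperE U, uVar U 2 * (Λ U 1 (uVar U 2) * g) = Λ U 1 (uVar U 2) * (uVar U 2 * g) :=
    mul_left_comm_of_mem (uVar_mem 2)
  fin_cases α <;>
    simp only [Fin.zero_eta, Fin.mk_one, Fin.reduceFinMk, Matrix.cons_val, Λ_Λ, Int.reduceNeg,
      Int.reduceAdd, Λ_zero_apply, Λ_mul, map_add, mul_add, SuperE.mul_sub, hl, hl']
  · abel
  · abel

theorem P₁_flatAdjoint_one (hw : ∀ x ∈ U, 0 < x 2) (α : Fin 3) (f : SuperE U) :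
    ∑ β, P₁ U α β (flatAdjoint U hw β 1 f) =
    √2 • ![Λ U 2 (invOp U f) - invOp U f,
      uVar U 2 * Λ U (-1) (invOp U f) - uVar U 2 * Λ U 1 (invOp U f), 0] α := by
  rw [P₁_apply]
  have e0 : flatAdjoint U hw 0 1 f = √2 • Λ U 1 (invOp U f) := rfl
  have e1 : flatAdjoint U hw 1 1 f = 0 := rfl
  have e2 : flatAdjoint U hw 2 1 f = √2 • Λ U 1 (invOp U f) := rfl
  rw [e0, e1, e2]
  fin_cases α <;>
    simp only [Fin.zero_eta, Fin.mk_one, Fin.reduceFinMk, Matrix.cons_val, map_smul, Λ_Λ,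
      Int.reduceNeg, Int.reduceAdd, Λ_zero_apply, SuperE.mul_smul, mul_zero, map_zero, smul_sub,
      sub_zero, smul_zero, add_zero]
  abel

theorem P₁_flatAdjoint_two (hw : ∀ x ∈ U, 0 < x 2) (α : Fin 3) (f : SuperE U) :
    ∑ β, P₁ U α β (flatAdjoint U hw β 2 f) = ![0, Λ U 1 f - f, 0] α := by
  rw [P₁_apply]
  have e0 : flatAdjoint U hw 0 2 f = 0 := rfl
  have e1 : flatAdjoint U hw 1 2 f = 0 := rfl
  have e2 : flatAdjoint U hw 2 2 f = divW U hw f := rfl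
  rw [e0, e1, e2]
  fin_cases α <;>
    simp only [Fin.zero_eta, Fin.mk_one, Fin.reduceFinMk, Matrix.cons_val, mul_zero, map_zero,
      sub_zero, add_zero, zero_add, mul_divW]

theorem transformsTo_flatCoord (hw : ∀ x ∈ U, 0 < x 2) : TransformsTo (flatCoord hw) (P₁ U)
    !![0, 0, Λ U 1 - 1;
      0, (2 : ℝ) • symbolOp U ((shift 1 - 1) * (shift 1 + 1)⁻¹), 0;
      1 - Λ U (-1), 0, 0] := by
  refine ⟨flatAdjoint U hw, isAdjoint_flatCoord hw, ?_⟩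
  ext1 γ δ
  refine LinearMap.ext fun f => ?_
  have h : ((Matrix.of fun α β => frechet (flatCoord hw α) β) * P₁ U * flatAdjoint U hw) γ δ f =
      ∑ α, frechet (flatCoord hw γ) α (∑ β, P₁ U α β (flatAdjoint U hw β δ f)) := by
    rw [mul_assoc, Matrix.mul_apply, LinearMap.sum_apply]
    refine Finset.sum_congr rfl fun α _ => ?_
    rw [Matrix.mul_apply, Module.End.mul_apply, LinearMap.sum_apply]
    rfl
  rw [h, flatCoord_apply]
  fin_cases δ
  · simp only [P₁_flatAdjoint_zero, Fin.zero_eta]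
    have hl : ∀ g : SuperE U, uVar U 2 * (Λ U (-1) (uVar U 2) * g) =
      Λ U (-1) (uVar U 2) * (uVar U 2 * g) := mul_left_comm_of_mem (uVar_mem 2)
    have hl' : ∀ g : SuperE U, uVar U 2 * (Λ U (-1) (uVar U 0) * g) =
      Λ U (-1) (uVar U 0) * (uVar U 2 * g) := mul_left_comm_of_mem (uVar_mem 2)
    fin_cases γ
    · simp only [Fin.zero_eta, Matrix.cons_val, map_sub, Λ_mul, SuperE.mul_sub, hl, hl']
      change _ = (0 : SuperE U)
      abel
    · simp only [Fin.mk_one, Matrix.cons_val, map_sub]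
      change _ = (0 : SuperE U)
      rw [smul_sub, smul_sub]
      abel
    · simp only [Fin.reduceFinMk, Matrix.cons_val, map_sub, divW_mul]
      rfl
  · simp only [P₁_flatAdjoint_one, Fin.mk_one]
    fin_cases γ
    · simp only [Fin.zero_eta, Matrix.cons_val, map_sub, map_smul, Λ_Λ, SuperE.mul_sub,
        SuperE.mul_smul, smul_zero, mul_zero, add_zero, map_zero, Int.reduceAdd, Int.reduceNeg]
      change _ = (0 : SuperE U)
      rw [smul_sub, smul_sub]
      abel
    · simp only [Fin.mk_one, Matrix.cons_val, smul_zero, map_zero, map_smul, add_zero, smul_smul]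
      have e : ((2 : ℝ) • symbolOp U ((shift 1 - 1) * (shift 1 + 1)⁻¹)) f =
          (2 : ℝ) • (Λ U 1 (invOp U f) - invOp U f) := by
        rw [add_comm, LinearMap.smul_apply, symbolOp_mul_apply, symbolOp_sub, symbolOp_one]
        rfl
      refine Eq.trans ?_ e.symm
      rw [Real.mul_self_sqrt (by norm_num), map_sub, invOp_Λ]
      congr 1
      -- With `x = (1+Λ)⁻² f`, the equation for `x` and its shift give `Λ²x - x = (Λ - 1)(1+Λ)⁻¹ f`.
      have h1 := invOp_add (invOp U f)
      have h2 := congrArg (Λ U 1) h1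
      rw [map_add, Λ_Λ, one_add_one_eq_two] at h2
      generalize invOp U (invOp U f) = x at h1 h2 ⊢
      rw [← h2, ← h1]
      abel
    · simp only [Fin.reduceFinMk, Matrix.cons_val, smul_zero, map_zero]
      rfl
  · simp only [P₁_flatAdjoint_two, Fin.reduceFinMk]
    fin_cases γ <;>
      simp only [Fin.zero_eta, Fin.mk_one, Fin.reduceFinMk, Matrix.cons_val, map_zero, mul_zero,
        smul_zero, add_zero, zero_add] <;> rfl

/-! ### The coordinates at vanishing dispersion -/

theorem coeff_zero_symbolFun (φ : ℝ⟦X⟧) (f : (DiffPoly U)⟦X⟧) :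
    PowerSeries.coeff 0 (symbolFun φ f) = PowerSeries.coeff 0 φ • PowerSeries.coeff 0 f := by
  simp [symbolFun]

theorem isCoordinates_flatCoord (hw : ∀ x ∈ U, 0 < x 2) : IsCoordinates (flatCoord hw) := by
  have hC (c : ℝ) (f : Smooth U) : (MvPolynomial.C (c • f) : DiffPoly U) = c • MvPolynomial.C f :=
    (MvPolynomial.smul_monomial c).symm
  have hc (α : Fin 3) : PowerSeries.coeff 0 (coordFun U α) =
      MvPolynomial.C (Smooth.coord U α) := PowerSeries.coeff_zero_C _
  have hs (k : ℤ) : PowerSeries.coeff 0 (shift k) = 1 := by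
    rw [PowerSeries.coeff_zero_eq_constantCoeff_apply, constantCoeff_shift]
  have h0 (f g : (DiffPoly U)⟦X⟧) : PowerSeries.coeff 0 (f * g) =
      PowerSeries.coeff 0 f * PowerSeries.coeff 0 g := by
    simp only [PowerSeries.coeff_zero_eq_constantCoeff_apply, map_mul]
  -- At `ε = 0` each shift becomes `1`, so `(Λ+1)⁻¹` becomes `1/2`.
  have hi : PowerSeries.coeff 0 (shift 1 + 1)⁻¹ = (1 / 2 : ℝ) := by
    rw [PowerSeries.coeff_zero_eq_constantCoeff_apply, PowerSeries.constantCoeff_inv, map_add,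
      constantCoeff_shift, map_one]
    norm_num
  refine ⟨![Smooth.coord U 1 + Smooth.coord U 0 * Smooth.coord U 2 +
    Smooth.coord U 2 * Smooth.coord U 2,
    √2 • (1 / 2 : ℝ) • (Smooth.coord U 0 + Smooth.coord U 2), logW hw], fun α => ?_, fun x => ?_⟩
  · fin_cases α
    · change PowerSeries.coeff 0 (coordFun U 1 + symbolFun (shift (-1)) (coordFun U 0) *
        coordFun U 2 + symbolFun (shift (-1)) (coordFun U 2) * coordFun U 2) =
        MvPolynomial.C (Smooth.coord U 1 + Smooth.coord U 0 * Smooth.coord U 2 +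
          Smooth.coord U 2 * Smooth.coord U 2)
      rw [map_add, map_add, h0, h0,
        coeff_zero_symbolFun, coeff_zero_symbolFun, hc, hc, hc, hs, one_smul, one_smul, map_add,
        map_add, map_mul, map_mul]
    · change PowerSeries.coeff 0 (√2 • symbolFun (shift 1 + 1)⁻¹ (coordFun U 0 + coordFun U 2)) =
        MvPolynomial.C (√2 • (1 / 2 : ℝ) • (Smooth.coord U 0 + Smooth.coord U 2))
      rw [coeff_smulE, coeff_zero_symbolFun, hi, map_add, hc, hc, hC, hC, map_add]
    · exact PowerSeries.coeff_zero_C _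
  -- The determinant is `-1/(√2 w)`.
  · rw [Matrix.det_fin_three]
    simp [Smooth.pd_coord, pd_logW, Derivation.leibniz]
    exact inv_ne_zero (hw x x.2).ne'

end Coordinates

end SuperJet

/-! ### Assembly of the theorem -/

theorem mainTheorem3 (U : Opens (Fin 3 → ℝ)) :
    IsBihamiltonian (P₁ U) (P₂ U) ∧
    schouten 2 (bivector (P₂ U)) (bivector (P₂ U)) = 0 ∧
    schouten 2 (bivector (P₁ U)) (bivector (P₂ U)) = 0 ∧
    ((∀ x ∈ U, 0 < x 2) →
      ∃ z : Fin 3 → (DiffPoly U)⟦X⟧,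
        ofFun (z 0) = uVar U 1 + Λ U (-1) (uVar U 0) * uVar U 2
          + Λ U (-1) (uVar U 2) * uVar U 2 ∧
        ofFun (z 1) = √2 • symbolOp U (shift 1 + 1)⁻¹ (uVar U 0 + uVar U 2) ∧
        (∃ l : Smooth U, (∀ x : U, l x = Real.log (x.1 2)) ∧
          z 2 = PowerSeries.C (MvPolynomial.C l)) ∧
        IsCoordinates z ∧
        TransformsTo z (P₁ U)
          !![0, 0, Λ U 1 - 1;
            0, (2 : ℝ) • symbolOp U ((shift 1 - 1) * (shift 1 + 1)⁻¹), 0;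
            1 - Λ U (-1), 0, 0]) := by
  refine ⟨isBihamiltonian U, schouten_P₂_P₂ U, schouten_P₁_P₂ U, fun hw =>
    ⟨flatCoord hw, ?_, ?_, ⟨logW hw, fun _ => rfl, rfl⟩, isCoordinates_flatCoord hw,
      transformsTo_flatCoord hw⟩⟩
  · change ofFun (coordFun U 1 + symbolFun (shift (-1)) (coordFun U 0) * coordFun U 2 +
      symbolFun (shift (-1)) (coordFun U 2) * coordFun U 2) = _
    rw [map_add, map_add, map_mul, map_mul, ofFun_symbolFun, ofFun_symbolFun]
    rfl
  · change ofFun (√2 • symbolFun (shift 1 + 1)⁻¹ (coordFun U 0 + coordFun U 2)) = _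
    rw [ofFun_smul, ofFun_symbolFun, map_add]
    rfl
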